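/- Let $\mathbb T^2=\mathbb R^2/\mathbb Z^2$, let $V$ be the complex Hilbert space of mean-zero functions in $L^2(\mathbb T^2)$ with orthonormal basis $e_k(x)=e^{i\langle k,x\rangle}$, $k\in K:=2\pi\mathbb Z^2\setminus\{0\}$, and let $\tau,\nu>0$, $H\in(0,1)$. Let $A$ and $Q^{1/2}$ be the diagonal operators on $V$ with $Ae_k=-\alpha_k e_k$ and $Q^{1/2}e_k=\sqrt{\lambda_k}\,e_k$, where $\alpha_k=\alpha_{-k}\ge c>0$, $\alpha_k\to\infty$ as $|k|\to\infty$, $\lambda_k=\lambda_{-k}\ge 0$ and $\sup_k\lambda_k<\infty$, and let $S(t)$, $t\ge 0$, be the semigroup generated by $\nu A$, so $S(t)e_k=e^{-t\nu\alpha_k}e_k$. On a probability space $(\Omega,\mathcal F,\mathbb P)$ let $B^H=\sum_{k\in K}\beta_k e_k$, where $\beta_k$ are complex normalized fractional Brownian motions on $\mathbb R$ with Hurst parameter $H$ (that is, $\sqrt2\,\mathrm{Re}\,\beta_k$ and $\sqrt2\,\mathrm{Im}\,\beta_k$ are independent real normalized two-sided fractional Brownian motions), independent for different $k$ except that $\beta_{-k}=\overline{\beta_k}$.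 A mild solution of $$d\psi_t=\nu A\psi_t\,dt+\nu^H Q^{1/2}\,dB^H_t \tag{1}$$ on the time axis $\mathbb R$ is a jointly measurable $V$-valued process $(\psi(t))_{t\in\mathbb R}$ such that for all $s\le t$, $\mathbb P$-a.s., $$\psi(t)=S(t-s)\psi(s)+\sum_{k\in K}\sqrt{\lambda_k}\,\nu^H\int_s^t e^{-(t-u)\nu\alpha_k}\,d\beta_k(u)\,e_k ,$$ the series converging in $L^2(\Omega,V)$. It is strictly stationary if its finite-dimensional distributions are invariant under time shifts. A $C^m$-version of $\psi$ is a real-valued random field $\Psi(t,x)$ such that for every $t\in\mathbb R$, $\mathbb P$-a.s., $\Psi(t,\cdot)=\psi(t)$ in $V$, and such that $\mathbb P$-a.s. $\Psi\in C(\mathbb R,C^m(\mathbb T^2))$. Assume that there are $m\in\mathbb N$, $m\ge 2$, and $\gamma\in(0,1)$ such that $$\sum_{k\in K}\lambda_k\alpha_k^{2\gamma-2H}|k|^{2m}<\infty\qquad\text{and}\qquad \sum_{k\in K}\lambda_k\alpha_k^{-2H}|k|^{2m+2\gamma}<\infty .$$ Then (1) has a strictly stationary mild solution $\psi$ on $\mathbb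 R$ which is given, with convergence in $L^2(\Omega,V)$, by $$\psi(t)=\sum_{k\in K}\sqrt{\lambda_k}\,\nu^H\int_{-\infty}^t e^{-(t-u)\nu\alpha_k}\,d\beta_k(u)\,e_k,\qquad t\in\mathbb R.$$ Moreover, every strictly stationary mild solution $\psi$ of (1) on $\mathbb R$ (in particular the ergodic one) has a $C^m$-version, and for every $C^m$-version $\Psi$ of it, $\mathbb P$-a.s., the particle equation $$\tau\ddot x(t)=\nabla^\perp\Psi(x(t),t)-\dot x(t),\qquad \nabla^\perp\Psi=\Big(\frac{\partial\Psi}{\partial x_2},-\frac{\partial\Psi}{\partial x_1}\Big),\qquad (x(0),\dot x(0))\in\mathbb T^2\times\mathbb R^2,$$ has a unique global $C^{m-1}$-solution. That is, $\mathbb P$-a.s. there is $\varphi\in C^1\big(\mathbb R,C^{m-1}(\mathbb T^2\times\mathbb R^2,\mathbb T^2\times\mathbb R^2)\big)$ such that for every $z\in\mathbb T^2\times\mathbb R^2$ the curve $t\mapsto\varphi(t)(z)=(x(t),\dot x(t))$ satisfies the equation for all $t\in\mathbb R$ with $\varphi(0)(z)=z$, and any solution with initial value $z$ on an open interval containing $0$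 coincides there with $\varphi(\cdot)(z)$. -/

import Mathlib

open MeasureTheory ProbabilityTheory Filter Topology

namespace InertialParticle

noncomputable section

/-! ### The torus, wave vectors and the space `V` -/

/-- The torus `𝕋² = ℝ² / ℤ²`. -/
abbrev Torus : Type := UnitAddTorus (Fin 2)

/-- The plane `ℝ²`. Only its topology and its linear structure are used. -/
abbrev Plane : Type := Fin 2 → ℝ

/-- The covering map `ℝ² → 𝕋²`. -/
def proj (v : Plane) : Torus := fun i => (v i : UnitAddCircle)

/-- Lebesgue (normalised Haar) measure on the torus. -/
abbrev torusMeasure : Measure Torus := Measure.pi fun _ => AddCircle.haarAddCircle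

/-- Index set of the wave vectors: `n ∈ ℤ² \ {0}` stands for `k = 2πn ∈ K = 2πℤ² \ {0}`. -/
abbrev Mode : Type := {n : Fin 2 → ℤ // n ≠ 0}

/-- The mode `-k`. -/
def negMode (k : Mode) : Mode := ⟨-k.1, neg_ne_zero.mpr k.2⟩

/-- The Euclidean length `|k|` of the wave vector `k = 2πn`. -/
def waveNorm (k : Mode) : ℝ := 2 * Real.pi * √((k.1 0 : ℝ) ^ 2 + (k.1 1 : ℝ) ^ 2)

/-- `V`, the complex Hilbert space of square integrable functions on the torus with mean zero,
with the inner product of `L²`. -/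
def V : Submodule ℂ (Lp ℂ 2 torusMeasure) where
  carrier := {f | ∫ x, f x ∂torusMeasure = 0}
  zero_mem' := by
    simp
  add_mem' := by
    intro f g hf hg
    have hf' : ∫ x, f x ∂torusMeasure = 0 := hf
    have hg' : ∫ x, g x ∂torusMeasure = 0 := hg
    have h : ∫ x, (f + g) x ∂torusMeasure = ∫ x, (f x + g x) ∂torusMeasure :=
      integral_congr_ae (Lp.coeFn_add f g)
    have hi : ∀ f : Lp ℂ 2 torusMeasure, Integrable f torusMeasure :=
      fun f => (Lp.memLp f).integrable (by norm_num)
    rw [Set.mem_ofPred_eq, h, integral_add (hi f) (hi g), hf', hg', add_zero]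
  smul_mem' := by
    intro c f hf
    have hf' : ∫ x, f x ∂torusMeasure = 0 := hf
    have h : ∫ x, (c • f) x ∂torusMeasure = ∫ x, c • f x ∂torusMeasure :=
      integral_congr_ae (Lp.coeFn_smul c f)
    rw [Set.mem_ofPred_eq, h, integral_smul, hf', smul_zero]

instance : MeasurableSpace V := borel V

instance : BorelSpace V := ⟨rfl⟩

theorem mFourierLp_mem_V (k : Mode) :
    (UnitAddTorus.mFourierLp 2 k.1 : Lp ℂ 2 torusMeasure) ∈ V := by
  have h := (UnitAddTorus.orthonormal_mFourier (d := Fin 2)).2 (Ne.symm k.2)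
  have h2 : inner ℂ (UnitAddTorus.mFourierLp 2 (0 : Fin 2 → ℤ) : Lp ℂ 2 torusMeasure)
      (UnitAddTorus.mFourierLp 2 k.1 : Lp ℂ 2 torusMeasure) = 0 := h
  rw [MeasureTheory.L2.inner_def] at h2
  change ∫ x, (UnitAddTorus.mFourierLp 2 k.1 : Lp ℂ 2 torusMeasure) x ∂torusMeasure = 0
  rw [← h2]
  refine integral_congr_ae ?_
  have h0 : (UnitAddTorus.mFourierLp 2 (0 : Fin 2 → ℤ) : Lp ℂ 2 torusMeasure) =ᵐ[torusMeasure]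
    UnitAddTorus.mFourier 0 := UnitAddTorus.coeFn_mFourierLp 2 (0 : Fin 2 → ℤ)
  filter_upwards [h0] with x hx
  rw [hx, UnitAddTorus.mFourier_zero]
  simp

/-- The orthonormal basis vector `e_k(x) = exp (i ⟨k, x⟩)` of `V`. -/
def e (k : Mode) : V := ⟨UnitAddTorus.mFourierLp 2 k.1, mFourierLp_mem_V k⟩

/-! ### The data of the model -/

/-- Standing assumptions on the parameters. The operator `A` on `V` is the diagonal operator with
`A e_k = -α_k e_k` on its maximal domain, and `Q^{1/2}` is the bounded diagonal operator with
`Q^{1/2} e_k = √λ_k e_k`. -/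
structure Assumptions (τ ν H : ℝ) (α lam : Mode → ℝ) : Prop where
  tau_pos : 0 < τ
  nu_pos : 0 < ν
  hurst_pos : 0 < H
  hurst_lt_one : H < 1
  alpha_lower : ∃ c : ℝ, 0 < c ∧ ∀ k, c ≤ α k
  alpha_symm : ∀ k, α (negMode k) = α k
  alpha_tendsto : Tendsto α cofinite atTop
  lam_nonneg : ∀ k, 0 ≤ lam k
  lam_symm : ∀ k, lam (negMode k) = lam k
  lam_bounded : ∃ M : ℝ, ∀ k, lam k ≤ M

variable {Ω : Type*} [MeasurableSpace Ω]

/-- A real, normalised, two-sided fractional Brownian motion with Hurst parameter `H`. -/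
structure IsFBM (H : ℝ) (X : ℝ → Ω → ℝ) (P : Measure Ω) : Prop where
  measurable : ∀ t, Measurable (X t)
  gaussian : IsGaussianProcess X P
  zero : ∀ᵐ ω ∂P, X 0 ω = 0
  mean : ∀ t, ∫ ω, X t ω ∂P = 0
  cov : ∀ s t, ∫ ω, X s ω * X t ω ∂P =
    (1 / 2) * (|s| ^ (2 * H) + |t| ^ (2 * H) - |s - t| ^ (2 * H))
  continuous_paths : ∀ᵐ ω ∂P, Continuous fun t => X t ω

/-- The coefficients `β_k` of the infinite-dimensional fractional Brownian motion
`B^H = ∑ β_k e_k`: complex normalised fractional Brownian motions, with `β_{-k}` the conjugate of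
`β_k`, and otherwise independent. -/
structure IsModeFBM (H : ℝ) (β : Mode → ℝ → Ω → ℂ) (P : Measure Ω) : Prop where
  re_fbm : ∀ k, IsFBM H (fun t ω => √2 * (β k t ω).re) P
  im_fbm : ∀ k, IsFBM H (fun t ω => √2 * (β k t ω).im) P
  re_im_indep : ∀ k, IndepFun (fun ω t => (β k t ω).re) (fun ω t => (β k t ω).im) P
  conj : ∀ k, ∀ᵐ ω ∂P, ∀ t, β (negMode k) t ω = (starRingEnd ℂ) (β k t ω)
  indep : ∀ S : Set Mode, (∀ k ∈ S, negMode k ∉ S) →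
    iIndepFun (fun (k : S) ω t => β k.1 t ω) P

/-! ### Stochastic integrals of deterministic functions, pathwise -/

/-- `I` is the Riemann–Stieltjes integral `∫_a^b f dg` (for `a ≤ b`): the limit of the sums over
tagged partitions `a = u 0 ≤ u 1 ≤ ⋯ ≤ u n = b` as the mesh tends to zero. -/
def HasRSIntegral (f : ℝ → ℝ) (g : ℝ → ℂ) (a b : ℝ) (I : ℂ) : Prop :=
  ∀ ε > 0, ∃ δ > 0, ∀ (n : ℕ) (u ξ : ℕ → ℝ), u 0 = a → u n = b →
    (∀ i < n, ξ i ∈ Set.Icc (u i) (u (i + 1)) ∧ u (i + 1) - u i < δ) →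
    ‖∑ i ∈ Finset.range n, (f (ξ i) : ℂ) * (g (u (i + 1)) - g (u i)) - I‖ < ε

open Classical in
/-- The Riemann–Stieltjes integral `∫_a^b f dg` for `a ≤ b` (zero if it does not exist). -/
def rsIntegral (f : ℝ → ℝ) (g : ℝ → ℂ) (a b : ℝ) : ℂ :=
  if h : ∃ I, HasRSIntegral f g a b I then h.choose else 0

/-- The improper integral `∫_{-∞}^b f dg`. -/
def rsIntegralIic (f : ℝ → ℝ) (g : ℝ → ℂ) (b : ℝ) : ℂ :=
  limUnder atBot fun a => rsIntegral f g a b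

/-- `√λ_k ν^H ∫_s^t exp (-(t-u) ν α_k) dβ_k(u)`. -/
def convCoeff (ν H : ℝ) (α lam : Mode → ℝ) (β : Mode → ℝ → Ω → ℂ) (s t : ℝ) (k : Mode)
    (ω : Ω) : ℂ :=
  ((√(lam k) * ν ^ H : ℝ) : ℂ) *
    rsIntegral (fun u => Real.exp (-(t - u) * ν * α k)) (fun u => β k u ω) s t

/-- `√λ_k ν^H ∫_{-∞}^t exp (-(t-u) ν α_k) dβ_k(u)`. -/
def statCoeff (ν H : ℝ) (α lam : Mode → ℝ) (β : Mode → ℝ → Ω → ℂ) (t : ℝ) (k : Mode)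
    (ω : Ω) : ℂ :=
  ((√(lam k) * ν ^ H : ℝ) : ℂ) *
    rsIntegralIic (fun u => Real.exp (-(t - u) * ν * α k)) (fun u => β k u ω) t

/-- The series `∑_k X_k` converges (unconditionally) in `L²(Ω, V)` with sum `Z`. -/
def HasL2Sum (P : Measure Ω) (X : Mode → Ω → V) (Z : Ω → V) : Prop :=
  (∀ k, MemLp (X k) 2 P) ∧ MemLp Z 2 P ∧
    Tendsto (fun F : Finset Mode => eLpNorm (fun ω => Z ω - ∑ k ∈ F, X k ω) 2 P) atTop (𝓝 0)

/-! ### Strictly stationary mild solutions -/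

/-- The semigroup `S(t)`, `t ≥ 0`, generated by `νA`: `S(t) e_k = exp (-t ν α_k) e_k`. -/
def semigroup (ν : ℝ) (α : Mode → ℝ) (t : ℝ) (f : V) : V :=
  ∑' k, ((Real.exp (-t * ν * α k) : ℂ) * inner ℂ (e k) f) • e k

/-- `ψ` is a mild solution, on the time axis `ℝ`, of `dψ = ν A ψ dt + ν^H Q^{1/2} dB^H`: it is
jointly measurable and for all `s ≤ t`, almost surely,
`ψ(t) = S(t-s) ψ(s) + ∫_s^t S(t-r) Q^{1/2} dB^H(r)`, where the stochastic integral is the sum in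
`L²(Ω, V)` of the series `∑_k √λ_k ν^H ∫_s^t exp (-(t-r) ν α_k) dβ_k(r) e_k` (the factor `ν^H` is
part of the integral). -/
def IsMildSolution (P : Measure Ω) (ν H : ℝ) (α lam : Mode → ℝ) (β : Mode → ℝ → Ω → ℂ)
    (ψ : ℝ → Ω → V) : Prop :=
  Measurable (fun p : ℝ × Ω => ψ p.1 p.2) ∧
    ∀ s t : ℝ, s ≤ t → ∃ Z : Ω → V,
      HasL2Sum P (fun k ω => convCoeff ν H α lam β s t k ω • e k) Z ∧
        ∀ᵐ ω ∂P, ψ t ω = semigroup ν α (t - s) (ψ s ω) + Z ω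

/-- Strict stationarity: finite-dimensional distributions are invariant under time shifts. -/
def IsStrictlyStationary (P : Measure Ω) (ψ : ℝ → Ω → V) : Prop :=
  ∀ (n : ℕ) (t : Fin n → ℝ) (r : ℝ),
    P.map (fun ω (i : Fin n) => ψ (t i + r) ω) = P.map (fun ω (i : Fin n) => ψ (t i) ω)

/-! ### Families of `Cⁿ` maps -/

section Families

variable {E G : Type*} [NormedAddCommGroup E] [NormedSpace ℝ E] [NormedAddCommGroup G]
  [NormedSpace ℝ G]

/-- `F ∈ C(ℝ, Cⁿ(E, G))`, where `Cⁿ(E, G)` carries the topology of locally uniform convergence of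
all derivatives of order at most `n`. For maps that are periodic in `E = ℝ²`, that is, maps on
`𝕋²`, this is the topology of the `Cⁿ` norm. -/
def ContinuousInCn (n : ℕ) (F : ℝ → E → G) : Prop :=
  (∀ t, ContDiff ℝ n (F t)) ∧
    ∀ i ≤ n, ∀ t₀ : ℝ, TendstoLocallyUniformly (fun t x => iteratedFDeriv ℝ i (F t) x)
      (fun x => iteratedFDeriv ℝ i (F t₀) x) (𝓝 t₀)

/-- `F ∈ C¹(ℝ, Cⁿ(E, G))`: there is `F' ∈ C(ℝ, Cⁿ(E, G))` such that the difference quotients of `F`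
in time converge to `F'` in `Cⁿ(E, G)`. -/
def C1InCn (n : ℕ) (F : ℝ → E → G) : Prop :=
  ContinuousInCn n F ∧ ∃ F' : ℝ → E → G, ContinuousInCn n F' ∧
    ∀ i ≤ n, ∀ t₀ : ℝ, TendstoLocallyUniformly
      (fun t x => (t - t₀)⁻¹ • (iteratedFDeriv ℝ i (F t) x - iteratedFDeriv ℝ i (F t₀) x))
      (fun x => iteratedFDeriv ℝ i (F' t₀) x) (𝓝[≠] t₀)

end Families

/-- `Ψ` is a real-valued version of `ψ`, a random field `Ψ(t, x)`, with almost surely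
`Ψ ∈ C(ℝ, Cᵐ(𝕋²))`. -/
def IsCmVersion (P : Measure Ω) (m : ℕ) (ψ : ℝ → Ω → V) (Ψ : ℝ → Torus → Ω → ℝ) : Prop :=
  (∀ t x, Measurable (Ψ t x)) ∧
    (∀ t, ∀ᵐ ω ∂P, (ψ t ω : Lp ℂ 2 torusMeasure) =ᵐ[torusMeasure] fun x => (Ψ t x ω : ℂ)) ∧
    ∀ᵐ ω ∂P, ContinuousInCn m fun (t : ℝ) (v : Plane) => Ψ t (proj v) ω

/-! ### The particle equation on `𝕋² × ℝ²` -/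

/-- The phase space `𝕋² × ℝ²` of pairs `(x, ẋ)`. -/
abbrev Phase : Type := Torus × Plane

/-- The partial derivative `∂f/∂x_i` on the torus. -/
def partialDeriv (i : Fin 2) (f : Torus → ℝ) (x : Torus) : ℝ :=
  deriv (fun h : ℝ => f (x + proj (Pi.single i h))) 0

/-- `∇^⊥ f = (∂f/∂x₂, -∂f/∂x₁)`. -/
def perpGrad (f : Torus → ℝ) (x : Torus) : Plane :=
  ![partialDeriv 1 f x, -partialDeriv 0 f x]

/-- The curve `x` in the torus is differentiable at `t` with velocity `v`: some lift of `x` to `ℝ²`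
near `t` has derivative `v` at `t`. -/
def HasTorusDerivAt (x : ℝ → Torus) (v : Plane) (t : ℝ) : Prop :=
  ∃ ξ : ℝ → Plane, (∀ᶠ s in 𝓝 t, proj (ξ s) = x s) ∧ HasDerivAt ξ v t

/-- The curve `Z = (x, y)` satisfies `ẋ = y`, `ẏ = (∇^⊥ψ(x, t) - y) / τ` at all times `t ∈ J`. -/
def SolvesOn (τ : ℝ) (ψ : ℝ → Torus → ℝ) (J : Set ℝ) (Z : ℝ → Phase) : Prop :=
  ∀ t ∈ J, HasTorusDerivAt (fun s => (Z s).1) (Z t).2 t ∧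
    HasDerivAt (fun s => (Z s).2) (τ⁻¹ • (perpGrad (ψ t) (Z t).1 - (Z t).2)) t

/-- `φ ∈ C¹(ℝ, Cⁿ(𝕋² × ℝ², 𝕋² × ℝ²))`, expressed by a lift of `φ` to the universal cover. -/
def PhaseC1InCn (n : ℕ) (φ : ℝ → Phase → Phase) : Prop :=
  ∃ Φ : ℝ → Plane × Plane → Plane × Plane, C1InCn n Φ ∧
    ∀ t x y, φ t (proj x, y) = (proj (Φ t (x, y)).1, (Φ t (x, y)).2)

/-- The particle equation `τ ẍ = ∇^⊥ψ(x, t) - ẋ` has a unique global `Cⁿ`-solution: there is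
`φ ∈ C¹(ℝ, Cⁿ(𝕋² × ℝ², 𝕋² × ℝ²))` such that, for every initial value `z`, `t ↦ φ t z` solves the
equation on `ℝ`, and every solution with initial value `z` on an open interval containing `0`
agrees there with it. -/
def HasUniqueGlobalSolution (n : ℕ) (τ : ℝ) (ψ : ℝ → Torus → ℝ) : Prop :=
  ∃ φ : ℝ → Phase → Phase, PhaseC1InCn n φ ∧
    ∀ z : Phase, φ 0 z = z ∧ SolvesOn τ ψ Set.univ (fun t => φ t z) ∧
      ∀ (J : Set ℝ) (Z : ℝ → Phase), IsOpen J → J.OrdConnected → 0 ∈ J → Z 0 = z →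
        SolvesOn τ ψ J Z → ∀ t ∈ J, Z t = φ t z

end

end InertialParticle

/-! The theorem splits into a probabilistic half, which produces a random field in C(ℝ, Cᵐ), and a
deterministic half, which solves the particle equation for a fixed field.

Stationary solution. Paths of fractional Brownian motion grow at most polynomially, so after an
integration by parts the integral over (-∞, t] becomes the pathwise functional ∫₀^∞ a e^{-av} (g(t)
- g(t-v)) dv with a = να_k (`ouInt`). It depends only on increments of g, and these are stationary;
hence the coefficients are jointly stationary, and they satisfy the mild equation mode by mode
(`exists_isOUFamily`). Parseval and the summability of λ_k α_k^{-2H} give convergence in L²(Ω, V).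
Two stationary mild solutions driven by the same noise differ by S(t-s)(ψ(s) - φ(s)); the semigroup
contracts exponentially while the laws at time s do not depend on s, so s → -∞ shows that they agree
almost surely at each time (`IsMildSolution.ae_eq`). It is therefore enough to find a smooth version
of one of them.

Regularity. The functional `ouInt` is an almost sure limit of finite averages of Gaussian
increments. It is sub-Gaussian with parameter of order a^{-2H}, and its increments have parameter of
order min(a^{-2H}, |t-s|^{2H}) ≤ a^{2γ-2H} |t-s|^{2γ} for γ ≤ H. Choosing one mode from each pair ±k
gives independent coefficients, so parameters add, and the two series of the hypothesis control the
time and the space increments of all partial derivatives of order at most m. Sub-Gaussian variables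
have moments of all orders; dyadic chaining in time and space (`exists_sup_bound`) thus bounds the
supremum of a block of modes. The blocks are chosen so that their parameters decay like 8^{-N}, and
the block series then converges geometrically in Cᵐ, locally uniformly in time
(`IsOUFamily.exists_isCmVersion`). Lowering γ to min(γ, H) is harmless because α is bounded below
and wave numbers are at least one.

Particle equation. Lifted to ℝ² × ℝ², the vector field is linear in the velocity up to a term
periodic in the position. Since m ≥ 2, it is globally Lipschitz in the state, uniformly on bounded
time intervals. Picard iteration gives a global flow; it inherits the regularity of the field, by
induction through the variational equation (`jointCn_flow`). By uniqueness the flow commutes with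
lattice translations and so descends to the torus. -/

namespace InertialParticle

/-! ### Families of `Cⁿ` maps with jointly continuous derivatives -/

section JointCn

variable {E F G : Type*} [NormedAddCommGroup E] [NormedSpace ℝ E] [NormedAddCommGroup F]
  [NormedSpace ℝ F] [NormedAddCommGroup G] [NormedSpace ℝ G]

/-- Every `f t` is `Cⁿ`, and the derivatives of order at most `n` are jointly continuous. -/
def JointCn (n : ℕ) (f : ℝ → E → F) : Prop :=
  (∀ t, ContDiff ℝ n (f t)) ∧
    ∀ i ≤ n, Continuous fun p : ℝ × E => iteratedFDeriv ℝ i (f p.1) p.2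

/-- Locally uniform convergence to a continuous limit amounts to joint continuity, and the limits
are continuous in x because each f t is Cⁿ. Joint continuity is the form that behaves well under
composition and induction on n. -/
theorem continuousInCn_iff_jointCn {n : ℕ} {f : ℝ → E → F} :
    ContinuousInCn n f ↔ JointCn n f := by
  refine and_congr_right fun hf => forall₂_congr fun i hi => ?_
  constructor
  · intro h
    refine continuous_iff_continuousAt.2 fun ⟨t₀, x₀⟩ => ?_
    have hc : Continuous (iteratedFDeriv ℝ i (f t₀)) :=
      (hf t₀).continuous_iteratedFDeriv (by exact_mod_cast hi)
    rw [Metric.continuousAt_iff']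
    intro ε hε
    have h1 := Metric.tendstoLocallyUniformly_iff.1 (h t₀) (ε / 2) (half_pos hε) x₀
    obtain ⟨N, hN, hev⟩ := h1
    have h2 := Metric.continuousAt_iff'.1 (hc.continuousAt (x := x₀)) (ε / 2) (half_pos hε)
    have h3 : ∀ᶠ p : ℝ × E in 𝓝 (t₀, x₀), (∀ y ∈ N, dist (iteratedFDeriv ℝ i (f t₀) y)
        (iteratedFDeriv ℝ i (f p.1) y) < ε / 2) ∧ p.2 ∈ N ∧
        dist (iteratedFDeriv ℝ i (f t₀) p.2) (iteratedFDeriv ℝ i (f t₀) x₀) < ε / 2 := by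
      rw [nhds_prod_eq]
      exact (hev.prod_inl _).and ((Filter.Eventually.prod_inr hN _).and (h2.prod_inr _))
    filter_upwards [h3] with p hp
    have := hp.1 p.2 hp.2.1
    rw [dist_comm] at this
    linarith [dist_triangle (iteratedFDeriv ℝ i (f p.1) p.2) (iteratedFDeriv ℝ i (f t₀) p.2)
      (iteratedFDeriv ℝ i (f t₀) x₀), hp.2.2]
  · intro h t₀
    rw [Metric.tendstoLocallyUniformly_iff]
    intro ε hε x₀
    have h1 := Metric.continuousAt_iff'.1 (h.continuousAt (x := (t₀, x₀))) (ε / 2) (half_pos hε)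
    rw [nhds_prod_eq, Filter.eventually_prod_iff] at h1
    obtain ⟨pa, ha, pb, hb, hab⟩ := h1
    refine ⟨{x | pb x}, hb, ?_⟩
    filter_upwards [ha] with t ht y hy
    have h2 := hab ht hy
    have h3 := hab ha.self_of_nhds hy
    rw [dist_comm] at h2
    exact (dist_triangle_right _ _ _).trans_lt (by rw [dist_comm] at h2; linarith)

theorem JointCn.of_le {m n : ℕ} {f : ℝ → E → F} (h : JointCn n f) (hmn : m ≤ n) : JointCn m f :=
  ⟨fun t => (h.1 t).of_le (by exact_mod_cast hmn), fun i hi => h.2 i (hi.trans hmn)⟩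

theorem jointCn_zero_iff {f : ℝ → E → F} :
    JointCn 0 f ↔ Continuous fun p : ℝ × E => f p.1 p.2 := by
  constructor
  · intro h
    have := h.2 0 le_rfl
    simp only [iteratedFDeriv_zero_eq_comp] at this
    exact ((continuousMultilinearCurryFin0 ℝ E F).continuous.comp this).congr fun p =>
      (continuousMultilinearCurryFin0 ℝ E F).apply_symm_apply _
  · intro h
    refine ⟨fun t => ?_, fun i hi => ?_⟩
    · have : Continuous (f t) := h.comp (by fun_prop : Continuous fun x : E => (t, x))
      exact_mod_cast contDiff_zero.2 this
    · obtain rfl : i = 0 := by omega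
      simp only [iteratedFDeriv_zero_eq_comp]
      exact (continuousMultilinearCurryFin0 ℝ E F).symm.continuous.comp h

theorem JointCn.continuous {n : ℕ} {f : ℝ → E → F} (h : JointCn n f) :
    Continuous fun p : ℝ × E => f p.1 p.2 :=
  jointCn_zero_iff.1 (h.of_le n.zero_le)

/-- The induction device: up to a currying isometry, the derivative of order i + 1 is the derivative
of order i of `fderiv`. -/
theorem jointCn_succ_iff {n : ℕ} {f : ℝ → E → F} :
    JointCn (n + 1) f ↔ (∀ t, Differentiable ℝ (f t)) ∧
      (Continuous fun p : ℝ × E => f p.1 p.2) ∧ JointCn n fun t x => fderiv ℝ (f t) x := by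
  have hcd : ∀ t, ContDiff ℝ ((n + 1 : ℕ)) (f t) ↔
      Differentiable ℝ (f t) ∧ ContDiff ℝ n (fderiv ℝ (f t)) := fun t => by
    have := contDiff_succ_iff_fderiv (𝕜 := ℝ) (f := f t) (n := n)
    push_cast
    rw [this]
    simp
  have hit : ∀ i, (Continuous fun p : ℝ × E => iteratedFDeriv ℝ (i + 1) (f p.1) p.2) ↔
      Continuous fun p : ℝ × E => iteratedFDeriv ℝ i (fderiv ℝ (f p.1)) p.2 := fun i => by
    simp only [iteratedFDeriv_succ_eq_comp_right, Function.comp_def]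
    exact (continuousMultilinearCurryRightEquiv' ℝ i E F).symm.toHomeomorph.comp_continuous_iff
      (f := fun p : ℝ × E => iteratedFDeriv ℝ i (fderiv ℝ (f p.1)) p.2)
  constructor
  · intro h
    exact ⟨fun t => ((hcd t).1 (h.1 t)).1, h.continuous, fun t => ((hcd t).1 (h.1 t)).2,
      fun i hi => (hit i).1 (h.2 (i + 1) (by omega))⟩
  · rintro ⟨h1, h2, h3⟩
    refine ⟨fun t => (hcd t).2 ⟨h1 t, h3.1 t⟩, fun i hi => ?_⟩
    cases i with
    | zero => exact (jointCn_zero_iff.2 h2).2 0 le_rfl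
    | succ i => exact (hit i).2 (h3.2 i (by omega))

theorem JointCn.clm_comp {n : ℕ} {f : ℝ → E → F} (h : JointCn n f) (L : F →L[ℝ] G) :
    JointCn n fun t x => L (f t x) := by
  refine ⟨fun t => L.contDiff.comp (h.1 t), fun i hi => ?_⟩
  have : ∀ p : ℝ × E, iteratedFDeriv ℝ i (fun x => L (f p.1 x)) p.2 =
      L.compContinuousMultilinearMap (iteratedFDeriv ℝ i (f p.1) p.2) := fun p =>
    L.iteratedFDeriv_comp_left (h.1 p.1).contDiffAt (by exact_mod_cast hi)
  simp only [this]
  exact (ContinuousLinearMap.compContinuousMultilinearMapL ℝ (fun _ : Fin i => E) F G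
    L).continuous.comp (h.2 i hi)

theorem JointCn.add {n : ℕ} {f g : ℝ → E → F} (hf : JointCn n f) (hg : JointCn n g) :
    JointCn n fun t x => f t x + g t x := by
  refine ⟨fun t => (hf.1 t).add (hg.1 t), fun i hi => ?_⟩
  have : ∀ p : ℝ × E, iteratedFDeriv ℝ i (fun x => f p.1 x + g p.1 x) p.2 =
      iteratedFDeriv ℝ i (f p.1) p.2 + iteratedFDeriv ℝ i (g p.1) p.2 := fun p =>
    iteratedFDeriv_add_apply ((hf.1 p.1).of_le (by exact_mod_cast hi)).contDiffAt
      ((hg.1 p.1).of_le (by exact_mod_cast hi)).contDiffAt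
  simp only [this]
  exact (hf.2 i hi).add (hg.2 i hi)

theorem JointCn.prodMk {n : ℕ} {f : ℝ → E → F} {g : ℝ → E → G} (hf : JointCn n f)
    (hg : JointCn n g) : JointCn n fun t x => (f t x, g t x) := by
  have := (hf.clm_comp (ContinuousLinearMap.inl ℝ F G)).add
    (hg.clm_comp (ContinuousLinearMap.inr ℝ F G))
  simpa using this

theorem jointCn_const {n : ℕ} {f : E → F} (hf : ContDiff ℝ n f) : JointCn n fun _ : ℝ => f :=
  ⟨fun _ => hf, fun _ hi => (hf.continuous_iteratedFDeriv (by exact_mod_cast hi)).comp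
    continuous_snd⟩

end JointCn

/-! ### Chain rule for families of Cⁿ maps -/

section JointCnComp

universe u

/-- The derivative is the bilinear composition map applied to a pair of derivatives, so the
induction hypothesis serves twice. The spaces change to spaces of linear maps along the induction,
which is why they are quantified inside it and share a universe. -/
theorem JointCn.comp {n : ℕ} : ∀ {E F G : Type u} [NormedAddCommGroup E] [NormedSpace ℝ E]
    [NormedAddCommGroup F] [NormedSpace ℝ F] [NormedAddCommGroup G] [NormedSpace ℝ G]
    {g : ℝ → F → G} {f : ℝ → E → F}, JointCn n g → JointCn n f →
    JointCn n fun t x => g t (f t x) := by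
  induction n with
  | zero =>
    intro E F G _ _ _ _ _ _ g f hg hf
    rw [jointCn_zero_iff] at *
    exact hg.comp (continuous_fst.prodMk hf)
  | succ n ih =>
    intro E F G _ _ _ _ _ _ g f hg hf
    have hc := hg.continuous.comp (continuous_fst.prodMk hf.continuous)
    have hf0 := hf.of_le n.le_succ
    rw [jointCn_succ_iff] at *
    refine ⟨fun t => (hg.1 t).comp (hf.1 t), hc, ?_⟩
    have hder : ∀ t x, fderiv ℝ (fun x => g t (f t x)) x =
        (fderiv ℝ (g t) (f t x)).comp (fderiv ℝ (f t) x) := fun t x =>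
      fderiv_comp x (hg.1 t _) (hf.1 t x)
    simp only [hder]
    have h1 := ih hg.2.2 hf0
    have h2 := h1.prodMk hf.2.2
    have hB : JointCn n fun (_ : ℝ) (p : (F →L[ℝ] G) × (E →L[ℝ] F)) => p.1.comp p.2 :=
      jointCn_const (contDiff_fst.clm_comp contDiff_snd)
    exact ih hB h2

end JointCnComp

end InertialParticle

namespace InertialParticle

/-! ### Ordinary differential equations: global existence and uniqueness -/

section GlobalExistence

variable {Λ E : Type*} [PseudoMetricSpace Λ] [NormedAddCommGroup E] [NormedSpace ℝ E]

/-- The Picard iterates of the initial value problem `u' = f(l, t, u)`, `u(0) = x₀(l)`. -/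
noncomputable def picardIter (f : Λ → ℝ → E → E) (x₀ : Λ → E) : ℕ → Λ → ℝ → E
  | 0 => fun l _ => x₀ l
  | n + 1 => fun l t => x₀ l + ∫ s in (0 : ℝ)..t, f l s (picardIter f x₀ n l s)

variable {f : Λ → ℝ → E → E} {x₀ : Λ → E}

theorem continuous_picardIter (hf : Continuous fun p : Λ × ℝ × E => f p.1 p.2.1 p.2.2)
    (hx₀ : Continuous x₀) (n : ℕ) :
    Continuous fun p : Λ × ℝ => picardIter f x₀ n p.1 p.2 := by
  induction n with
  | zero => exact hx₀.comp continuous_fst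
  | succ n ih =>
    refine (hx₀.comp continuous_fst).add
      (intervalIntegral.continuous_parametric_intervalIntegral_of_continuous (s := Prod.snd)
        (f := fun (p : Λ × ℝ) s => f p.1 s (picardIter f x₀ n p.1 s)) ?_ continuous_snd)
    exact hf.comp ((continuous_fst.comp continuous_fst).prodMk (continuous_snd.prodMk
      (ih.comp ((continuous_fst.comp continuous_fst).prodMk continuous_snd))))

/-- The classical Picard estimate: each iteration integrates the previous bound once more, which
produces the factorial. -/
theorem norm_picardIter_succ_sub_le (hf : Continuous fun p : Λ × ℝ × E => f p.1 p.2.1 p.2.2)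
    (hx₀ : Continuous x₀) {K M T : ℝ} (hK : 0 ≤ K) {l : Λ}
    (hL : ∀ t, |t| ≤ T → (∀ x y, ‖f l t x - f l t y‖ ≤ K * ‖x - y‖) ∧ ‖f l t (x₀ l)‖ ≤ M)
    (n : ℕ) : ∀ t, |t| ≤ T → ‖picardIter f x₀ (n + 1) l t - picardIter f x₀ n l t‖ ≤
      M * K ^ n * |t| ^ (n + 1) / (n + 1).factorial := by
  have hcont : ∀ n, Continuous fun s => f l s (picardIter f x₀ n l s) := fun n =>
    hf.comp (continuous_const.prodMk (continuous_id.prodMk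
      ((continuous_picardIter hf hx₀ n).comp (continuous_const.prodMk continuous_id))))
  have habs : ∀ {s t : ℝ}, s ∈ Set.uIoc 0 t → |s| ≤ |t| := fun {s t} hs => by
    have := Set.abs_sub_left_of_mem_uIcc (Set.uIoc_subset_uIcc hs)
    simpa using this
  induction n with
  | zero =>
    intro t ht
    simp only [picardIter, add_sub_cancel_left]
    have := intervalIntegral.norm_integral_le_of_norm_le_const (a := 0) (b := t) (C := M)
      (f := fun s => f l s (x₀ l)) fun s hs => (hL s ((habs hs).trans ht)).2
    simpa using this
  | succ n ih =>
    intro t ht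
    have h1 : picardIter f x₀ (n + 1 + 1) l t - picardIter f x₀ (n + 1) l t =
        ∫ s in (0 : ℝ)..t, (f l s (picardIter f x₀ (n + 1) l s) -
          f l s (picardIter f x₀ n l s)) := by
      rw [intervalIntegral.integral_sub ((hcont _).intervalIntegrable _ _)
        ((hcont _).intervalIntegrable _ _)]
      simp [picardIter]
    rw [h1]
    refine intervalIntegral.norm_integral_le_integral_norm_uIoc.trans ?_
    have h2 : ∀ s ∈ Set.uIoc 0 t, ‖f l s (picardIter f x₀ (n + 1) l s) -
        f l s (picardIter f x₀ n l s)‖ ≤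
        M * K ^ (n + 1) / (n + 1).factorial * |s - 0| ^ (n + 1) := fun s hs => by
      have hs' := (habs hs).trans ht
      refine ((hL s hs').1 _ _).trans ((mul_le_mul_of_nonneg_left (ih s hs') hK).trans_eq ?_)
      rw [sub_zero]; ring
    have hint : IntegrableOn (fun s : ℝ => M * K ^ (n + 1) / (n + 1).factorial * |s - 0| ^ (n + 1))
        (Set.uIoc 0 t) :=
      (Continuous.intervalIntegrable (by fun_prop) 0 t).def'
    refine (setIntegral_mono_on (((hcont _).sub (hcont _)).norm.intervalIntegrable 0 t).def' hint
      measurableSet_uIoc h2).trans_eq ?_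
    rw [integral_const_mul, integral_pow_abs_sub_uIoc, Nat.factorial_succ (n + 1)]
    push_cast
    rw [sub_zero]
    field_simp

/-- The Lipschitz bound is global in the state, so the Picard increments are dominated by an
exponential series on every bounded time interval and no blow-up occurs. The constants are uniform
near each parameter, which makes the sum jointly continuous. -/
theorem exists_global_solution [CompleteSpace E]
    (hf : Continuous fun p : Λ × ℝ × E => f p.1 p.2.1 p.2.2) (hx₀ : Continuous x₀)
    (hL : ∀ l₀ T, ∃ K M : ℝ, 0 ≤ K ∧ ∀ᶠ l in 𝓝 l₀, ∀ t, |t| ≤ T →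
      (∀ x y, ‖f l t x - f l t y‖ ≤ K * ‖x - y‖) ∧ ‖f l t (x₀ l)‖ ≤ M) :
    ∃ u : Λ → ℝ → E, (Continuous fun p : Λ × ℝ => u p.1 p.2) ∧ (∀ l, u l 0 = x₀ l) ∧
      ∀ l t, HasDerivAt (u l) (f l t (u l t)) t := by
  set v := picardIter f x₀ with hv
  have hvc := continuous_picardIter hf hx₀
  -- local uniform summability of the increments
  have hloc : ∀ l₀ T, ∃ b : ℕ → ℝ, Summable b ∧ ∃ K M : ℝ, 0 ≤ K ∧
      ∀ᶠ l in 𝓝 l₀, ∀ t, |t| ≤ T →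
      ((∀ x y, ‖f l t x - f l t y‖ ≤ K * ‖x - y‖) ∧ ‖f l t (x₀ l)‖ ≤ M) ∧
      ∀ n, ‖v (n + 1) l t - v n l t‖ ≤ b n := by
    intro l₀ T
    obtain ⟨K, M, hK, hev⟩ := hL l₀ T
    -- The denominator (n + 1)! is weakened to n! so that the terms are those of an exponential
    -- series.
    refine ⟨fun n => |M| * |T| * ((K * |T|) ^ n / n.factorial),
      (Real.summable_pow_div_factorial _).mul_left _, K, M, hK, ?_⟩
    filter_upwards [hev] with l hl t ht
    refine ⟨hl t ht, fun n => (norm_picardIter_succ_sub_le hf hx₀ hK hl n t ht).trans ?_⟩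
    have hT : |t| ≤ |T| := ht.trans (le_abs_self T)
    have h1 : (n.factorial : ℝ) ≤ (n + 1).factorial := by
      exact_mod_cast Nat.factorial_le n.le_succ
    calc M * K ^ n * |t| ^ (n + 1) / (n + 1).factorial
        ≤ |M| * K ^ n * |T| ^ (n + 1) / n.factorial := by
          gcongr
          exact le_abs_self M
      _ = _ := by rw [mul_pow]; ring
  let u : Λ → ℝ → E := fun l t => x₀ l + ∑' n, (v (n + 1) l t - v n l t)
  have hsum : ∀ l t, Summable fun n => v (n + 1) l t - v n l t := fun l t => by
    obtain ⟨b, hb, K, M, hK, hev⟩ := hloc l |t|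
    exact hb.of_norm_bounded (hev.self_of_nhds t le_rfl).2
  have hlim : ∀ l t, Tendsto (fun n => v n l t) atTop (𝓝 (u l t)) := fun l t => by
    have h1 := (hsum l t).hasSum.tendsto_sum_nat
    refine (h1.const_add (x₀ l)).congr fun n => ?_
    rw [Finset.sum_range_sub fun n => v n l t]
    exact add_sub_cancel (x₀ l) _
  have huc : Continuous fun p : Λ × ℝ => u p.1 p.2 := by
    refine continuous_iff_continuousAt.2 fun ⟨l₀, t₀⟩ => ?_
    obtain ⟨b, hb, K, M, hK, hev⟩ := hloc l₀ (|t₀| + 1)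
    have hnt : ∀ᶠ t in 𝓝 t₀, |t| ≤ |t₀| + 1 :=
      (continuous_abs.tendsto t₀).eventually_le_const (by linarith)
    have hN := hev.prod_mk hnt
    rw [← nhds_prod_eq] at hN
    have hcon : ContinuousOn (fun p : Λ × ℝ => ∑' n, (v (n + 1) p.1 p.2 - v n p.1 p.2))
        {p : Λ × ℝ | (∀ t, |t| ≤ |t₀| + 1 →
          ((∀ x y, ‖f p.1 t x - f p.1 t y‖ ≤ K * ‖x - y‖) ∧ ‖f p.1 t (x₀ p.1)‖ ≤ M) ∧
          ∀ n, ‖v (n + 1) p.1 t - v n p.1 t‖ ≤ b n) ∧ |p.2| ≤ |t₀| + 1} :=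
      continuousOn_tsum (fun n => ((hvc (n + 1)).sub (hvc n)).continuousOn) hb
        fun n p hp => (hp.1 p.2 hp.2).2 n
    exact (hx₀.comp continuous_fst).continuousAt.add (hcon.continuousAt hN)
  have hint : ∀ l t, u l t = x₀ l + ∫ s in (0 : ℝ)..t, f l s (u l s) := by
    intro l t
    obtain ⟨b, hb, K, M, hK, hev⟩ := hloc l |t|
    have hev := hev.self_of_nhds
    have habs : ∀ {s : ℝ}, s ∈ Set.uIoc 0 t → |s| ≤ |t| := fun {s} hs => by
      have := Set.abs_sub_left_of_mem_uIcc (Set.uIoc_subset_uIcc hs)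
      simpa using this
    have hfc : ∀ n, Continuous fun s => f l s (v n l s) := fun n =>
      hf.comp (continuous_const.prodMk (continuous_id.prodMk
        ((hvc n).comp (continuous_const.prodMk continuous_id))))
    have hbn : ∀ n s, |s| ≤ |t| → ‖v n l s - x₀ l‖ ≤ ∑' n, b n := fun n s hs => by
      have h0 : v n l s - x₀ l = ∑ i ∈ Finset.range n, (v (i + 1) l s - v i l s) := by
        rw [Finset.sum_range_sub fun n => v n l s]; rfl
      rw [h0]
      refine (norm_sum_le _ _).trans ((Finset.sum_le_sum fun i _ => (hev s hs).2 i).trans ?_)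
      exact hb.sum_le_tsum _ fun i _ => (norm_nonneg _).trans ((hev s hs).2 i)
    have h1 : Tendsto (fun n => ∫ s in (0 : ℝ)..t, f l s (v n l s)) atTop
        (𝓝 (∫ s in (0 : ℝ)..t, f l s (u l s))) := by
      refine intervalIntegral.tendsto_integral_filter_of_dominated_convergence
        (fun _ => K * ∑' n, b n + M) (Eventually.of_forall fun n => (hfc n).aestronglyMeasurable)
        (Eventually.of_forall fun n => ae_of_all _ fun s hs => ?_) (by simp)
        (ae_of_all _ fun s hs => ?_)
      · have h2 := hev s (habs hs)
        have h3 : f l s (v n l s) = (f l s (v n l s) - f l s (x₀ l)) + f l s (x₀ l) := by abel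
        rw [h3]
        refine (norm_add_le _ _).trans (add_le_add ((h2.1.1 _ _).trans ?_) h2.1.2)
        exact mul_le_mul_of_nonneg_left (hbn n s (habs hs)) hK
      · have hc : Continuous fun x => f l s x :=
          hf.comp (continuous_const.prodMk (continuous_const.prodMk continuous_id))
        exact (hc.tendsto _).comp (hlim l s)
    refine tendsto_nhds_unique ((hlim l t).comp (tendsto_add_atTop_nat 1)) ?_
    simpa [Function.comp_def, hv, picardIter] using h1.const_add (x₀ l)
  refine ⟨u, huc, fun l => by rw [hint]; simp, fun l t => ?_⟩
  have hc : Continuous fun s => f l s (u l s) :=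
    hf.comp (continuous_const.prodMk (continuous_id.prodMk
      (huc.comp (continuous_const.prodMk continuous_id))))
  have h1 : u l = fun t => x₀ l + ∫ s in (0 : ℝ)..t, f l s (u l s) := funext (hint l)
  have h2 := (hc.integral_hasStrictDerivAt 0 t).hasDerivAt.const_add (x₀ l)
  rw [← h1] at h2
  exact h2

/-- Two solutions of an ordinary differential equation on an open interval coincide. -/
theorem eqOn_of_hasDerivAt {g : ℝ → E → E} {J : Set ℝ} (hJ : IsOpen J) (hJ' : J.OrdConnected)
    {t₀ : ℝ} (ht₀ : t₀ ∈ J)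
    (hL : ∀ T, ∃ K : ℝ, ∀ t, |t| ≤ T → ∀ x y, ‖g t x - g t y‖ ≤ K * ‖x - y‖) {u w : ℝ → E}
    (hu : ∀ t ∈ J, HasDerivAt u (g t (u t)) t) (hw : ∀ t ∈ J, HasDerivAt w (g t (w t)) t)
    (h0 : u t₀ = w t₀) : Set.EqOn u w J := by
  intro t ht
  have hsub : Set.uIcc t₀ t ⊆ J := hJ'.uIcc_subset ht₀ ht
  -- The closed interval between t₀ and t is enlarged to an open one inside J, on which the
  -- uniqueness theorem applies.
  obtain ⟨ε, hε, hε'⟩ := Metric.isOpen_iff.1 hJ (min t₀ t) (hsub (by simp [Set.uIcc]))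
  obtain ⟨δ, hδ, hδ'⟩ := Metric.isOpen_iff.1 hJ (max t₀ t) (hsub (by simp [Set.uIcc]))
  have hIoo : Set.Ioo (min t₀ t - ε) (max t₀ t + δ) ⊆ J := by
    intro s hs
    rcases lt_or_ge s (min t₀ t) with h | h
    · exact hε' (by rw [Metric.mem_ball, Real.dist_eq, abs_lt]; constructor <;> linarith [hs.1])
    rcases lt_or_ge (max t₀ t) s with h' | h'
    · exact hδ' (by rw [Metric.mem_ball, Real.dist_eq, abs_lt]; constructor <;> linarith [hs.2])
    · exact hsub ⟨h, h'⟩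
  obtain ⟨K, hK⟩ := hL (|min t₀ t - ε| + |max t₀ t + δ|)
  have hKn : ∀ s ∈ Set.Ioo (min t₀ t - ε) (max t₀ t + δ),
      LipschitzOnWith K.toNNReal (g s) Set.univ := fun s hs => by
    refine LipschitzOnWith.of_dist_le_mul fun x _ y _ => ?_
    rw [dist_eq_norm, dist_eq_norm]
    refine (hK s ?_ x y).trans (mul_le_mul_of_nonneg_right (Real.le_coe_toNNReal K) (norm_nonneg _))
    rw [abs_le]
    constructor
    · linarith [hs.1, neg_abs_le (min t₀ t - ε), abs_nonneg (max t₀ t + δ)]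
    · linarith [hs.2, le_abs_self (max t₀ t + δ), abs_nonneg (min t₀ t - ε)]
  exact ODE_solution_unique_of_mem_Ioo hKn
    (t₀ := t₀) ⟨by linarith [min_le_left t₀ t], by linarith [le_max_left t₀ t]⟩
    (fun s hs => ⟨hu s (hIoo hs), trivial⟩) (fun s hs => ⟨hw s (hIoo hs), trivial⟩) h0
    ⟨by linarith [min_le_right t₀ t], by linarith [le_max_right t₀ t]⟩

end GlobalExistence

end InertialParticle

namespace InertialParticle

/-! ### Smooth dependence of the flow on the initial value -/

section Flow

universe u

/-- A continuous function is bounded on a neighbourhood of every compact slice. -/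
theorem exists_bound_of_continuous {Λ E : Type*} [TopologicalSpace Λ] [SeminormedAddCommGroup E]
    {g : Λ → ℝ → E} (hg : Continuous fun p : Λ × ℝ => g p.1 p.2) (l₀ : Λ) (T : ℝ) :
    ∃ M : ℝ, 0 ≤ M ∧ ∀ᶠ l in 𝓝 l₀, ∀ t, |t| ≤ T → ‖g l t‖ ≤ M := by
  have hc : IsCompact (Set.Icc (-T) T) := isCompact_Icc
  have h1 : Continuous fun t => ‖g l₀ t‖ :=
    (hg.comp (continuous_const.prodMk continuous_id)).norm
  obtain ⟨M, hM⟩ := (hc.image h1).bddAbove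
  refine ⟨|M| + 1, by positivity, ?_⟩
  have h3 : ∀ᶠ l in 𝓝 l₀, ∀ t ∈ Set.Icc (-T) T, ‖g l t‖ ≤ |M| + 1 :=
    hc.eventually_forall_of_forall_eventually fun t ht => by
      have : ‖g l₀ t‖ < |M| + 1 := by
        have := hM ⟨t, ht, rfl⟩
        simp only at this
        linarith [le_abs_self M]
      exact (hg.norm.tendsto (l₀, t)).eventually_le_const this
  filter_upwards [h3] with l hl t ht
  exact hl t (abs_le.1 ht)

variable {E : Type u} [NormedAddCommGroup E] [NormedSpace ℝ E]

/-- The linear initial value problem `W' = A(l, t) W`, `W(0) = 1` with parameters. -/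
theorem exists_linear_flow [CompleteSpace E] {Λ : Type*} [PseudoMetricSpace Λ]
    {A : Λ → ℝ → E →L[ℝ] E} (hA : Continuous fun p : Λ × ℝ => A p.1 p.2) :
    ∃ W : Λ → ℝ → E →L[ℝ] E, (Continuous fun p : Λ × ℝ => W p.1 p.2) ∧
      (∀ l, W l 0 = ContinuousLinearMap.id ℝ E) ∧
      ∀ l t, HasDerivAt (W l) ((A l t).comp (W l t)) t := by
  refine exists_global_solution (f := fun l t W => (A l t).comp W)
    (x₀ := fun _ => ContinuousLinearMap.id ℝ E) ?_ continuous_const fun l₀ T => ?_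
  · exact (hA.comp (continuous_fst.prodMk (continuous_fst.comp continuous_snd))).clm_comp
      (continuous_snd.comp continuous_snd)
  · obtain ⟨M, hM, hev⟩ := exists_bound_of_continuous hA l₀ T
    refine ⟨M, M, hM, ?_⟩
    filter_upwards [hev] with l hl t ht
    refine ⟨fun x y => ?_, ?_⟩
    · rw [← ContinuousLinearMap.comp_sub]
      exact (ContinuousLinearMap.opNorm_comp_le _ _).trans
        (mul_le_mul_of_nonneg_right (hl t ht) (norm_nonneg _))
    · rw [ContinuousLinearMap.comp_id]
      exact hl t ht

/-- The flow of a vector field whose space derivative is jointly continuous is differentiable in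
the initial value, and the derivative solves the variational equation. -/
theorem exists_hasFDerivAt_flow [CompleteSpace E] {f : ℝ → E → E} (hf : JointCn 1 f)
    {Φ : ℝ → E → E} (hΦ : Continuous fun p : ℝ × E => Φ p.1 p.2) (h0 : ∀ x, Φ 0 x = x)
    (hd : ∀ x t, HasDerivAt (fun t => Φ t x) (f t (Φ t x)) t) :
    ∃ Y : ℝ → E → E →L[ℝ] E, (Continuous fun p : ℝ × E => Y p.1 p.2) ∧
      (∀ x, Y 0 x = ContinuousLinearMap.id ℝ E) ∧ (∀ t x, HasFDerivAt (Φ t) (Y t x) x) ∧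
      ∀ x t, HasDerivAt (fun t => Y t x) ((fderiv ℝ (f t) (Φ t x)).comp (Y t x)) t := by
  obtain ⟨hfd, hfc, hf'⟩ := jointCn_succ_iff.1 hf
  have hDf : Continuous fun p : ℝ × E => fderiv ℝ (f p.1) p.2 := hf'.continuous
  -- Hadamard's trick: with the derivative averaged over the segment between two trajectories, their
  -- difference solves a linear equation exactly, and no remainder has to be estimated.
  let A : E × E → ℝ → E →L[ℝ] E := fun q t =>
    ∫ θ in (0 : ℝ)..1, fderiv ℝ (f t) (Φ t q.1 + θ • (Φ t q.2 - Φ t q.1))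
  have hcA : Continuous (Function.uncurry fun (p : (E × E) × ℝ) (θ : ℝ) =>
      fderiv ℝ (f p.2) (Φ p.2 p.1.1 + θ • (Φ p.2 p.1.2 - Φ p.2 p.1.1))) := by
    have h1 : Continuous fun p : ((E × E) × ℝ) × ℝ => Φ p.1.2 p.1.1.1 :=
      hΦ.comp (by fun_prop : Continuous fun p : ((E × E) × ℝ) × ℝ => (p.1.2, p.1.1.1))
    have h2 : Continuous fun p : ((E × E) × ℝ) × ℝ => Φ p.1.2 p.1.1.2 :=
      hΦ.comp (by fun_prop : Continuous fun p : ((E × E) × ℝ) × ℝ => (p.1.2, p.1.1.2))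
    exact hDf.comp ((continuous_snd.comp continuous_fst).prodMk
      (h1.add (continuous_snd.smul (h2.sub h1))))
  have hA : Continuous fun p : (E × E) × ℝ => A p.1 p.2 :=
    intervalIntegral.continuous_parametric_intervalIntegral_of_continuous' hcA 0 1
  have hmv : ∀ q t, f t (Φ t q.2) - f t (Φ t q.1) = A q t (Φ t q.2 - Φ t q.1) := by
    intro q t
    have hct : Continuous fun θ : ℝ => fderiv ℝ (f t) (Φ t q.1 + θ • (Φ t q.2 - Φ t q.1)) :=
      hcA.comp (continuous_const.prodMk continuous_id : Continuous fun θ : ℝ => ((q, t), θ))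
    have h1 : ∀ θ ∈ Set.uIcc (0 : ℝ) 1, HasDerivAt
        (fun θ : ℝ => f t (Φ t q.1 + θ • (Φ t q.2 - Φ t q.1)))
        (fderiv ℝ (f t) (Φ t q.1 + θ • (Φ t q.2 - Φ t q.1)) (Φ t q.2 - Φ t q.1)) θ := by
      intro θ _
      have h2 : HasDerivAt (fun θ : ℝ => Φ t q.1 + θ • (Φ t q.2 - Φ t q.1))
          (Φ t q.2 - Φ t q.1) θ := by
        simpa using ((hasDerivAt_id θ).smul_const (Φ t q.2 - Φ t q.1)).const_add (Φ t q.1)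
      exact (hfd t _).hasFDerivAt.comp_hasDerivAt θ h2
    have h3 := intervalIntegral.integral_eq_sub_of_hasDerivAt h1
      ((hct.clm_apply continuous_const).intervalIntegrable _ _)
    rw [← ContinuousLinearMap.intervalIntegral_apply (hct.intervalIntegrable 0 1)] at h3
    simpa using h3.symm
  obtain ⟨W, hWc, hW0, hWd⟩ := exists_linear_flow hA
  -- Both sides solve the same linear equation with initial value y - x. Continuity of W at the
  -- diagonal then yields the derivative of the flow.
  have hΦW : ∀ x y t, Φ t y - Φ t x = W (x, y) t (y - x) := by
    intro x y t
    refine eqOn_of_hasDerivAt (g := fun t v => A (x, y) t v) isOpen_univ Set.ordConnected_univ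
      (t₀ := 0) trivial (fun T => ?_) (u := fun t => Φ t y - Φ t x)
      (w := fun t => W (x, y) t (y - x)) (fun t _ => ?_) (fun t _ => ?_) ?_ trivial
    · obtain ⟨M, hM, hev⟩ := exists_bound_of_continuous hA (x, y) T
      refine ⟨M, fun t ht a b => ?_⟩
      rw [← map_sub]
      exact ContinuousLinearMap.le_of_opNorm_le _ (hev.self_of_nhds t ht) _
    · have := (hd y t).sub (hd x t)
      rwa [hmv (x, y) t] at this
    · simpa using (hWd (x, y) t).clm_apply (hasDerivAt_const t (y - x))
    · simp [h0, hW0]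
  have hAdiag : ∀ x t, A (x, x) t = fderiv ℝ (f t) (Φ t x) := fun x t => by
    simp [A]
  refine ⟨fun t x => W (x, x) t, hWc.comp (by fun_prop : Continuous fun p : ℝ × E =>
    (((p.2, p.2), p.1) : (E × E) × ℝ)), fun x => hW0 _, fun t x => ?_, fun x t => ?_⟩
  · rw [hasFDerivAt_iff_isLittleO_nhds_zero, Asymptotics.isLittleO_iff]
    intro c hc
    have h1 : Continuous fun h : E => W (x, x + h) t - W (x, x) t :=
      (hWc.comp (by fun_prop : Continuous fun h : E => (((x, x + h), t) : (E × E) × ℝ))).sub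
        continuous_const
    have h2 : ∀ᶠ h in 𝓝 (0 : E), ‖W (x, x + h) t - W (x, x) t‖ ≤ c :=
      (h1.norm.tendsto 0).eventually_le_const (by simpa using hc)
    filter_upwards [h2] with h hh
    have h3 : Φ t (x + h) - Φ t x - W (x, x) t h = (W (x, x + h) t - W (x, x) t) h := by
      rw [hΦW, add_sub_cancel_left]; rfl
    rw [h3]
    exact ContinuousLinearMap.le_of_opNorm_le _ hh _
  · have := hWd (x, x) t
    rwa [hAdiag] at this

/-- The flow of a vector field in `C(ℝ, Cⁿ)` belongs to `C(ℝ, Cⁿ)`. -/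
theorem jointCn_flow (n : ℕ) : ∀ {E : Type u} [NormedAddCommGroup E] [NormedSpace ℝ E]
    [CompleteSpace E] {f Φ : ℝ → E → E}, JointCn (n + 1) f →
    (Continuous fun p : ℝ × E => Φ p.1 p.2) → (∀ x, Φ 0 x = x) →
    (∀ x t, HasDerivAt (fun t => Φ t x) (f t (Φ t x)) t) → JointCn (n + 1) Φ := by
  induction n with
  | zero =>
    intro E _ _ _ f Φ hf hΦ h0 hd
    obtain ⟨Y, hY, -, hYΦ, -⟩ := exists_hasFDerivAt_flow hf hΦ h0 hd
    refine jointCn_succ_iff.2 ⟨fun t x => (hYΦ t x).differentiableAt, hΦ, ?_⟩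
    simp only [fun t x => (hYΦ t x).fderiv]
    exact jointCn_zero_iff.2 hY
  | succ n ih =>
    intro E _ _ _ f Φ hf hΦ h0 hd
    obtain ⟨Y, hY, hY0, hYΦ, hYd⟩ := exists_hasFDerivAt_flow (hf.of_le (by omega)) hΦ h0 hd
    refine jointCn_succ_iff.2 ⟨fun t x => (hYΦ t x).differentiableAt, hΦ, ?_⟩
    simp only [fun t x => (hYΦ t x).fderiv]
    have hf1 := (jointCn_succ_iff.1 hf).2.2
    -- the flow of the variational equation
    let f' : ℝ → E × (E →L[ℝ] E) → E × (E →L[ℝ] E) := fun t p =>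
      (f t p.1, (fderiv ℝ (f t) p.1).comp p.2)
    let Φ' : ℝ → E × (E →L[ℝ] E) → E × (E →L[ℝ] E) := fun t p => (Φ t p.1, (Y t p.1).comp p.2)
    have hfst : JointCn (n + 1) fun (_ : ℝ) (p : E × (E →L[ℝ] E)) => p.1 :=
      jointCn_const contDiff_fst
    have hf' : JointCn (n + 1) f' := by
      refine ((hf.of_le (by omega)).comp hfst).prodMk ?_
      have h1 := (hf1.comp hfst).prodMk
        (jointCn_const (n := n + 1) (contDiff_snd (𝕜 := ℝ) (E := E) (F := E →L[ℝ] E)))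
      have hB : JointCn (n + 1) fun (_ : ℝ) (p : (E →L[ℝ] E) × (E →L[ℝ] E)) => p.1.comp p.2 :=
        jointCn_const (contDiff_fst.clm_comp contDiff_snd)
      exact hB.comp h1
    have hΦ' : JointCn (n + 1) Φ' := by
      refine ih hf' ?_ (fun p => ?_) fun p t => ?_
      · exact (hΦ.comp (by fun_prop : Continuous fun p : ℝ × (E × (E →L[ℝ] E)) =>
          (p.1, p.2.1))).prodMk ((hY.comp (by fun_prop :
          Continuous fun p : ℝ × (E × (E →L[ℝ] E)) => (p.1, p.2.1))).clm_comp
          (continuous_snd.comp continuous_snd))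
      · simp [Φ', h0, hY0]
      · refine (hd p.1 t).prodMk ?_
        have := (hYd p.1 t).clm_comp (hasDerivAt_const t p.2)
        simpa [ContinuousLinearMap.comp_assoc] using this
    -- The derivative of Φ is the second component of the enlarged flow started at (x, id).
    have h2 : JointCn (n + 1) fun (_ : ℝ) (x : E) => (x, ContinuousLinearMap.id ℝ E) :=
      jointCn_const (contDiff_id.prodMk contDiff_const)
    have h3 := (hΦ'.comp h2).clm_comp (ContinuousLinearMap.snd ℝ E (E →L[ℝ] E))
    simpa [Φ'] using h3

variable {F : Type u} [NormedAddCommGroup F] [NormedSpace ℝ F]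

/-- Time and space derivatives commute: f t is f 0 plus a time integral of f', one differentiates
under the integral sign, and the fundamental theorem of calculus recovers the time derivative. -/
theorem hasDerivAt_iteratedFDeriv (n : ℕ) : ∀ {E F : Type u} [NormedAddCommGroup E]
    [NormedSpace ℝ E] [NormedAddCommGroup F] [NormedSpace ℝ F] [CompleteSpace F]
    {f f' : ℝ → E → F}, JointCn n f → JointCn n f' →
    (∀ x t, HasDerivAt (fun t => f t x) (f' t x) t) →
    ∀ x t, HasDerivAt (fun t => iteratedFDeriv ℝ n (f t) x) (iteratedFDeriv ℝ n (f' t) x) t := by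
  induction n with
  | zero =>
    intro E F _ _ _ _ _ f f' hf hf' hd x t
    simp only [iteratedFDeriv_zero_eq_comp, Function.comp_apply]
    exact (continuousMultilinearCurryFin0 ℝ E
      F).symm.toContinuousLinearEquiv.toContinuousLinearMap.hasFDerivAt.comp_hasDerivAt t (hd x t)
  | succ n ih =>
    intro E F _ _ _ _ _ f f' hf hf' hd x t
    obtain ⟨h1, h2, h3⟩ := jointCn_succ_iff.1 hf
    obtain ⟨h1', h2', h3'⟩ := jointCn_succ_iff.1 hf'
    have hd' : ∀ x t, HasDerivAt (fun t => fderiv ℝ (f t) x) (fderiv ℝ (f' t) x) t := by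
      intro x t
      have hc : Continuous fun s => fderiv ℝ (f' s) x :=
        h3'.continuous.comp (continuous_id.prodMk continuous_const)
      have hcx : ∀ x, Continuous fun s => f' s x := fun x =>
        h2'.comp (continuous_id.prodMk continuous_const)
      have hint : ∀ t x, f t x = f 0 x + ∫ s in (0 : ℝ)..t, f' s x := fun t x => by
        rw [intervalIntegral.integral_eq_sub_of_hasDerivAt (fun s _ => hd x s)
          ((hcx x).intervalIntegrable _ _)]
        abel
      have hder : ∀ t, fderiv ℝ (f t) x = fderiv ℝ (f 0) x + ∫ s in (0 : ℝ)..t,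
          fderiv ℝ (f' s) x := by
        intro t
        obtain ⟨M, hM, hev⟩ := exists_bound_of_continuous (g := fun x s => fderiv ℝ (f' s) x)
          (h3'.continuous.comp continuous_swap) x |t|
        have h4 := intervalIntegral.hasFDerivAt_integral_of_dominated_of_fderiv_le (𝕜 := ℝ)
          (μ := volume) (a := 0) (b := t) (F := fun x s => f' s x)
          (F' := fun x s => fderiv ℝ (f' s) x) (bound := fun _ => M) hev
          (Eventually.of_forall fun y => (hcx y).aestronglyMeasurable)
          ((hcx x).intervalIntegrable _ _) hc.aestronglyMeasurable
          (ae_of_all _ fun s hs y hy => hy s (by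
            have := Set.abs_sub_left_of_mem_uIcc (Set.uIoc_subset_uIcc hs)
            simpa using this))
          (by simp) (ae_of_all _ fun s _ y _ => (h1' s y).hasFDerivAt)
        have h5 := ((h1 0 x).hasFDerivAt).add h4
        have h6 : f t = fun x => f 0 x + ∫ s in (0 : ℝ)..t, f' s x := funext (hint t)
        conv_lhs => rw [h6]
        exact h5.fderiv
      rw [show (fun t => fderiv ℝ (f t) x) = _ from funext hder]
      exact ((hc.integral_hasStrictDerivAt 0 t).hasDerivAt).const_add _
    simp only [iteratedFDeriv_succ_eq_comp_right, Function.comp_apply]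
    exact ((continuousMultilinearCurryRightEquiv' ℝ n E
      F).symm.toContinuousLinearEquiv.toContinuousLinearMap).hasFDerivAt.comp_hasDerivAt t
      (ih h3 h3' hd' x t)

/-- The mean value inequality for s ↦ Dⁱf(s) - s • Dⁱf'(t₀) bounds the error of the difference
quotient by the oscillation of Dⁱf' in time, uniformly for x in a neighbourhood. -/
theorem c1InCn_of_hasDerivAt [CompleteSpace F] {n : ℕ} {f f' : ℝ → E → F} (hf : JointCn n f)
    (hf' : JointCn n f') (hd : ∀ x t, HasDerivAt (fun t => f t x) (f' t x) t) : C1InCn n f := by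
  refine ⟨continuousInCn_iff_jointCn.2 hf, f', continuousInCn_iff_jointCn.2 hf',
    fun i hi t₀ => ?_⟩
  have hder := hasDerivAt_iteratedFDeriv i (hf.of_le hi) (hf'.of_le hi) hd
  rw [Metric.tendstoLocallyUniformly_iff]
  intro ε hε x₀
  have h1 := Metric.continuousAt_iff'.1 ((hf'.2 i hi).continuousAt (x := (t₀, x₀))) (ε / 4)
    (by positivity)
  rw [nhds_prod_eq, Filter.eventually_prod_iff] at h1
  obtain ⟨pa, ha, pb, hb, hab⟩ := h1
  refine ⟨{x | pb x}, hb, ?_⟩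
  obtain ⟨δ, hδ, hball⟩ := Metric.eventually_nhds_iff_ball.1 ha
  filter_upwards [self_mem_nhdsWithin, mem_nhdsWithin_of_mem_nhds (Metric.ball_mem_nhds t₀ hδ)]
    with t htne htb y hy
  have hbound : ∀ s ∈ Metric.ball t₀ δ,
      ‖iteratedFDeriv ℝ i (f' s) y - iteratedFDeriv ℝ i (f' t₀) y‖ ≤ ε / 2 := by
    intro s hs
    have h2 := hab (hball s hs) hy
    have h3 := hab (hball t₀ (Metric.mem_ball_self hδ)) hy
    rw [← dist_eq_norm]
    exact (dist_triangle_right _ _ (iteratedFDeriv ℝ i (f' t₀) x₀)).trans (by linarith)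
  have hmv := (convex_ball t₀ δ).norm_image_sub_le_of_norm_hasDerivWithin_le
    (f := fun s => iteratedFDeriv ℝ i (f s) y - s • iteratedFDeriv ℝ i (f' t₀) y)
    (f' := fun s => iteratedFDeriv ℝ i (f' s) y - (1 : ℝ) • iteratedFDeriv ℝ i (f' t₀) y)
    (C := ε / 2)
    (fun s _ => ((hder y s).sub ((hasDerivAt_id s).smul_const _)).hasDerivWithinAt)
    (fun s hs => by simpa using hbound s hs) (Metric.mem_ball_self hδ) htb
  have hne : t - t₀ ≠ 0 := sub_ne_zero.2 htne
  rw [dist_comm, dist_eq_norm]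
  have h4 : (t - t₀)⁻¹ • (iteratedFDeriv ℝ i (f t) y - iteratedFDeriv ℝ i (f t₀) y) -
      iteratedFDeriv ℝ i (f' t₀) y = (t - t₀)⁻¹ • ((iteratedFDeriv ℝ i (f t) y -
        t • iteratedFDeriv ℝ i (f' t₀) y) - (iteratedFDeriv ℝ i (f t₀) y -
        t₀ • iteratedFDeriv ℝ i (f' t₀) y)) := by
    have h5 : iteratedFDeriv ℝ i (f' t₀) y =
        (t - t₀)⁻¹ • ((t - t₀) • iteratedFDeriv ℝ i (f' t₀) y) := by
      rw [smul_smul, inv_mul_cancel₀ hne, one_smul]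
    conv_lhs => rw [h5, ← smul_sub]
    congr 1
    rw [sub_smul]
    abel
  rw [h4, norm_smul, norm_inv]
  have hpos : 0 < ‖t - t₀‖ := norm_pos_iff.2 hne
  calc ‖t - t₀‖⁻¹ * _ ≤ ‖t - t₀‖⁻¹ * (ε / 2 * ‖t - t₀‖) := by gcongr
    _ = ε / 2 := by field_simp
    _ < ε := half_lt_self hε

end Flow

end InertialParticle

namespace InertialParticle

/-! ### The torus and its universal cover -/

section Torus

theorem proj_surjective : Function.Surjective proj := fun X =>
  ⟨fun i => (QuotientAddGroup.mk_surjective (X i)).choose,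
    funext fun i => (QuotientAddGroup.mk_surjective (X i)).choose_spec⟩

/-- The inclusion of the lattice `ℤ²` into the plane. -/
def latticeVec (n : Fin 2 → ℤ) : Plane := fun i => (n i : ℝ)

theorem proj_add_latticeVec (v : Plane) (n : Fin 2 → ℤ) : proj (v + latticeVec n) = proj v := by
  funext i
  change ((v i + (n i : ℝ) : ℝ) : UnitAddCircle) = (v i : UnitAddCircle)
  rw [AddCircle.coe_add]
  have : ((n i : ℝ) : UnitAddCircle) = 0 := by
    rw [AddCircle.coe_eq_zero_iff]
    exact ⟨n i, by simp⟩
  rw [this, add_zero]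

theorem proj_eq_iff {v w : Plane} : proj v = proj w ↔ ∃ n : Fin 2 → ℤ, w = v + latticeVec n := by
  constructor
  · intro h
    have : ∀ i, ∃ n : ℤ, w i = v i + n := fun i => by
      have h1 : ((w i - v i : ℝ) : UnitAddCircle) = 0 := by
        rw [AddCircle.coe_sub, sub_eq_zero]
        exact (congrFun h i).symm
      rw [AddCircle.coe_eq_zero_iff] at h1
      obtain ⟨n, hn⟩ := h1
      exact ⟨n, by simp at hn; linarith⟩
    choose n hn using this
    exact ⟨n, funext hn⟩
  · rintro ⟨n, rfl⟩
    exact (proj_add_latticeVec v n).symm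

theorem exists_unitCube_eq_add_latticeVec (v : Plane) :
    ∃ w ∈ Set.Icc (0 : Plane) 1, ∃ n : Fin 2 → ℤ, v = w + latticeVec n :=
  ⟨fun i => Int.fract (v i), ⟨fun _ => Int.fract_nonneg _, fun _ => (Int.fract_lt_one _).le⟩,
    fun i => ⌊v i⌋, funext fun i => (Int.fract_add_floor (v i)).symm⟩

/-- Periodicity reduces the plane to the compact unit square. -/
theorem exists_bound_of_periodic {F : Type*} [SeminormedAddCommGroup F] {g : ℝ → Plane → F}
    (hg : Continuous fun p : ℝ × Plane => g p.1 p.2)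
    (hper : ∀ t v n, g t (v + latticeVec n) = g t v) (T : ℝ) :
    ∃ M : ℝ, 0 ≤ M ∧ ∀ t, |t| ≤ T → ∀ v, ‖g t v‖ ≤ M := by
  obtain ⟨M, hM⟩ := ((isCompact_Icc (a := -T) (b := T)).prod
    (isCompact_Icc (a := (0 : Plane)) (b := 1))).image hg.norm |>.bddAbove
  refine ⟨|M|, abs_nonneg M, fun t ht v => ?_⟩
  obtain ⟨w, hw, n, rfl⟩ := exists_unitCube_eq_add_latticeVec v
  rw [hper]
  exact (hM ⟨(t, w), ⟨abs_le.1 ht, hw⟩, rfl⟩).trans (le_abs_self M)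

theorem fderiv_add_latticeVec {F : Type*} [NormedAddCommGroup F] [NormedSpace ℝ F]
    {g : Plane → F} {n : Fin 2 → ℤ} (h : ∀ v, g (v + latticeVec n) = g v) (v : Plane) :
    fderiv ℝ g (v + latticeVec n) = fderiv ℝ g v := by
  have h1 := fderiv_comp_add_right (𝕜 := ℝ) (f := g) (x := v) (latticeVec n)
  rw [← h1]
  simp only [h]

/-- The lift of `∇^⊥ f` to the plane. -/
noncomputable def perpMap : (Plane →L[ℝ] ℝ) →L[ℝ] Plane :=
  ContinuousLinearMap.pi ![ContinuousLinearMap.apply ℝ ℝ (Pi.single 1 1),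
    -ContinuousLinearMap.apply ℝ ℝ (Pi.single 0 1)]

theorem perpGrad_proj {f : Torus → ℝ} {v : Plane}
    (hf : DifferentiableAt ℝ (fun v => f (proj v)) v) :
    perpGrad f (proj v) = perpMap (fderiv ℝ (fun v => f (proj v)) v) := by
  have h1 : ∀ i, partialDeriv i f (proj v) =
      fderiv ℝ (fun v => f (proj v)) v (Pi.single i 1) := fun i => by
    unfold partialDeriv
    have h2 : HasDerivAt (fun h : ℝ => v + Pi.single (M := fun _ : Fin 2 => ℝ) i h)
        (Pi.single i 1) 0 := by
      have h3 : HasDerivAt (fun h : ℝ => v + h • (Pi.single i 1 : Plane))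
          ((1 : ℝ) • (Pi.single i 1 : Plane)) 0 :=
        ((hasDerivAt_id (0 : ℝ)).smul_const _).const_add v
      rw [one_smul] at h3
      refine h3.congr_of_eventuallyEq (Eventually.of_forall fun h => ?_)
      simp only [← Pi.single_smul, smul_eq_mul, mul_one]
    have h4 : HasFDerivAt (fun v => f (proj v)) (fderiv ℝ (fun v => f (proj v)) v)
        (v + Pi.single i (0 : ℝ)) := by
      simpa using hf.hasFDerivAt
    exact (h4.comp_hasDerivAt (0 : ℝ) h2).deriv
  unfold perpGrad perpMap
  funext i
  fin_cases i <;> simp [h1]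

/-- A curve in the torus with continuous velocity on an interval is the projection of the
primitive of its velocity. -/
theorem eq_proj_of_hasTorusDerivAt {J : Set ℝ} (hJ : IsOpen J) (hJ' : J.OrdConnected)
    (h0 : (0 : ℝ) ∈ J) {x : ℝ → Torus} {y ξ : ℝ → Plane}
    (hx : ∀ t ∈ J, HasTorusDerivAt x (y t) t) (hξ : ∀ t ∈ J, HasDerivAt ξ (y t) t)
    (hx0 : proj (ξ 0) = x 0) : ∀ t ∈ J, x t = proj (ξ t) := by
  intro t ht
  funext i
  refine AddCircle.injective_toCircle one_ne_zero ?_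
  have hmk : ∀ r : ℝ, ((AddCircle.toCircle (r : UnitAddCircle) : Circle) : ℂ) =
      Complex.exp ((2 * Real.pi * r : ℝ) * Complex.I) := fun r => by
    rw [AddCircle.toCircle_apply_mk, Circle.coe_exp]
    simp
  -- The circle-valued quotient exp(2πi(x - ξ)) has zero derivative, hence is constant on J; only
  -- local lifts of x are needed for this.
  let c : ℝ → ℂ := fun s => ((x s i).toCircle : ℂ) *
    Complex.exp (-((2 * Real.pi * ξ s i : ℝ) * Complex.I))
  have hc : ∀ s ∈ J, HasDerivAt c 0 s := by
    intro s hs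
    obtain ⟨ζ, hζ, hζd⟩ := hx s hs
    have h1 : HasDerivAt (fun r => ζ r i - ξ r i) 0 s := by
      have h2 : HasDerivAt (fun r => ζ r i - ξ r i) (y s i - y s i) s :=
        ((hasDerivAt_pi.1 hζd) i).sub ((hasDerivAt_pi.1 (hξ s hs)) i)
      rwa [sub_self] at h2
    have h2 : HasDerivAt (fun r => Complex.exp ((2 * Real.pi * (ζ r i - ξ r i) : ℝ) * Complex.I))
        0 s := by
      have := ((h1.const_mul (2 * Real.pi)).ofReal_comp.mul_const Complex.I).cexp
      simpa using this
    refine h2.congr_of_eventuallyEq ?_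
    filter_upwards [hζ] with r hr
    have : x r i = (ζ r i : UnitAddCircle) := (congrFun hr i).symm
    simp only [c, this, hmk, ← Complex.exp_add]
    congr 1
    push_cast
    ring
  have hconst : c t = c 0 := by
    refine hJ.is_const_of_deriv_eq_zero (s := J) hJ'.isPreconnected
      (fun s hs => (hc s hs).differentiableAt.differentiableWithinAt)
      (fun s hs => (hc s hs).deriv) ht h0
  have hc0 : c 0 = 1 := by
    have : x 0 i = (ξ 0 i : UnitAddCircle) := (congrFun hx0 i).symm
    simp only [c, this, hmk, ← Complex.exp_add]
    simp
  have h3 : ((x t i).toCircle : ℂ) = ((proj (ξ t) i).toCircle : ℂ) := by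
    change _ = ((AddCircle.toCircle ((ξ t i : ℝ) : UnitAddCircle) : Circle) : ℂ)
    rw [hmk]
    have h4 : c t = 1 := hconst.trans hc0
    simp only [c, Complex.exp_neg] at h4
    exact (mul_inv_eq_one₀ (Complex.exp_ne_zero _)).1 h4
  exact Subtype.ext h3

end Torus

/-! ### The particle equation for a fixed field -/

section ParticleEquation

/-- The vector field of the particle equation, lifted to the plane. -/
noncomputable def particleField (τ : ℝ) (ψ : ℝ → Torus → ℝ) (t : ℝ) (p : Plane × Plane) :
    Plane × Plane :=
  (p.2, τ⁻¹ • (perpMap (fderiv ℝ (fun v => ψ t (proj v)) p.1) - p.2))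

variable {τ : ℝ} {ψ : ℝ → Torus → ℝ} {k : ℕ}

theorem jointCn_particleField (h : JointCn (k + 1) fun (t : ℝ) (v : Plane) => ψ t (proj v)) :
    JointCn k (particleField τ ψ) := by
  have h1 : JointCn k fun t (v : Plane) => perpMap (fderiv ℝ (fun v => ψ t (proj v)) v) :=
    (jointCn_succ_iff.1 h).2.2.clm_comp perpMap
  have h2 := h1.comp (jointCn_const (n := k) (contDiff_fst (𝕜 := ℝ) (E := Plane) (F := Plane)))
  have h3 := h2.prodMk (jointCn_const (n := k) (contDiff_snd (𝕜 := ℝ) (E := Plane) (F := Plane)))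
  have h4 : ContDiff ℝ k fun p : Plane × Plane => (p.2, τ⁻¹ • (p.1 - p.2)) :=
    contDiff_snd.prodMk ((contDiff_fst.sub contDiff_snd).const_smul _)
  exact (jointCn_const (n := k) h4).comp h3

theorem particleField_add_latticeVec (t : ℝ) (x y : Plane) (n : Fin 2 → ℤ) :
    particleField τ ψ t (x + latticeVec n, y) = particleField τ ψ t (x, y) := by
  simp only [particleField]
  rw [fderiv_add_latticeVec fun v => by rw [proj_add_latticeVec]]

/-- The field is linear in the velocity, and the second space derivatives of ψ are bounded on the
whole plane by periodicity. This is where two derivatives are used. -/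
theorem exists_lipschitz_particleField
    (h : JointCn 2 fun (t : ℝ) (v : Plane) => ψ t (proj v)) (T : ℝ) :
    ∃ K : ℝ, 0 ≤ K ∧ ∀ t, |t| ≤ T → ∀ p q,
      ‖particleField τ ψ t p - particleField τ ψ t q‖ ≤ K * ‖p - q‖ := by
  have h1 : JointCn 1 (particleField τ ψ) := jointCn_particleField h
  have h2 : JointCn 1 fun t (v : Plane) => perpMap (fderiv ℝ (fun v => ψ t (proj v)) v) :=
    (jointCn_succ_iff.1 h).2.2.clm_comp perpMap
  set b : ℝ → Plane → Plane := fun t v => perpMap (fderiv ℝ (fun v => ψ t (proj v)) v)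
  obtain ⟨hbd, -, hbc⟩ := jointCn_succ_iff.1 h2
  have hper : ∀ t v n, b t (v + latticeVec n) = b t v := fun t v n => by
    simp only [b]
    rw [fderiv_add_latticeVec fun v => by rw [proj_add_latticeVec]]
  obtain ⟨B, hB, hBb⟩ := exists_bound_of_periodic (g := fun t v => fderiv ℝ (b t) v) hbc.continuous
    (fun t v n => fderiv_add_latticeVec (fun v => hper t v n) v) T
  refine ⟨1 + |τ⁻¹| * (B + 1), by positivity, fun t ht p q => ?_⟩
  have hb : ‖b t p.1 - b t q.1‖ ≤ B * ‖p.1 - q.1‖ :=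
    convex_univ.norm_image_sub_le_of_norm_fderiv_le (fun v _ => hbd t v) (fun v _ => hBb t ht v)
      trivial trivial
  have h3 : ‖p.1 - q.1‖ ≤ ‖p - q‖ := norm_fst_le (p - q)
  have h4 : ‖p.2 - q.2‖ ≤ ‖p - q‖ := norm_snd_le (p - q)
  have h5 : particleField τ ψ t p - particleField τ ψ t q =
      (p.2 - q.2, τ⁻¹ • ((b t p.1 - b t q.1) - (p.2 - q.2))) := by
    refine Prod.ext rfl ?_
    change τ⁻¹ • (b t p.1 - p.2) - τ⁻¹ • (b t q.1 - q.2) = _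
    rw [← smul_sub]
    congr 1
    abel
  rw [h5, Prod.norm_mk, add_mul, one_mul]
  refine max_le (h4.trans (le_add_of_nonneg_right (by positivity))) ?_
  rw [norm_smul, Real.norm_eq_abs, mul_assoc]
  refine (mul_le_mul_of_nonneg_left ((norm_sub_le _ _).trans ?_) (abs_nonneg _)).trans
    (le_add_of_nonneg_left (norm_nonneg _))
  rw [add_mul, one_mul]
  exact add_le_add (hb.trans (mul_le_mul_of_nonneg_left h3 hB)) h4

/-- The flow is built on the cover and projected. One order of regularity is lost because the vector
field contains the gradient of ψ. -/
theorem hasUniqueGlobalSolution_of_continuousInCn {m : ℕ} (hm : 2 ≤ m)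
    (h : ContinuousInCn m fun (t : ℝ) (v : Plane) => ψ t (proj v)) :
    HasUniqueGlobalSolution (m - 1) τ ψ := by
  obtain ⟨j, rfl⟩ : ∃ j, m = j + 2 := ⟨m - 2, by omega⟩
  rw [continuousInCn_iff_jointCn] at h
  have hf : JointCn (j + 1) (particleField τ ψ) := jointCn_particleField h
  have hL := exists_lipschitz_particleField (τ := τ) (h.of_le (by omega : 2 ≤ j + 2))
  have hfc := hf.continuous
  obtain ⟨u, huc, hu0, hud⟩ := exists_global_solution (Λ := Plane × Plane)
    (f := fun _ t p => particleField τ ψ t p) (x₀ := id) (hfc.comp continuous_snd) continuous_id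
    fun l₀ T => by
      obtain ⟨K, hK, hK'⟩ := hL T
      obtain ⟨M, -, hM⟩ := exists_bound_of_continuous
        (g := fun (p : Plane × Plane) t => particleField τ ψ t p) (hfc.comp continuous_swap) l₀ T
      refine ⟨K, M, hK, ?_⟩
      filter_upwards [hM] with l hl t ht
      exact ⟨hK' t ht, hl t ht⟩
  let Φ : ℝ → Plane × Plane → Plane × Plane := fun t p => u p t
  have hL' : ∀ T, ∃ K : ℝ, ∀ t, |t| ≤ T → ∀ x y,
      ‖particleField τ ψ t x - particleField τ ψ t y‖ ≤ K * ‖x - y‖ := fun T => by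
    obtain ⟨K, -, hK⟩ := hL T
    exact ⟨K, hK⟩
  have hΦc : Continuous fun p : ℝ × (Plane × Plane) => Φ p.1 p.2 := huc.comp continuous_swap
  have hΦ : JointCn (j + 1) Φ := jointCn_flow j hf hΦc hu0 fun x t => hud x t
  have hC1 : C1InCn (j + 1) Φ := c1InCn_of_hasDerivAt hΦ (hf.comp hΦ) fun x t => hud x t
  -- By uniqueness, moving the initial position by a lattice vector moves the whole trajectory; this
  -- lets the flow descend to the torus.
  have hshift : ∀ t x y n, Φ t (x + latticeVec n, y) = Φ t (x, y) + (latticeVec n, 0) := by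
    intro t x y n
    refine eqOn_of_hasDerivAt (g := particleField τ ψ) isOpen_univ Set.ordConnected_univ
      (t₀ := 0) trivial hL' (u := fun t => Φ t (x + latticeVec n, y))
      (w := fun t => Φ t (x, y) + (latticeVec n, 0)) (fun t _ => hud _ t) (fun t _ => ?_) ?_ trivial
    · have h1 : particleField τ ψ t (Φ t (x, y) + (latticeVec n, 0)) =
          particleField τ ψ t (Φ t (x, y)) := by
        rw [show Φ t (x, y) + (latticeVec n, 0) =
          ((Φ t (x, y)).1 + latticeVec n, (Φ t (x, y)).2) by ext <;> simp]
        exact particleField_add_latticeVec _ _ _ _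
      rw [h1]
      exact (hud (x, y) t).add_const _
    · simp [Φ, hu0]
  choose lift hlift using proj_surjective
  let φ : ℝ → Phase → Phase := fun t z =>
    (proj (Φ t (lift z.1, z.2)).1, (Φ t (lift z.1, z.2)).2)
  have hsolve : ∀ x y t, HasDerivAt (fun s => (Φ s (x, y)).1) (Φ t (x, y)).2 t ∧
      HasDerivAt (fun s => (Φ s (x, y)).2)
        (τ⁻¹ • (perpGrad (ψ t) (proj (Φ t (x, y)).1) - (Φ t (x, y)).2)) t := by
    intro x y t
    have h1 := hud (x, y) t
    have h2 := (hasFDerivAt_fst (𝕜 := ℝ) (E := Plane) (F := Plane)).comp_hasDerivAt t h1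
    have h3 := (hasFDerivAt_snd (𝕜 := ℝ) (E := Plane) (F := Plane)).comp_hasDerivAt t h1
    refine ⟨h2, ?_⟩
    rw [perpGrad_proj ((jointCn_succ_iff.1 h).1 t _)]
    exact h3
  refine ⟨φ, ⟨Φ, hC1, fun t x y => ?_⟩, fun z => ⟨?_, fun t _ => ⟨⟨_, Eventually.of_forall
    fun s => rfl, (hsolve _ _ t).1⟩, (hsolve _ _ t).2⟩, ?_⟩⟩
  · obtain ⟨n, hn⟩ := proj_eq_iff.1 (hlift (proj x)).symm
    simp only [φ]
    rw [hn, hshift]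
    ext1
    · simp only [Prod.fst_add]
      exact proj_add_latticeVec _ _
    · simp
  · simp [φ, Φ, hu0, hlift]
  · intro J Z hJ hJ' h0 hZ0 hZ t ht
    have hyc : ContinuousOn (fun s => (Z s).2) J := fun s hs =>
      (hZ s hs).2.continuousAt.continuousWithinAt
    -- An arbitrary solution on the torus is lifted by integrating its velocity and is compared with
    -- the flow on the cover.
    let ξ : ℝ → Plane := fun s => lift z.1 + ∫ r in (0 : ℝ)..s, (Z r).2
    have hξ : ∀ s ∈ J, HasDerivAt ξ (Z s).2 s := fun s hs =>
      (intervalIntegral.integral_hasDerivAt_right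
        ((hyc.mono (hJ'.uIcc_subset h0 hs)).intervalIntegrable)
        (hyc.stronglyMeasurableAtFilter hJ s hs) (hZ s hs).2.continuousAt).const_add _
    have hx := eq_proj_of_hasTorusDerivAt hJ hJ' h0 (x := fun s => (Z s).1) (ξ := ξ)
      (fun s hs => (hZ s hs).1) hξ (by simp [ξ, hlift, hZ0])
    have heq := eqOn_of_hasDerivAt (g := particleField τ ψ) hJ hJ' h0 hL'
      (u := fun s => (ξ s, (Z s).2)) (w := fun s => Φ s (lift z.1, z.2)) (fun s hs => ?_)
      (fun s _ => hud _ s) (by simp [ξ, Φ, hu0, hZ0]) ht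
    · have h1 : Φ t (lift z.1, z.2) = (ξ t, (Z t).2) := heq.symm
      simp only [φ, h1]
      exact Prod.ext (hx t ht) rfl
    · refine (hξ s hs).prodMk ?_
      have h2 := (hZ s hs).2
      rwa [hx s hs, perpGrad_proj ((jointCn_succ_iff.1 h).1 s _)] at h2

end ParticleEquation

end InertialParticle

namespace InertialParticle

/-! ### Riemann–Stieltjes integrals -/

section RiemannStieltjes

variable {f f' : ℝ → ℝ} {g : ℝ → ℂ} {a b : ℝ}

/-- Both values are tested on the same fine uniform partition. If a > b there is no partition, and
every number would qualify. -/
theorem HasRSIntegral.unique {I I' : ℂ} (hab : a ≤ b) (h : HasRSIntegral f g a b I)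
    (h' : HasRSIntegral f g a b I') : I = I' := by
  refine eq_of_forall_dist_le fun ε hε => ?_
  obtain ⟨δ, hδ, H⟩ := h (ε / 2) (half_pos hε)
  obtain ⟨δ', hδ', H'⟩ := h' (ε / 2) (half_pos hε)
  obtain ⟨n, hn⟩ := exists_nat_gt ((b - a) / min δ δ')
  have hm : 0 < min δ δ' := lt_min hδ hδ'
  have hn0 : (0 : ℝ) < n := (div_nonneg (sub_nonneg.2 hab) hm.le).trans_lt hn
  let u : ℕ → ℝ := fun i => a + i * ((b - a) / n)
  have hstep : ∀ i, u (i + 1) - u i = (b - a) / n := fun i => by simp only [u]; push_cast; ring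
  have hlt : (b - a) / n < min δ δ' := by
    rw [div_lt_iff₀ hm] at hn
    rw [div_lt_iff₀ hn0]
    linarith
  have hpos : 0 ≤ (b - a) / n := div_nonneg (sub_nonneg.2 hab) hn0.le
  have hu0 : u 0 = a := by simp [u]
  have hun : u n = b := by simp only [u]; field_simp; ring
  have hmem : ∀ i, u i ∈ Set.Icc (u i) (u (i + 1)) := fun i =>
    ⟨le_rfl, by linarith [hstep i]⟩
  have h1 := H n u u hu0 hun fun i _ =>
    ⟨hmem i, by rw [hstep]; exact hlt.trans_le (min_le_left _ _)⟩
  have h2 := H' n u u hu0 hun fun i _ =>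
    ⟨hmem i, by rw [hstep]; exact hlt.trans_le (min_le_right _ _)⟩
  rw [← dist_eq_norm] at h1 h2
  linarith [dist_triangle_left I I' (∑ i ∈ Finset.range n, (f (u i) : ℂ) * (g (u (i + 1)) - g (u i)))]

/-- Integration by parts: existence and value of the Riemann–Stieltjes integral of a `C¹` function
against a continuous function. -/
theorem hasRSIntegral_of_hasDerivAt (hf : ∀ u, HasDerivAt f (f' u) u) (hf' : Continuous f')
    (hg : Continuous g) : HasRSIntegral f g a b
      (f b * g b - f a * g a - ∫ u in a..b, (f' u : ℂ) * g u) := by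
  intro ε hε
  obtain ⟨M, hM⟩ := ((isCompact_Icc (a := a) (b := b)).image hf'.norm).bddAbove
  have hMf : ∀ u ∈ Set.Icc a b, ‖f' u‖ ≤ |M| := fun u hu =>
    (hM ⟨u, hu, rfl⟩).trans (le_abs_self M)
  -- The total error will be at most |M| η (b - a); the added ones keep the denominator positive and
  -- the 2 makes the final inequality strict.
  set η : ℝ := ε / (2 * ((|M| + 1) * (|b - a| + 1))) with hη
  have hη0 : 0 < η := by positivity
  obtain ⟨δ, hδ, hδg⟩ := Metric.uniformContinuousOn_iff_le.1
    ((isCompact_Icc (a := a) (b := b)).uniformContinuousOn_of_continuous hg.continuousOn) η hη0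
  refine ⟨δ, hδ, fun n u ξ hu0 hun hp => ?_⟩
  have hmono : ∀ i < n, u i ≤ u (i + 1) := fun i hi => (hp i hi).1.1.trans (hp i hi).1.2
  have hle : ∀ i ≤ n, a ≤ u i := by
    intro i
    induction i with
    | zero => exact fun _ => hu0.ge
    | succ i ih => exact fun hi => (ih (by omega)).trans (hmono i (by omega))
  have hge : ∀ i ≤ n, u i ≤ b := by
    have h1 : ∀ j i, i + j = n → u i ≤ b := by
      intro j
      induction j with
      | zero => rintro i rfl; exact hun.le
      | succ j ih => exact fun i hi => (hmono i (by omega)).trans (ih (i + 1) (by omega))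
    exact fun i hi => h1 (n - i) i (by omega)
  have hfg : Continuous fun r => (f' r : ℂ) * g r := by fun_prop
  have hfc : Continuous fun r => (f' r : ℂ) := by fun_prop
  have hterm : ∀ i < n, ‖(f (ξ i) : ℂ) * (g (u (i + 1)) - g (u i)) -
      (f (u (i + 1)) * g (u (i + 1)) - f (u i) * g (u i) -
        ∫ r in u i..u (i + 1), (f' r : ℂ) * g r)‖ ≤ |M| * η * (u (i + 1) - u i) := by
    intro i hi
    obtain ⟨⟨h1, h2⟩, h3⟩ := hp i hi
    have hsub : ∀ r, u i ≤ r → r ≤ u (i + 1) → r ∈ Set.Icc a b := fun r hr hr' =>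
      ⟨(hle i hi.le).trans hr, hr'.trans (hge (i + 1) hi)⟩
    have hftc : ∀ c d, ∫ r in c..d, (f' r : ℂ) = f d - f c := fun c d => by
      rw [intervalIntegral.integral_ofReal, intervalIntegral.integral_eq_sub_of_hasDerivAt
        (fun r _ => hf r) (hf'.intervalIntegrable _ _)]
      push_cast; rfl
    -- Freezing g at a point w of the cell costs |M| η times the length. Each cell is cut at its
    -- tag, with g frozen at the left endpoint before it and at the right endpoint after it; the
    -- boundary terms then recombine to the Riemann–Stieltjes summand.
    have key : ∀ c d w, u i ≤ c → c ≤ d → d ≤ u (i + 1) → u i ≤ w → w ≤ u (i + 1) →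
        ‖(∫ r in c..d, (f' r : ℂ) * g r) - (f d - f c) * g w‖ ≤ |M| * η * (d - c) := by
      intro c d w hc hcd hd hw hw'
      have h4 : (∫ r in c..d, (f' r : ℂ) * g r) - (f d - f c) * g w =
          ∫ r in c..d, (f' r : ℂ) * (g r - g w) := by
        simp only [mul_sub]
        rw [intervalIntegral.integral_sub (hfg.intervalIntegrable _ _)
          ((by fun_prop : Continuous fun r => (f' r : ℂ) * g w).intervalIntegrable _ _),
          intervalIntegral.integral_mul_const, hftc]
      rw [h4]
      have h5 := intervalIntegral.norm_integral_le_of_norm_le_const (a := c) (b := d)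
        (C := |M| * η) (f := fun r => (f' r : ℂ) * (g r - g w)) fun r hr => by
          rw [Set.uIoc_of_le hcd] at hr
          have hr1 := hsub r (hc.trans hr.1.le) (hr.2.trans hd)
          have hw1 := hsub w hw hw'
          rw [norm_mul, Complex.norm_real]
          refine mul_le_mul (hMf r hr1) ?_ (norm_nonneg _) (abs_nonneg _)
          rw [← dist_eq_norm]
          refine hδg r hr1 w hw1 ?_
          rw [Real.dist_eq, abs_le]
          constructor <;> linarith [hr.1, hr.2]
      rwa [abs_of_nonneg (sub_nonneg.2 hcd)] at h5
    have k1 := key (u i) (ξ i) (u i) le_rfl h1 h2 le_rfl (h1.trans h2)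
    have k2 := key (ξ i) (u (i + 1)) (u (i + 1)) h1 h2 le_rfl (h1.trans h2) le_rfl
    have h6 := intervalIntegral.integral_add_adjacent_intervals
      (hfg.intervalIntegrable (μ := volume) (u i) (ξ i))
      (hfg.intervalIntegrable (ξ i) (u (i + 1)))
    rw [← h6]
    calc _ = ‖((∫ r in u i..ξ i, (f' r : ℂ) * g r) - (f (ξ i) - f (u i)) * g (u i)) +
          ((∫ r in ξ i..u (i + 1), (f' r : ℂ) * g r) -
            (f (u (i + 1)) - f (ξ i)) * g (u (i + 1)))‖ := by congr 1; ring
      _ ≤ _ := (norm_add_le _ _).trans (by linarith)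
  have htel : (f b * g b - f a * g a - ∫ u in a..b, (f' u : ℂ) * g u) =
      ∑ i ∈ Finset.range n, (f (u (i + 1)) * g (u (i + 1)) - f (u i) * g (u i) -
        ∫ r in u i..u (i + 1), (f' r : ℂ) * g r) := by
    rw [Finset.sum_sub_distrib, Finset.sum_range_sub fun i => (f (u i) : ℂ) * g (u i),
      intervalIntegral.sum_integral_adjacent_intervals fun i _ => hfg.intervalIntegrable _ _,
      hu0, hun]
  rw [htel, ← Finset.sum_sub_distrib]
  have hab : a ≤ b := hun ▸ hle n le_rfl
  calc _ ≤ ∑ i ∈ Finset.range n, |M| * η * (u (i + 1) - u i) :=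
        norm_sum_le_of_le _ fun i hi => hterm i (Finset.mem_range.1 hi)
    _ = |M| * η * (b - a) := by rw [← Finset.mul_sum, Finset.sum_range_sub, hu0, hun]
    _ ≤ (|M| + 1) * η * (|b - a| + 1) := by
        gcongr
        · linarith
        · linarith [le_abs_self (b - a)]
    _ = ε / 2 := by rw [hη]; field_simp
    _ < ε := half_lt_self hε

theorem HasRSIntegral.rsIntegral_eq {I : ℂ} (hab : a ≤ b) (h : HasRSIntegral f g a b I) :
    rsIntegral f g a b = I := by
  have hex : ∃ I, HasRSIntegral f g a b I := ⟨I, h⟩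
  rw [rsIntegral, dif_pos hex]
  exact hex.choose_spec.unique hab h

end RiemannStieltjes

end InertialParticle

namespace InertialParticle

/-! ### The pathwise Ornstein–Uhlenbeck functional and its discretisation -/

section OrnsteinUhlenbeck

/-- Continuous paths that grow more slowly than every exponential. -/
def SubexpPath (g : ℝ → ℂ) : Prop :=
  Continuous g ∧ ∀ ε > 0, ∃ C : ℝ, 0 ≤ C ∧ ∀ u, ‖g u‖ ≤ C * Real.exp (ε * |u|)

/-- The stationary Ornstein–Uhlenbeck functional `∫_{-∞}^t exp (-(t-u) a) dg(u)`, in the form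
`∫_0^∞ a exp (-a v) (g(t) - g(t-v)) dv`. -/
noncomputable def ouInt (a : ℝ) (g : ℝ → ℂ) (t : ℝ) : ℂ :=
  ∫ v in Set.Ioi (0 : ℝ), (a * Real.exp (-a * v)) • (g t - g (t - v))

/-- The integral `∫_s^t exp (-(t-u) a) dg(u)` after an integration by parts. -/
noncomputable def ouInc (a : ℝ) (g : ℝ → ℂ) (s t : ℝ) : ℂ :=
  g t - Real.exp (-(t - s) * a) * g s - ∫ u in s..t, ((a * Real.exp (-(t - u) * a) : ℝ) : ℂ) * g u

variable {a : ℝ} {g : ℝ → ℂ}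

theorem rsIntegral_exp_eq {ν α : ℝ} (hg : Continuous g) {s t : ℝ} (hst : s ≤ t) :
    rsIntegral (fun u => Real.exp (-(t - u) * ν * α)) g s t = ouInc (ν * α) g s t := by
  have hd : ∀ u, HasDerivAt (fun u => Real.exp (-(t - u) * ν * α))
      (ν * α * Real.exp (-(t - u) * (ν * α))) u := fun u => by
    have h1 : HasDerivAt (fun u => -(t - u) * ν * α) (ν * α) u := by
      have := ((((hasDerivAt_id u).const_sub t).neg).mul_const ν).mul_const α
      simpa using this
    convert h1.exp using 1
    rw [mul_comm, mul_assoc (-(t - u))]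
  rw [(hasRSIntegral_of_hasDerivAt hd (by fun_prop) hg).rsIntegral_eq hst, ouInc]
  simp [mul_assoc]

/-- Variation of constants over two adjacent intervals; letting r → -∞ gives the mild equation for
the stationary functional. -/
theorem ouInc_add (hg : Continuous g) (r s t : ℝ) :
    ouInc a g r t = Real.exp (-(t - s) * a) * ouInc a g r s + ouInc a g s t := by
  have hc : ∀ t, Continuous fun u => ((a * Real.exp (-(t - u) * a) : ℝ) : ℂ) * g u := fun t => by
    fun_prop
  have h1 := intervalIntegral.integral_add_adjacent_intervals
    ((hc t).intervalIntegrable (μ := volume) r s) ((hc t).intervalIntegrable s t)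
  have h2 : ∫ u in r..s, ((a * Real.exp (-(t - u) * a) : ℝ) : ℂ) * g u =
      Real.exp (-(t - s) * a) * ∫ u in r..s, ((a * Real.exp (-(s - u) * a) : ℝ) : ℂ) * g u := by
    rw [← intervalIntegral.integral_const_mul]
    congr 1
    funext u
    rw [show -(t - u) * a = -(t - s) * a + -(s - u) * a by ring, Real.exp_add]
    push_cast
    ring
  have h3 : Real.exp (-(t - r) * a) = Real.exp (-(t - s) * a) * Real.exp (-(s - r) * a) := by
    rw [← Real.exp_add]
    congr 1
    ring
  simp only [ouInc]
  rw [← h1, h2, h3]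
  push_cast
  ring

theorem SubexpPath.exists_bound_sub (hg : SubexpPath g) {ε : ℝ} (hε : 0 < ε) (t : ℝ) :
    ∃ C : ℝ, 0 ≤ C ∧ ∀ v, 0 ≤ v → ‖g t - g (t - v)‖ ≤ C * Real.exp (ε * v) := by
  obtain ⟨C, hC, h⟩ := hg.2 ε hε
  refine ⟨2 * C * Real.exp (ε * |t|), by positivity, fun v hv => ?_⟩
  have h1 : ‖g t‖ ≤ C * (Real.exp (ε * |t|) * Real.exp (ε * v)) := by
    refine (h t).trans (mul_le_mul_of_nonneg_left ?_ hC)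
    exact le_mul_of_one_le_right (Real.exp_nonneg _) (Real.one_le_exp (by positivity))
  have h2 : ‖g (t - v)‖ ≤ C * (Real.exp (ε * |t|) * Real.exp (ε * v)) := by
    refine (h _).trans (mul_le_mul_of_nonneg_left ?_ hC)
    rw [← Real.exp_add, ← mul_add]
    refine Real.exp_le_exp.2 (mul_le_mul_of_nonneg_left ?_ hε.le)
    refine (abs_sub _ _).trans_eq ?_
    rw [abs_of_nonneg hv]
  calc _ ≤ ‖g t‖ + ‖g (t - v)‖ := norm_sub_le _ _
    _ ≤ _ := by linarith

/-- Growth at rate a/2 is beaten by decay at rate a. The separate offset w ≤ v lets one dominating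
function serve the integrand and all its grid approximations. -/
theorem SubexpPath.exists_exp_bound (ha : 0 < a) (hg : SubexpPath g) (t : ℝ) :
    ∃ C : ℝ, 0 ≤ C ∧ ∀ v, 0 ≤ v → ∀ w, 0 ≤ w → w ≤ v →
      ‖(a * Real.exp (-a * v)) • (g t - g (t - w))‖ ≤ C * Real.exp (-(a / 2) * v) := by
  obtain ⟨C, hC, h⟩ := hg.exists_bound_sub (half_pos ha) t
  refine ⟨a * C, by positivity, fun v hv w hw hwv => ?_⟩
  rw [norm_smul, Real.norm_of_nonneg (by positivity)]
  calc a * Real.exp (-a * v) * ‖g t - g (t - w)‖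
      ≤ a * Real.exp (-a * v) * (C * Real.exp (a / 2 * v)) := by
        gcongr
        refine (h w hw).trans ?_
        gcongr
    _ = a * C * Real.exp (-(a / 2) * v) := by
        rw [show -(a / 2) * v = -a * v + a / 2 * v by ring, Real.exp_add]
        ring

theorem SubexpPath.continuous_integrand (hg : SubexpPath g) (t : ℝ) :
    Continuous fun v => (a * Real.exp (-a * v)) • (g t - g (t - v)) := by
  have := hg.1
  fun_prop

theorem SubexpPath.integrableOn (ha : 0 < a) (hg : SubexpPath g) (t : ℝ) :
    IntegrableOn (fun v => (a * Real.exp (-a * v)) • (g t - g (t - v))) (Set.Ioi 0) := by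
  obtain ⟨C, hC, h⟩ := hg.exists_exp_bound ha t
  refine Integrable.mono' ((integrableOn_exp_mul_Ioi (by linarith : -(a / 2) < 0) 0).const_mul C)
    (hg.continuous_integrand t).aestronglyMeasurable ?_
  exact (ae_restrict_iff' measurableSet_Ioi).2 (ae_of_all _ fun v hv =>
    h v (le_of_lt hv) v (le_of_lt hv) le_rfl)

/-- The substitution v = t - u leaves the truncated integral of increments and a boundary term,
which is killed by the subexponential growth of g. -/
theorem SubexpPath.tendsto_ouInc (ha : 0 < a) (hg : SubexpPath g) (t : ℝ) :
    Tendsto (fun s => ouInc a g s t) atBot (𝓝 (ouInt a g t)) := by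
  have h1 : ∀ s, ouInc a g s t = (∫ v in (0 : ℝ)..(t - s), (a * Real.exp (-a * v)) •
      (g t - g (t - v))) + Real.exp (-(t - s) * a) * (g t - g s) := by
    intro s
    have hc := hg.1
    have h2 := intervalIntegral.integral_comp_sub_left (a := s) (b := t)
      (fun v => (a * Real.exp (-a * v)) • (g t - g (t - v))) t
    simp only [sub_self, sub_sub_cancel] at h2
    rw [← h2]
    have h3 : ∀ u, (a * Real.exp (-a * (t - u))) • (g t - g u) =
        ((a * Real.exp (-(t - u) * a) : ℝ) : ℂ) * g t -
          ((a * Real.exp (-(t - u) * a) : ℝ) : ℂ) * g u := fun u => by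
      rw [Complex.real_smul, mul_sub, show -a * (t - u) = -(t - u) * a by ring]
    simp only [h3]
    rw [intervalIntegral.integral_sub (Continuous.intervalIntegrable (by fun_prop) _ _)
      (Continuous.intervalIntegrable (by fun_prop) _ _), intervalIntegral.integral_mul_const,
      intervalIntegral.integral_ofReal]
    have h4 : ∫ u in s..t, a * Real.exp (-(t - u) * a) = 1 - Real.exp (-(t - s) * a) := by
      rw [intervalIntegral.integral_eq_sub_of_hasDerivAt
        (f := fun u => Real.exp (-(t - u) * a)) (fun u _ => ?_)
        (Continuous.intervalIntegrable (by fun_prop) _ _)]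
      · simp
      · have h5 : HasDerivAt (fun u => -(t - u) * a) a u := by
          have := (((hasDerivAt_id u).const_sub t).neg).mul_const a
          simpa using this
        exact h5.exp.congr_deriv (by ring)
    rw [h4, ouInc]
    push_cast
    ring
  have hts : Tendsto (fun s : ℝ => t - s) atBot atTop := by
    simpa [sub_eq_add_neg] using tendsto_atTop_add_const_left _ t tendsto_neg_atBot_atTop
  have h2 := (intervalIntegral_tendsto_integral_Ioi 0 (hg.integrableOn ha t) tendsto_id).comp hts
  obtain ⟨C, hC, hb⟩ := hg.exists_bound_sub (half_pos ha) t
  have h3 : Tendsto (fun s => (Real.exp (-(t - s) * a) : ℂ) * (g t - g s)) atBot (𝓝 0) := by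
    rw [tendsto_zero_iff_norm_tendsto_zero]
    have h4 : Tendsto (fun s => C * Real.exp (-((a / 2) * (t - s)))) atBot (𝓝 0) := by
      have := (Real.tendsto_exp_neg_atTop_nhds_zero.comp
        (hts.const_mul_atTop (half_pos ha))).const_mul C
      simpa [Function.comp_def] using this
    refine tendsto_of_tendsto_of_tendsto_of_le_of_le' tendsto_const_nhds h4
      (Eventually.of_forall fun s => norm_nonneg _) ?_
    filter_upwards [eventually_le_atBot t] with s hs
    rw [norm_mul, Complex.norm_real, Real.norm_of_nonneg (Real.exp_nonneg _)]
    have h5 := hb (t - s) (by linarith)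
    rw [sub_sub_cancel] at h5
    calc _ ≤ Real.exp (-(t - s) * a) * (C * Real.exp (a / 2 * (t - s))) := by gcongr
      _ = C * Real.exp (-((a / 2) * (t - s))) := by
        rw [show -((a / 2) * (t - s)) = -(t - s) * a + a / 2 * (t - s) by ring, Real.exp_add]
        ring
  have h6 := h2.add h3
  rw [add_zero] at h6
  exact h6.congr fun s => (h1 s).symm

theorem rsIntegralIic_exp_eq {ν α t : ℝ} (ha : 0 < ν * α) (hg : SubexpPath g) :
    rsIntegralIic (fun u => Real.exp (-(t - u) * ν * α)) g t = ouInt (ν * α) g t := by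
  refine ((hg.tendsto_ouInc ha t).congr' ?_).limUnder_eq
  filter_upwards [eventually_le_atBot t] with s hs
  exact (rsIntegral_exp_eq hg.1 hs).symm

theorem ouInt_eq (ha : 0 < a) (hg : SubexpPath g) (s t : ℝ) :
    ouInt a g t = Real.exp (-(t - s) * a) * ouInt a g s + ouInc a g s t := by
  refine tendsto_nhds_unique (hg.tendsto_ouInc ha t) ?_
  exact (((hg.tendsto_ouInc ha s).const_mul _).add_const _).congr fun r =>
    (ouInc_add hg.1 r s t).symm

/-- Starting at time 0 and pulling exp(-ta) out of the integral leaves a primitive of a function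
that does not involve t. -/
theorem continuous_ouInt (ha : 0 < a) (hg : SubexpPath g) : Continuous (ouInt a g) := by
  have h1 : ouInt a g = fun t => Real.exp (-(t - 0) * a) * ouInt a g 0 + (g t -
      Real.exp (-(t - 0) * a) * g 0 - Real.exp (-t * a) *
        ∫ u in (0 : ℝ)..t, ((a * Real.exp (u * a) : ℝ) : ℂ) * g u) := by
    funext t
    rw [ouInt_eq ha hg 0 t, ouInc, ← intervalIntegral.integral_const_mul]
    congr 4
    funext u
    rw [show -(t - u) * a = -t * a + u * a by ring, Real.exp_add]
    push_cast
    ring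
  rw [h1]
  have hc := hg.1
  have h2 : Continuous fun t => ∫ u in (0 : ℝ)..t, ((a * Real.exp (u * a) : ℝ) : ℂ) * g u :=
    intervalIntegral.continuous_primitive
      (fun x y => Continuous.intervalIntegrable (by fun_prop) x y) 0
  fun_prop

/-- The weights of the discretised Ornstein–Uhlenbeck functional. -/
noncomputable def ouWeight (a : ℝ) (n j : ℕ) : ℝ :=
  Real.exp (-a * (j / (n + 1))) - Real.exp (-a * ((j + 1 : ℕ) / (n + 1)))

/-- The discretised Ornstein–Uhlenbeck functional. -/
noncomputable def ouApprox {E : Type*} [AddCommGroup E] [Module ℝ E] (a : ℝ) (n : ℕ) (g : ℝ → E)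
    (t : ℝ) : E :=
  ∑ j ∈ Finset.range ((n + 1) ^ 2), ouWeight a n j • (g t - g (t - j / (n + 1)))

theorem ouWeight_nonneg (ha : 0 < a) (n j : ℕ) : 0 ≤ ouWeight a n j := by
  refine sub_nonneg.2 (Real.exp_le_exp.2 ?_)
  rw [neg_mul, neg_mul, neg_le_neg_iff]
  gcongr
  exact Nat.le_succ j

theorem ouWeight_eq_integral (a : ℝ) (n j : ℕ) :
    ouWeight a n j = ∫ v in ((j : ℝ) / (n + 1))..((j + 1 : ℕ) / (n + 1)), a * Real.exp (-a * v) := by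
  rw [intervalIntegral.integral_eq_sub_of_hasDerivAt (f := fun v => -Real.exp (-a * v))
    (fun v _ => ?_) (Continuous.intervalIntegrable (by fun_prop) _ _), ouWeight]
  · ring
  · have h5 : HasDerivAt (fun v => -a * v) (-a) v := by
      simpa using (hasDerivAt_id v).const_mul (-a)
    exact h5.exp.fun_neg.congr_deriv (by ring)

theorem sum_ouWeight_le_one (n N : ℕ) :
    ∑ j ∈ Finset.range N, ouWeight a n j ≤ 1 := by
  have := Finset.sum_range_sub' (fun j : ℕ => Real.exp (-a * ((j : ℝ) / (n + 1)))) N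
  simp only [ouWeight]
  rw [this]
  simp [Real.exp_nonneg]

/-- The discretisation points. -/
noncomputable def gridFloor (n : ℕ) (v : ℝ) : ℝ := ((⌈(n + 1) * v⌉₊ - 1 : ℕ) : ℝ) / (n + 1)

/-- The ceiling minus one is used instead of the floor because the cells are open on the left and
closed on the right, as in interval integrals. -/
theorem gridFloor_eq {n j : ℕ} {v : ℝ}
    (hv : v ∈ Set.Ioc ((j : ℝ) / (n + 1)) ((j + 1 : ℕ) / (n + 1))) : gridFloor n v = j / (n + 1) := by
  have hn : (0 : ℝ) < n + 1 := by positivity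
  have h1 : ⌈(n + 1) * v⌉₊ = j + 1 := by
    rw [Nat.ceil_eq_iff (by omega)]
    have h2 := (div_lt_iff₀ hn).1 hv.1
    have h3 := (le_div_iff₀ hn).1 hv.2
    simp only [Nat.add_sub_cancel]
    constructor <;> linarith
  simp [gridFloor, h1]

theorem gridFloor_nonneg (n : ℕ) (v : ℝ) : 0 ≤ gridFloor n v := by
  unfold gridFloor
  positivity

theorem gridFloor_mem {n : ℕ} {v : ℝ} (hv : 0 < v) :
    gridFloor n v ≤ v ∧ v - gridFloor n v ≤ 1 / ((n : ℝ) + 1) := by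
  have hn : (0 : ℝ) < n + 1 := by positivity
  have h0 : 0 < (n + 1) * v := by positivity
  have h1 : 1 ≤ ⌈(n + 1) * v⌉₊ := Nat.one_le_iff_ne_zero.2 (Nat.ceil_pos.2 h0).ne'
  have h2 := Nat.ceil_lt_add_one h0.le
  have h3 := Nat.le_ceil ((n + 1) * v)
  unfold gridFloor
  push_cast [h1]
  constructor
  · rw [div_le_iff₀ hn]
    linarith
  · rw [sub_le_iff_le_add, ← add_div, le_div_iff₀ hn]
    linarith

/-- The (n + 1)² cells of width 1/(n + 1) fill (0, n + 1], so mesh and cut-off are refined together;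
the weights are the masses of the density a e^{-av} on the cells. -/
theorem ouApprox_eq_integral (n : ℕ) (t : ℝ) :
    ouApprox a n g t = ∫ v in (0 : ℝ)..(n + 1),
      (a * Real.exp (-a * v)) • (g t - g (t - gridFloor n v)) := by
  have hn : (0 : ℝ) < n + 1 := by positivity
  have hle : ∀ j : ℕ, (j : ℝ) / (n + 1) ≤ (j + 1 : ℕ) / (n + 1) := fun j => by
    gcongr
    exact Nat.le_succ j
  have hcong : ∀ j : ℕ, Set.EqOn (fun v => (a * Real.exp (-a * v)) • (g t - g (t - j / (n + 1))))
      (fun v => (a * Real.exp (-a * v)) • (g t - g (t - gridFloor n v)))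
      (Set.uIoc ((j : ℝ) / (n + 1)) ((j + 1 : ℕ) / (n + 1))) := fun j v hv => by
    rw [Set.uIoc_of_le (hle j)] at hv
    simp only [gridFloor_eq hv]
  have hint : ∀ j : ℕ, IntervalIntegrable
      (fun v => (a * Real.exp (-a * v)) • (g t - g (t - gridFloor n v))) volume
      ((j : ℝ) / (n + 1)) ((j + 1 : ℕ) / (n + 1)) := fun j =>
    (Continuous.intervalIntegrable (by fun_prop) _ _).congr (hcong j)
  have h1 := intervalIntegral.sum_integral_adjacent_intervals
    (f := fun v => (a * Real.exp (-a * v)) • (g t - g (t - gridFloor n v))) (μ := volume)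
    (a := fun j : ℕ => (j : ℝ) / (n + 1)) (n := (n + 1) ^ 2) fun j _ => hint j
  have h2 : (((n + 1) ^ 2 : ℕ) : ℝ) / (n + 1) = n + 1 := by
    push_cast
    field_simp
  rw [h2] at h1
  simp only [Nat.cast_zero, zero_div] at h1
  rw [← h1, ouApprox]
  refine Finset.sum_congr rfl fun j _ => ?_
  rw [← intervalIntegral.integral_congr_ae (ae_of_all _ fun v hv => hcong j hv),
    intervalIntegral.integral_smul_const, ouWeight_eq_integral]

/-- Dominated convergence. The approximations are finite combinations of values of g, so
sub-Gaussian bounds and measurability pass from them to the functional. -/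
theorem SubexpPath.tendsto_ouApprox (ha : 0 < a) (hg : SubexpPath g) (t : ℝ) :
    Tendsto (fun n => ouApprox a n g t) atTop (𝓝 (ouInt a g t)) := by
  obtain ⟨C, hC, hb⟩ := hg.exists_exp_bound ha t
  have hmeas : ∀ n : ℕ, AEStronglyMeasurable
      (fun v => (Set.Ioc (0 : ℝ) (n + 1)).indicator (fun v => (a * Real.exp (-a * v)) •
        (g t - g (t - gridFloor n v))) v) (volume.restrict (Set.Ioi 0)) := fun n => by
    refine AEStronglyMeasurable.indicator (Measurable.aestronglyMeasurable ?_) measurableSet_Ioc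
    have h1 : Measurable fun v => gridFloor n v := by
      unfold gridFloor
      have h2 : Measurable fun v : ℝ => ⌈((n : ℝ) + 1) * v⌉₊ - 1 :=
        (measurable_from_nat (f := fun k => k - 1)).comp (Nat.measurable_ceil.comp (by fun_prop))
      exact (measurable_from_nat (f := fun k : ℕ => (k : ℝ)).comp h2).div_const _
    have h3 : Measurable g := hg.1.measurable
    fun_prop
  have h1 : ∀ n : ℕ, ouApprox a n g t = ∫ v in Set.Ioi (0 : ℝ), (Set.Ioc (0 : ℝ) (n + 1)).indicator
      (fun v => (a * Real.exp (-a * v)) • (g t - g (t - gridFloor n v))) v := fun n => by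
    rw [ouApprox_eq_integral, intervalIntegral.integral_of_le (by positivity),
      setIntegral_indicator measurableSet_Ioc, Set.inter_eq_right.2 Set.Ioc_subset_Ioi_self]
  simp only [h1]
  refine tendsto_integral_of_dominated_convergence (fun v => C * Real.exp (-(a / 2) * v)) hmeas
    ((integrableOn_exp_mul_Ioi (by linarith : -(a / 2) < 0) 0).const_mul C) (fun n => ?_) ?_
  · refine (ae_restrict_iff' measurableSet_Ioi).2 (ae_of_all _ fun v hv => ?_)
    refine (norm_indicator_le_norm_self _ _).trans ?_
    exact hb v (le_of_lt hv) _ (gridFloor_nonneg n v) (gridFloor_mem hv).1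
  · refine (ae_restrict_iff' measurableSet_Ioi).2 (ae_of_all _ fun v hv => ?_)
    have h2 : Tendsto (fun n => gridFloor n v) atTop (𝓝 v) := by
      have h3 : Tendsto (fun n : ℕ => v - 1 / ((n : ℝ) + 1)) atTop (𝓝 v) := by
        simpa using (tendsto_one_div_add_atTop_nhds_zero_nat (𝕜 := ℝ)).const_sub v
      exact tendsto_of_tendsto_of_tendsto_of_le_of_le h3 tendsto_const_nhds
        (fun n => by linarith [(gridFloor_mem (n := n) hv).2]) fun n => (gridFloor_mem hv).1
    have h4 : Tendsto (fun n => (a * Real.exp (-a * v)) • (g t - g (t - gridFloor n v))) atTop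
        (𝓝 ((a * Real.exp (-a * v)) • (g t - g (t - v)))) :=
      ((((hg.1.tendsto _).comp (h2.const_sub t))).const_sub _).const_smul _
    refine h4.congr' ?_
    obtain ⟨N, hN⟩ := exists_nat_ge v
    filter_upwards [eventually_ge_atTop N] with n hn
    rw [Set.indicator_of_mem]
    refine ⟨hv, hN.trans ?_⟩
    have : (N : ℝ) ≤ n := by exact_mod_cast hn
    linarith

end OrnsteinUhlenbeck

end InertialParticle

namespace InertialParticle

open scoped ENNReal NNReal

/-! ### Sub-Gaussian random variables -/

section SubGaussian

variable {Ω : Type*} [MeasurableSpace Ω] {P : Measure Ω}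

theorem _root_.ProbabilityTheory.HasSubgaussianMGF.mono {X : Ω → ℝ} {c c' : ℝ≥0}
    (h : HasSubgaussianMGF X c P) (hc : c ≤ c') : HasSubgaussianMGF X c' P :=
  ⟨h.integrable_exp_mul, fun t => (h.mgf_le t).trans (Real.exp_le_exp.2 (by gcongr))⟩

/-- The constant in the moment bound for sub-Gaussian random variables. -/
noncomputable def momentConst (p : ℕ) : ℝ≥0 :=
  ((2 * p).factorial * (2 * Real.exp (1 / 2)) : ℝ).toNNReal

/-- The inequality x^{2p} ≤ (2p)! (eˣ + e⁻ˣ) is used at x = X/√c, the scale at which both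
exponential moments are at most e^{1/2}. -/
theorem _root_.ProbabilityTheory.HasSubgaussianMGF.lintegral_pow_le {X : Ω → ℝ} {c : ℝ≥0}
    (h : HasSubgaussianMGF X c P) (hc : 0 < c) (p : ℕ) :
    ∫⁻ ω, ‖X ω‖ₑ ^ (2 * p) ∂P ≤ momentConst p * (c : ℝ≥0∞) ^ p := by
  have hc' : (0 : ℝ) < c := hc
  set r : ℝ := (√c)⁻¹ with hr
  have hr2 : (c : ℝ) * r ^ 2 = 1 := by
    rw [hr, inv_pow, Real.sq_sqrt hc'.le, mul_inv_cancel₀ hc'.ne']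
  have hpt : ∀ ω, ‖X ω‖ₑ ^ (2 * p) ≤ ENNReal.ofReal ((2 * p).factorial * (c : ℝ) ^ p *
      (Real.exp (r * X ω) + Real.exp (-r * X ω))) := fun ω => by
    rw [← ofReal_norm, ← ENNReal.ofReal_pow (norm_nonneg _)]
    refine ENNReal.ofReal_le_ofReal ?_
    have h1 := Real.pow_div_factorial_le_exp |r * X ω| (abs_nonneg _) (2 * p)
    rw [div_le_iff₀ (by positivity)] at h1
    have h2 : Real.exp |r * X ω| ≤ Real.exp (r * X ω) + Real.exp (-r * X ω) := by
      rcases abs_cases (r * X ω) with ⟨h, -⟩ | ⟨h, -⟩ <;> rw [h]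
      · linarith [Real.exp_pos (-r * X ω)]
      · rw [neg_mul]
        linarith [Real.exp_pos (r * X ω)]
    have h3 : ‖X ω‖ ^ (2 * p) = (c : ℝ) ^ p * |r * X ω| ^ (2 * p) := by
      rw [abs_mul, mul_pow, pow_mul |r|, sq_abs, ← mul_assoc, ← mul_pow, hr2, one_pow, one_mul,
        Real.norm_eq_abs]
    rw [h3]
    calc (c : ℝ) ^ p * |r * X ω| ^ (2 * p)
        ≤ (c : ℝ) ^ p * ((Real.exp (r * X ω) + Real.exp (-r * X ω)) * (2 * p).factorial) := by
          gcongr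
          exact h1.trans (by gcongr)
      _ = _ := by ring
  have hi1 := h.integrable_exp_mul r
  have hi2 := h.integrable_exp_mul (-r)
  have hm : ∀ s, (c : ℝ) * s ^ 2 = 1 → ∫ ω, Real.exp (s * X ω) ∂P ≤ Real.exp (1 / 2) := fun s hs => by
    have := h.mgf_le s
    rw [hs] at this
    exact this
  refine (lintegral_mono hpt).trans ?_
  have hi : Integrable (fun ω => (2 * p).factorial * (c : ℝ) ^ p *
      (Real.exp (r * X ω) + Real.exp (-r * X ω))) P := (hi1.add hi2).const_mul _
  rw [← ofReal_integral_eq_lintegral_ofReal hi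
    (ae_of_all _ fun ω => by positivity), integral_const_mul]
  have h4 : ∫ ω, (Real.exp (r * X ω) + Real.exp (-r * X ω)) ∂P ≤ 2 * Real.exp (1 / 2) := by
    rw [integral_add hi1 hi2]
    linarith [hm r hr2, hm (-r) (by rw [neg_sq, hr2])]
  have h5 : (momentConst p : ℝ≥0∞) * (c : ℝ≥0∞) ^ p =
      ENNReal.ofReal ((2 * p).factorial * (2 * Real.exp (1 / 2)) * (c : ℝ) ^ p) := by
    rw [ENNReal.ofReal_mul (by positivity), ENNReal.ofReal_pow hc'.le, ENNReal.ofReal_coe_nnreal]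
    rfl
  rw [h5]
  refine ENNReal.ofReal_le_ofReal ?_
  calc ((2 * p).factorial * (c : ℝ) ^ p) * _ ≤
      ((2 * p).factorial * (c : ℝ) ^ p) * (2 * Real.exp (1 / 2)) := by gcongr
    _ = _ := by ring

/-- Almost sure limits of sub-Gaussian random variables are sub-Gaussian. -/
theorem hasSubgaussianMGF_of_tendsto {X : ℕ → Ω → ℝ} {Y : Ω → ℝ} {c : ℝ≥0}
    (h : ∀ n, HasSubgaussianMGF (X n) c P)
    (hlim : ∀ᵐ ω ∂P, Tendsto (fun n => X n ω) atTop (𝓝 (Y ω))) : HasSubgaussianMGF Y c P := by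
  have hY : AEMeasurable Y P := aemeasurable_of_tendsto_metrizable_ae atTop
    (fun n => (h n).aemeasurable) hlim
  -- Fatou's lemma for the exponential moments.
  have key : ∀ t : ℝ, ∫⁻ ω, ENNReal.ofReal (Real.exp (t * Y ω)) ∂P ≤
      ENNReal.ofReal (Real.exp (c * t ^ 2 / 2)) := by
    intro t
    have h1 : ∀ᵐ ω ∂P, ENNReal.ofReal (Real.exp (t * Y ω)) =
        liminf (fun n => ENNReal.ofReal (Real.exp (t * X n ω))) atTop := by
      filter_upwards [hlim] with ω hω
      refine (Tendsto.liminf_eq ?_).symm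
      exact (ENNReal.continuous_ofReal.tendsto _).comp
        ((Real.continuous_exp.tendsto _).comp (hω.const_mul t))
    rw [lintegral_congr_ae h1]
    refine (lintegral_liminf_le' fun n => ((h n).integrable_exp_mul t).1.aemeasurable.ennreal_ofReal
      ).trans ?_
    refine (liminf_le_liminf (Eventually.of_forall fun n => ?_)).trans_eq (liminf_const _)
    rw [← ofReal_integral_eq_lintegral_ofReal ((h n).integrable_exp_mul t)
      (ae_of_all _ fun ω => Real.exp_nonneg _)]
    exact ENNReal.ofReal_le_ofReal ((h n).mgf_le t)
  have hint : ∀ t, Integrable (fun ω => Real.exp (t * Y ω)) P := fun t =>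
    ⟨(Real.measurable_exp.comp_aemeasurable (hY.const_mul t)).aestronglyMeasurable, by
      rw [hasFiniteIntegral_iff_ofReal (ae_of_all _ fun ω => Real.exp_nonneg _)]
      exact (key t).trans_lt ENNReal.ofReal_lt_top⟩
  refine ⟨hint, fun t => ?_⟩
  have h2 := key t
  rw [← ofReal_integral_eq_lintegral_ofReal (hint t) (ae_of_all _ fun ω => Real.exp_nonneg _)] at h2
  exact (ENNReal.ofReal_le_ofReal_iff (Real.exp_nonneg _)).1 h2

theorem hasSubgaussianMGF_of_hasGaussianLaw {X : Ω → ℝ} (hX : HasGaussianLaw X P)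
    (h0 : ∫ ω, X ω ∂P = 0) {c : ℝ≥0} (hc : ∫ ω, X ω ^ 2 ∂P ≤ c) : HasSubgaussianMGF X c P := by
  have hmap := hX.map_eq_gaussianReal
  have hXm : AEMeasurable X P := hX.aemeasurable
  refine ⟨fun t => ?_, fun t => ?_⟩
  · have h1 := integrable_exp_mul_gaussianReal (μ := P[X]) (v := Var[X; P].toNNReal) t
    rw [← hmap] at h1
    exact h1.comp_aemeasurable hXm
  · rw [mgf_gaussianReal hmap, h0, zero_mul, zero_add]
    refine Real.exp_le_exp.2 ?_
    have h2 : Var[X; P] ≤ c := by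
      rw [variance_of_integral_eq_zero hXm h0]
      exact hc
    have h3 : ((Var[X; P].toNNReal : ℝ≥0) : ℝ) ≤ c := by
      rw [Real.coe_toNNReal _ (variance_nonneg _ _)]
      exact h2
    gcongr

end SubGaussian

/-! ### Dyadic chaining -/

section Chaining

variable {Ω : Type*} [MeasurableSpace Ω] {P : Measure Ω} {d : ℕ}

/-- The dyadic point `q / 2ⁿ`. -/
noncomputable def dyadicPt (n : ℕ) (q : Fin d → ℕ) : Fin d → ℝ := fun l => (q l : ℝ) / 2 ^ n

/-- A neighbour of the dyadic point with index `q` in the next dyadic grid. -/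
def dyadicChild (n : ℕ) (q ε : Fin d → ℕ) : Fin d → ℕ := fun l => min (2 * q l + ε l) (2 ^ (n + 1))

/-- The indices of the dyadic grid of level `n` in the unit cube. -/
def dyadicGrid (d n : ℕ) : Finset (Fin d → ℕ) := Fintype.piFinset fun _ => Finset.range (2 ^ n + 1)

theorem dyadicPt_mem {n : ℕ} {q : Fin d → ℕ} (hq : ∀ l, q l ≤ 2 ^ n) :
    dyadicPt n q ∈ Set.Icc (0 : Fin d → ℝ) 1 := by
  refine ⟨fun l => by simp only [dyadicPt, Pi.zero_apply]; positivity, fun l => ?_⟩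
  simp only [dyadicPt, Pi.one_apply]
  rw [div_le_one (by positivity)]
  exact_mod_cast hq l

theorem mem_dyadicGrid {n : ℕ} {q : Fin d → ℕ} : q ∈ dyadicGrid d n ↔ ∀ l, q l ≤ 2 ^ n := by
  simp [dyadicGrid]

theorem norm_dyadicPt_sub_le {n : ℕ} {q ε : Fin d → ℕ} (hq : ∀ l, q l ≤ 2 ^ n)
    (hε : ∀ l, ε l ≤ 1) :
    ‖dyadicPt (n + 1) (dyadicChild n q ε) - dyadicPt n q‖ ≤ (1 / 2) ^ (n + 1) := by
  refine (pi_norm_le_iff_of_nonneg (by positivity)).2 fun l => ?_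
  have h1 : 2 * q l ≤ dyadicChild n q ε l := le_min (by omega) (by
    rw [pow_succ]; have := hq l; omega)
  have h2 : dyadicChild n q ε l ≤ 2 * q l + 1 := (min_le_left _ _).trans (by have := hε l; omega)
  have h1' : (2 * q l : ℝ) ≤ dyadicChild n q ε l := by exact_mod_cast h1
  have h2' : (dyadicChild n q ε l : ℝ) ≤ 2 * q l + 1 := by exact_mod_cast h2
  have h3 : dyadicPt (n + 1) (dyadicChild n q ε) l - dyadicPt n q l =
      ((dyadicChild n q ε l : ℝ) - 2 * q l) * (1 / 2) ^ (n + 1) := by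
    simp only [dyadicPt, one_div, inv_pow]
    rw [pow_succ]
    field_simp
  rw [Pi.sub_apply, h3, Real.norm_eq_abs, abs_of_nonneg (mul_nonneg (by linarith) (by positivity))]
  exact mul_le_of_le_one_left (by positivity) (by linarith)

/-- The constant of the chaining bound. -/
noncomputable def chainConst (d p : ℕ) : ℝ≥0∞ :=
  (1 + (1 - (1 / 2 : ℝ≥0∞) ^ (1 / p : ℝ))⁻¹) ^ p * 2 ^ (d + 1)

theorem chainConst_ne_top (d : ℕ) {p : ℕ} (hp : p ≠ 0) : chainConst d p ≠ ∞ := by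
  have h1 : (1 / 2 : ℝ≥0∞) ^ (1 / p : ℝ) < 1 := by
    refine ENNReal.rpow_lt_one (by simp [ENNReal.inv_lt_one]) ?_
    have : (0 : ℝ) < p := by exact_mod_cast Nat.pos_of_ne_zero hp
    positivity
  have h2 : (1 - (1 / 2 : ℝ≥0∞) ^ (1 / p : ℝ))⁻¹ ≠ ∞ :=
    ENNReal.inv_ne_top.2 (tsub_pos_of_lt h1).ne'
  unfold chainConst
  exact ENNReal.mul_ne_top (ENNReal.pow_ne_top (ENNReal.add_ne_top.2 ⟨ENNReal.one_ne_top, h2⟩))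
    (ENNReal.pow_ne_top (by simp))

/-- Dyadic chaining: a moment bound for the supremum over the unit cube of a random field with
continuous paths. -/
theorem exists_sup_bound {F : Type*} [NormedAddCommGroup F] [MeasurableSpace F] [BorelSpace F]
    [SecondCountableTopology F] {p : ℕ} (hp : p ≠ 0)
    {X : (Fin d → ℝ) → Ω → F} (hX : ∀ u, Measurable (X u)) {K : ℝ≥0∞}
    (h0 : ∀ u ∈ Set.Icc (0 : Fin d → ℝ) 1, ∫⁻ ω, ‖X u ω‖ₑ ^ p ∂P ≤ K)
    (h1 : ∀ u ∈ Set.Icc (0 : Fin d → ℝ) 1, ∀ v ∈ Set.Icc (0 : Fin d → ℝ) 1,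
      ∫⁻ ω, ‖X u ω - X v ω‖ₑ ^ p ∂P ≤ K * ‖u - v‖ₑ ^ (d + 2)) :
    ∃ W : Ω → ℝ≥0∞, Measurable W ∧ ∫⁻ ω, W ω ∂P ≤ chainConst d p * K ∧
      ∀ ω, (Continuous fun u => X u ω) → ∀ u ∈ Set.Icc (0 : Fin d → ℝ) 1, ‖X u ω‖ₑ ^ p ≤ W ω := by
  let E : Finset (Fin d → ℕ) := Fintype.piFinset fun _ => Finset.range 2
  have hE : ∀ ε : Fin d → ℕ, ε ∈ E ↔ ∀ l, ε l ≤ 1 := fun ε => by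
    simp [E]
  -- B controls the corners of the cube and M n all parent-child increments between the grids n and
  -- n + 1. In expectation M n is of order 2^{-2n}: about 2^{nd} pairs, each of order 2^{-n(d+2)}.
  -- One factor 2ⁿ pays for the weights in W', the other makes the series converge.
  let B : Ω → ℝ≥0∞ := fun ω => ∑ q ∈ dyadicGrid d 0, ‖X (dyadicPt 0 q) ω‖ₑ ^ p
  let M : ℕ → Ω → ℝ≥0∞ := fun n ω => ∑ q ∈ dyadicGrid d n, ∑ ε ∈ E,
    ‖X (dyadicPt (n + 1) (dyadicChild n q ε)) ω - X (dyadicPt n q) ω‖ₑ ^ p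
  have hBm : Measurable B := by
    refine Finset.measurable_fun_sum _ fun q _ => ?_
    exact ((hX _).enorm).pow_const p
  have hMm : ∀ n, Measurable (M n) := fun n => by
    refine Finset.measurable_fun_sum _ fun q _ => Finset.measurable_fun_sum _ fun ε _ => ?_
    exact (((hX _).sub (hX _)).enorm).pow_const p
  let W' : Ω → ℝ≥0∞ := fun ω => B ω + ∑' n, 2 ^ n * M n ω
  have hWm : Measurable W' := hBm.add (Measurable.tsum fun n => (hMm n).const_mul _)
  set D : ℝ≥0∞ := (1 + (1 - (1 / 2 : ℝ≥0∞) ^ (1 / p : ℝ))⁻¹) ^ p with hD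
  have hp0 : (0 : ℝ) < p := by exact_mod_cast Nat.pos_of_ne_zero hp
  refine ⟨fun ω => D * W' ω, hWm.const_mul _, ?_, ?_⟩
  · rw [lintegral_const_mul _ hWm]
    have hB : ∫⁻ ω, B ω ∂P ≤ 2 ^ d * K := by
      rw [lintegral_finsetSum _ fun q _ => ((hX _).enorm).pow_const p]
      refine (Finset.sum_le_card_nsmul _ _ K fun q hq => h0 _ (dyadicPt_mem
        (mem_dyadicGrid.1 hq))).trans_eq ?_
      simp [dyadicGrid]
    have hM : ∀ n, ∫⁻ ω, 2 ^ n * M n ω ∂P ≤ 2 ^ d * K * (1 / 2) ^ (n + 1) := by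
      intro n
      have hme : ∀ q ε : Fin d → ℕ, Measurable fun ω => ‖X (dyadicPt (n + 1) (dyadicChild n q ε)) ω -
          X (dyadicPt n q) ω‖ₑ ^ p := fun q ε => (((hX _).sub (hX _)).enorm).pow_const p
      rw [lintegral_const_mul _ (hMm n), lintegral_finsetSum _ fun q _ =>
        Finset.measurable_fun_sum _ fun ε _ => hme q ε]
      have h2 : ∀ q ∈ dyadicGrid d n, ∫⁻ ω, ∑ ε ∈ E, ‖X (dyadicPt (n + 1) (dyadicChild n q ε)) ω -
          X (dyadicPt n q) ω‖ₑ ^ p ∂P ≤ 2 ^ d * (K * ((1 / 2) ^ (n + 1)) ^ (d + 2)) := by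
        intro q hq
        rw [lintegral_finsetSum _ fun ε _ => hme q ε]
        refine (Finset.sum_le_card_nsmul _ _ (K * ((1 / 2) ^ (n + 1)) ^ (d + 2))
          fun ε hε => ?_).trans_eq (by simp [E])
        have hq' := mem_dyadicGrid.1 hq
        refine (h1 _ (dyadicPt_mem fun l => min_le_right _ _) _ (dyadicPt_mem hq')).trans ?_
        gcongr
        rw [← ofReal_norm]
        refine (ENNReal.ofReal_le_ofReal (norm_dyadicPt_sub_le hq' ((hE ε).1 hε))).trans_eq ?_
        rw [ENNReal.ofReal_pow (by norm_num), ENNReal.ofReal_div_of_pos (by norm_num)]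
        simp
      refine (mul_le_mul_right (Finset.sum_le_card_nsmul _ _ _ h2) _).trans ?_
      have h3 : ((dyadicGrid d n).card : ℝ≥0∞) ≤ (2 ^ (n + 1)) ^ d := by
        have : (dyadicGrid d n).card = (2 ^ n + 1) ^ d := by simp [dyadicGrid]
        rw [this]
        have h4 : (2 ^ n + 1) ^ d ≤ (2 ^ (n + 1)) ^ d := by
          gcongr
          rw [pow_succ]
          have := Nat.one_le_two_pow (n := n)
          omega
        exact_mod_cast h4
      have h22 : (2 : ℝ≥0∞) ^ (n + 1) * (1 / 2) ^ (n + 1) = 1 := by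
        rw [← mul_pow, one_div, ENNReal.mul_inv_cancel (by simp) (by simp), one_pow]
      have h5 : (2 : ℝ≥0∞) ^ n ≤ 2 ^ (n + 1) := pow_le_pow_right₀ (by norm_num) n.le_succ
      rw [nsmul_eq_mul]
      calc (2 : ℝ≥0∞) ^ n * ((dyadicGrid d n).card * (2 ^ d * (K * ((1 / 2) ^ (n + 1)) ^ (d + 2))))
          ≤ 2 ^ (n + 1) * ((2 ^ (n + 1)) ^ d * (2 ^ d * (K * ((1 / 2) ^ (n + 1)) ^ (d + 2)))) := by
            gcongr
        _ = 2 ^ d * K * (1 / 2) ^ (n + 1) * (2 ^ (n + 1) * (1 / 2) ^ (n + 1)) ^ (d + 1) := by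
            rw [mul_pow]; ring
        _ = _ := by rw [h22, one_pow, mul_one]
    have hW : ∫⁻ ω, W' ω ∂P ≤ 2 ^ (d + 1) * K := by
      rw [lintegral_add_left hBm, lintegral_tsum fun n => ((hMm n).const_mul _).aemeasurable]
      refine (add_le_add hB (ENNReal.tsum_le_tsum hM)).trans_eq ?_
      rw [ENNReal.tsum_mul_left]
      have : ∑' n : ℕ, (1 / 2 : ℝ≥0∞) ^ (n + 1) = 1 := by
        simp only [one_div]
        rw [ENNReal.tsum_geometric_add_one]
        rw [ENNReal.one_sub_inv_two, inv_inv, ENNReal.inv_mul_cancel (by simp) (by simp)]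
      rw [this, mul_one, ← two_mul, pow_succ]
      ring
    calc D * ∫⁻ ω, W' ω ∂P ≤ D * (2 ^ (d + 1) * K) := by gcongr
      _ = chainConst d p * K := by rw [chainConst, ← hD, mul_assoc]
  · intro ω hω u hu
    have hu0 : ∀ l, 0 ≤ u l := hu.1
    have hu1 : ∀ l, u l ≤ 1 := hu.2
    -- The lower dyadic approximations of u; consecutive ones are parent and child, so each
    -- increment of the chain occurs in M n.
    let q : ℕ → Fin d → ℕ := fun n l => ⌊2 ^ n * u l⌋₊
    have hq : ∀ n l, q n l ≤ 2 ^ n := fun n l => by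
      refine Nat.floor_le_of_le ?_
      push_cast
      exact mul_le_of_le_one_right (by positivity) (hu1 l)
    have hstep : ∀ n l, 2 * q n l ≤ q (n + 1) l ∧ q (n + 1) l ≤ 2 * q n l + 1 := fun n l => by
      have hx : (0 : ℝ) ≤ 2 ^ n * u l := mul_nonneg (by positivity) (hu0 l)
      have h2 := Nat.floor_le hx
      have h3 := Nat.lt_floor_add_one (2 ^ n * u l)
      have h4 : (2 : ℝ) ^ (n + 1) * u l = 2 * (2 ^ n * u l) := by ring
      constructor
      · refine Nat.le_floor ?_
        push_cast
        rw [h4]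
        linarith
      · refine Nat.lt_succ_iff.1 ((Nat.floor_lt (by rw [h4]; positivity)).2 ?_)
        push_cast
        rw [h4]
        linarith
    have hchild : ∀ n, q (n + 1) = dyadicChild n (q n) (fun l => q (n + 1) l - 2 * q n l) :=
      fun n => funext fun l => by
        have h2 := hstep n l
        have h3 := hq (n + 1) l
        simp only [dyadicChild]
        omega
    have hlim : Tendsto (fun n => dyadicPt n (q n)) atTop (𝓝 u) := by
      refine tendsto_pi_nhds.2 fun l => ?_
      have h2 : Tendsto (fun n : ℕ => u l - (1 / 2 : ℝ) ^ n) atTop (𝓝 (u l)) := by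
        simpa using (tendsto_pow_atTop_nhds_zero_of_lt_one (by norm_num : (0 : ℝ) ≤ 1 / 2)
          (by norm_num)).const_sub (u l)
      have hx : ∀ n : ℕ, (0 : ℝ) ≤ 2 ^ n * u l := fun n => mul_nonneg (by positivity) (hu0 l)
      refine tendsto_of_tendsto_of_tendsto_of_le_of_le h2 tendsto_const_nhds (fun n => ?_)
        fun n => ?_
      · simp only [dyadicPt, q]
        rw [le_div_iff₀ (by positivity), sub_mul, ← mul_pow]
        norm_num
        linarith [Nat.lt_floor_add_one (2 ^ n * u l)]
      · simp only [dyadicPt, q]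
        rw [div_le_iff₀ (by positivity)]
        linarith [Nat.floor_le (hx n)]
    have hroot : ∀ {x : ℝ≥0∞} {y : ℝ≥0∞}, x ^ p ≤ y → x ≤ y ^ (1 / p : ℝ) := fun {x y} h => by
      rw [one_div, ENNReal.le_rpow_inv_iff hp0, ENNReal.rpow_natCast]
      exact h
    set w := W' ω with hw
    have hb0 : ‖X (dyadicPt 0 (q 0)) ω‖ₑ ≤ w ^ (1 / p : ℝ) := by
      refine hroot (le_trans ?_ le_self_add)
      exact Finset.single_le_sum (f := fun q => ‖X (dyadicPt 0 q) ω‖ₑ ^ p) (fun _ _ => zero_le)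
        (mem_dyadicGrid.2 (hq 0))
    have hb : ∀ n, ‖X (dyadicPt (n + 1) (q (n + 1))) ω - X (dyadicPt n (q n)) ω‖ₑ ≤
        w ^ (1 / p : ℝ) * ((1 / 2 : ℝ≥0∞) ^ (1 / p : ℝ)) ^ n := by
      intro n
      have h2 : ‖X (dyadicPt (n + 1) (q (n + 1))) ω - X (dyadicPt n (q n)) ω‖ₑ ^ p ≤ M n ω := by
        conv_lhs => rw [hchild n]
        have h3 : (fun l => q (n + 1) l - 2 * q n l) ∈ E := (hE _).2 fun l => by
          have := hstep n l
          omega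
        refine le_trans ?_ (Finset.single_le_sum (f := fun q => ∑ ε ∈ E,
          ‖X (dyadicPt (n + 1) (dyadicChild n q ε)) ω - X (dyadicPt n q) ω‖ₑ ^ p)
          (fun _ _ => zero_le) (mem_dyadicGrid.2 (hq n)))
        exact Finset.single_le_sum (f := fun ε =>
          ‖X (dyadicPt (n + 1) (dyadicChild n (q n) ε)) ω - X (dyadicPt n (q n)) ω‖ₑ ^ p)
          (fun _ _ => zero_le) h3
      have h4 : 2 ^ n * M n ω ≤ w :=
        (ENNReal.le_tsum (f := fun n => 2 ^ n * M n ω) n).trans le_add_self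
      -- The weights turn finiteness of the series into geometric decay, which persists after taking
      -- p-th roots.
      have h5 : M n ω ≤ w * (1 / 2) ^ n := by
        calc M n ω = 2 ^ n * M n ω * (1 / 2) ^ n := by
              rw [mul_right_comm, ← mul_pow, one_div, ENNReal.mul_inv_cancel (by simp) (by simp),
                one_pow, one_mul]
          _ ≤ _ := by gcongr
      refine (hroot (h2.trans h5)).trans_eq ?_
      rw [ENNReal.mul_rpow_of_nonneg _ _ (by positivity), ← ENNReal.rpow_natCast,
        ← ENNReal.rpow_natCast, ← ENNReal.rpow_mul, ← ENNReal.rpow_mul, mul_comm (n : ℝ)]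
    have hN : ∀ N, ‖X (dyadicPt N (q N)) ω‖ₑ ≤ w ^ (1 / p : ℝ) +
        ∑ n ∈ Finset.range N, w ^ (1 / p : ℝ) * ((1 / 2 : ℝ≥0∞) ^ (1 / p : ℝ)) ^ n := by
      intro N
      induction N with
      | zero => simpa using hb0
      | succ N ih =>
        rw [Finset.sum_range_succ, ← add_assoc]
        have h2 : X (dyadicPt (N + 1) (q (N + 1))) ω = X (dyadicPt N (q N)) ω +
          (X (dyadicPt (N + 1) (q (N + 1))) ω - X (dyadicPt N (q N)) ω) := by abel
        rw [h2]
        exact (enorm_add_le _ _).trans (add_le_add ih (hb N))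
    have hfin : ‖X u ω‖ₑ ≤ w ^ (1 / p : ℝ) * (1 + (1 - (1 / 2 : ℝ≥0∞) ^ (1 / p : ℝ))⁻¹) := by
      refine le_of_tendsto ((continuous_enorm.tendsto _).comp
        ((hω.tendsto u).comp hlim)) (Eventually.of_forall fun N => ?_)
      refine (hN N).trans ?_
      rw [mul_add, mul_one, ← ENNReal.tsum_geometric, ← ENNReal.tsum_mul_left]
      gcongr
      exact ENNReal.sum_le_tsum _
    calc ‖X u ω‖ₑ ^ p ≤ (w ^ (1 / p : ℝ) * (1 + (1 - (1 / 2 : ℝ≥0∞) ^ (1 / p : ℝ))⁻¹)) ^ p := by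
          gcongr
      _ = D * w := by
          rw [mul_pow, ← hD, ← ENNReal.rpow_natCast, ← ENNReal.rpow_mul, one_div,
            inv_mul_cancel₀ hp0.ne', ENNReal.rpow_one, mul_comm]

end Chaining

end InertialParticle

namespace InertialParticle

open scoped ENNReal NNReal

/-! ### Moments and growth of fractional Brownian motion -/

section FractionalBrownianMotion

variable {Ω : Type*} [MeasurableSpace Ω] {P : Measure Ω} {H : ℝ} {X : ℝ → Ω → ℝ}

theorem IsFBM.integrable (h : IsFBM H X P) (t : ℝ) : Integrable (X t) P :=
  (h.gaussian.hasGaussianLaw_eval t).integrable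

theorem IsFBM.integrable_mul (h : IsFBM H X P) (s t : ℝ) :
    Integrable (fun ω => X s ω * X t ω) P :=
  (h.gaussian.hasGaussianLaw_eval s).memLp_two.integrable_mul
    (h.gaussian.hasGaussianLaw_eval t).memLp_two

theorem IsFBM.integrable_sub_sq (h : IsFBM H X P) (s t : ℝ) :
    Integrable (fun ω => (X s ω - X t ω) ^ 2) P :=
  (h.gaussian.hasGaussianLaw_fun_sub).memLp_two.integrable_sq

theorem IsFBM.integral_sub_sq (h : IsFBM H X P) (hH : 0 < H) (s t : ℝ) :
    ∫ ω, (X s ω - X t ω) ^ 2 ∂P = |s - t| ^ (2 * H) := by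
  have h1 : ∀ ω, (X s ω - X t ω) ^ 2 =
      X s ω * X s ω - (X s ω * X t ω + X s ω * X t ω) + X t ω * X t ω := fun ω => by ring
  simp only [h1]
  have i1 := h.integrable_mul s s
  have i2 := h.integrable_mul s t
  have i3 := h.integrable_mul t t
  have i4 : Integrable (fun ω => X s ω * X t ω + X s ω * X t ω) P := i2.add i2
  have i5 : Integrable (fun ω => X s ω * X s ω - (X s ω * X t ω + X s ω * X t ω)) P := i1.sub i4
  rw [integral_add i5 i3, integral_sub i1 i4, integral_add i2 i2, h.cov, h.cov, h.cov]
  have h0 : (0 : ℝ) ^ (2 * H) = 0 := Real.zero_rpow (by positivity)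
  simp only [sub_self, abs_zero, h0]
  ring

/-- Averages of second differences of a fractional Brownian motion are sub-Gaussian. -/
theorem IsFBM.hasSubgaussianMGF_sum (h : IsFBM H X P) (hH : 0 < H) {ι : Type*}
    (s : Finset ι) (w : ι → ℝ) (hw : ∀ i ∈ s, 0 ≤ w i) (hw1 : ∑ i ∈ s, w i ≤ 1)
    (f : ι → Fin 4 → ℝ) {c : ℝ≥0}
    (hc : ∑ i ∈ s, w i * (2 * |f i 0 - f i 1| ^ (2 * H) + 2 * |f i 2 - f i 3| ^ (2 * H)) ≤ c) :
    HasSubgaussianMGF (fun ω => ∑ i ∈ s, w i * ((X (f i 0) ω - X (f i 1) ω) -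
      (X (f i 2) ω - X (f i 3) ω))) c P := by
  have hg : HasGaussianLaw (fun ω => ∑ i ∈ s, w i * ((X (f i 0) ω - X (f i 1) ω) -
      (X (f i 2) ω - X (f i 3) ω))) P := by
    have h1 := ((h.gaussian.comp_right fun q : ι × Fin 4 => f q.1 q.2).smul
      fun q => w q.1 * ![1, -1, -1, 1] q.2).hasGaussianLaw_fun_sum
      (I := s ×ˢ (Finset.univ : Finset (Fin 4)))
    refine h1.congr (ae_of_all _ fun ω => ?_)
    simp only [Finset.sum_product]
    refine Finset.sum_congr rfl fun i _ => ?_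
    simp [Fin.sum_univ_four]
    ring
  refine hasSubgaussianMGF_of_hasGaussianLaw hg ?_ (le_trans ?_ hc)
  · have i1 : ∀ a b, Integrable (fun ω => X a ω - X b ω) P := fun a b =>
      (h.integrable a).sub (h.integrable b)
    have i2 : ∀ i, Integrable (fun ω => w i * ((X (f i 0) ω - X (f i 1) ω) -
        (X (f i 2) ω - X (f i 3) ω))) P := fun i => ((i1 _ _).sub (i1 _ _)).const_mul _
    rw [integral_finsetSum _ fun i _ => i2 i]
    refine Finset.sum_eq_zero fun i _ => ?_
    rw [integral_const_mul, integral_sub (i1 _ _) (i1 _ _), integral_sub (h.integrable _)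
      (h.integrable _), integral_sub (h.integrable _) (h.integrable _)]
    simp [h.mean]
  · have hint : ∀ i, Integrable (fun ω => w i * (2 * (X (f i 0) ω - X (f i 1) ω) ^ 2 +
        2 * (X (f i 2) ω - X (f i 3) ω) ^ 2)) P := fun i =>
      (((h.integrable_sub_sq _ _).const_mul 2).add
        ((h.integrable_sub_sq _ _).const_mul 2)).const_mul _
    have hle : ∀ ω, (∑ i ∈ s, w i * ((X (f i 0) ω - X (f i 1) ω) -
        (X (f i 2) ω - X (f i 3) ω))) ^ 2 ≤ ∑ i ∈ s, w i * (2 * (X (f i 0) ω - X (f i 1) ω) ^ 2 +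
        2 * (X (f i 2) ω - X (f i 3) ω) ^ 2) := fun ω => by
      -- Cauchy–Schwarz with weights of total mass at most one; covariances between different
      -- increments are not needed.
      refine (Finset.sum_sq_le_sum_mul_sum_of_sq_le_mul s (f := w) (g := fun i =>
        w i * ((X (f i 0) ω - X (f i 1) ω) - (X (f i 2) ω - X (f i 3) ω)) ^ 2) hw
        (fun i hi => mul_nonneg (hw i hi) (sq_nonneg _)) fun i _ => le_of_eq (by ring)).trans ?_
      refine (mul_le_of_le_one_left (Finset.sum_nonneg fun i hi =>
        mul_nonneg (hw i hi) (sq_nonneg _)) hw1).trans ?_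
      refine Finset.sum_le_sum fun i hi => mul_le_mul_of_nonneg_left ?_ (hw i hi)
      nlinarith [sq_nonneg ((X (f i 0) ω - X (f i 1) ω) + (X (f i 2) ω - X (f i 3) ω))]
    refine (integral_mono_of_nonneg (ae_of_all _ fun ω => sq_nonneg _)
      (integrable_finsetSum _ fun i _ => hint i) (ae_of_all _ hle)).trans_eq ?_
    rw [integral_finsetSum _ fun i _ => hint i]
    refine Finset.sum_congr rfl fun i _ => ?_
    rw [integral_const_mul, integral_add ((h.integrable_sub_sq _ _).const_mul 2)
      ((h.integrable_sub_sq _ _).const_mul 2), integral_const_mul, integral_const_mul,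
      h.integral_sub_sq hH, h.integral_sub_sq hH]

theorem IsFBM.hasSubgaussianMGF_sub (h : IsFBM H X P) (hH : 0 < H) (s t : ℝ) {c : ℝ≥0}
    (hc : |s - t| ^ (2 * H) ≤ c) : HasSubgaussianMGF (fun ω => X s ω - X t ω) c P := by
  refine hasSubgaussianMGF_of_hasGaussianLaw h.gaussian.hasGaussianLaw_fun_sub ?_ ?_
  · rw [integral_sub (h.integrable s) (h.integrable t), h.mean, h.mean, sub_zero]
  · rw [h.integral_sub_sq hH]
    exact hc

theorem IsFBM.lintegral_sub_pow_le (h : IsFBM H X P) (hH : 0 < H) {p : ℕ} (hp : p ≠ 0) (s t : ℝ) :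
    ∫⁻ ω, ‖X s ω - X t ω‖ₑ ^ (2 * p) ∂P ≤ momentConst p * ENNReal.ofReal (|s - t| ^ (2 * H)) ^ p := by
  rcases eq_or_ne s t with rfl | hst
  · simp [hp]
  have hpos : 0 < |s - t| ^ (2 * H) := Real.rpow_pos_of_pos (abs_pos.2 (sub_ne_zero.2 hst)) _
  exact (h.hasSubgaussianMGF_sub hH s t (c := (|s - t| ^ (2 * H)).toNNReal)
    (Real.le_coe_toNNReal _)).lintegral_pow_le (Real.toNNReal_pos.2 hpos) p

/-- Chaining bounds the path on each unit interval [k, k + 1]; a weighted sum of these bounds over k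
has finite expectation, so it is finite almost surely, which means polynomial growth. -/
theorem IsFBM.ae_exists_growth_bound (h : IsFBM H X P) (hH : 0 < H) (hH1 : H < 1) :
    ∀ᵐ ω ∂P, ∃ C : ℝ, 0 ≤ C ∧ ∀ u, |X u ω| ≤ C * (2 + |u|) ^ 2 := by
  -- The 2p-th moments of increments are of order |s - t|^{2Hp}, and chaining in dimension d = 1
  -- asks for the exponent d + 2 = 3.
  obtain ⟨p, hp⟩ := exists_nat_ge (3 / (2 * H))
  have hp3 : 3 ≤ 2 * H * p := by
    rw [div_le_iff₀ (by positivity)] at hp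
    linarith
  have hp0 : p ≠ 0 := by
    rintro rfl
    norm_num at hp3
  let K : ℤ → ℝ≥0∞ := fun k => momentConst p * ENNReal.ofReal ((1 + |(k : ℝ)|) ^ 2) ^ p
  have hX0 : ∀ k u, ∫⁻ ω, ‖X (k + u) ω‖ₑ ^ (2 * p) ∂P = ∫⁻ ω, ‖X (k + u) ω - X 0 ω‖ₑ ^ (2 * p) ∂P := by
    intro k u
    refine lintegral_congr_ae ?_
    filter_upwards [h.zero] with ω hω
    rw [hω, sub_zero]
  have hW : ∀ k : ℤ, ∃ W : Ω → ℝ≥0∞, Measurable W ∧ ∫⁻ ω, W ω ∂P ≤ chainConst 1 (2 * p) * K k ∧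
      ∀ ω, (Continuous fun u : Fin 1 → ℝ => X (k + u 0) ω) →
        ∀ u ∈ Set.Icc (0 : Fin 1 → ℝ) 1, ‖X (k + u 0) ω‖ₑ ^ (2 * p) ≤ W ω := by
    intro k
    refine exists_sup_bound (by omega) (fun u => h.measurable _) (fun u hu => ?_)
      fun u hu v hv => ?_
    · have hu0 : 0 ≤ u 0 := hu.1 0
      have hu1 : u 0 ≤ 1 := hu.2 0
      rw [hX0]
      refine (h.lintegral_sub_pow_le hH hp0 _ _).trans ?_
      simp only [K]
      gcongr
      have h1 : |(k : ℝ) + u 0 - 0| ≤ 1 + |(k : ℝ)| := by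
        rw [sub_zero]
        refine (abs_add_le _ _).trans ?_
        rw [abs_of_nonneg hu0]
        linarith
      calc |(k : ℝ) + u 0 - 0| ^ (2 * H) ≤ (1 + |(k : ℝ)|) ^ (2 * H) :=
            Real.rpow_le_rpow (abs_nonneg _) h1 (by positivity)
        _ ≤ (1 + |(k : ℝ)|) ^ (2 : ℝ) :=
            Real.rpow_le_rpow_of_exponent_le (by linarith [abs_nonneg (k : ℝ)]) (by linarith)
        _ = _ := Real.rpow_two _
    · refine (h.lintegral_sub_pow_le hH hp0 _ _).trans ?_
      rw [← ofReal_norm (u - v), ← ENNReal.ofReal_pow (by positivity), ← ENNReal.ofReal_pow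
        (norm_nonneg _)]
      have h1 : |u 0 - v 0| ≤ ‖u - v‖ := norm_le_pi_norm (u - v) 0
      have h2 : |u 0 - v 0| ≤ 1 := by
        have := hu.1 0; have := hu.2 0; have := hv.1 0; have := hv.2 0
        simp only [Pi.zero_apply, Pi.one_apply] at *
        rw [abs_le]
        constructor <;> linarith
      have h3 : (|(k : ℝ) + u 0 - (k + v 0)| ^ (2 * H)) ^ p ≤ ‖u - v‖ ^ (1 + 2) := by
        rw [add_sub_add_left_eq_sub, ← Real.rpow_natCast, ← Real.rpow_mul (abs_nonneg _)]
        calc |u 0 - v 0| ^ (2 * H * p) ≤ |u 0 - v 0| ^ (3 : ℝ) :=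
              Real.rpow_le_rpow_of_exponent_ge_of_imp (abs_nonneg _) h2 hp3 (by simp [hH.ne', hp0])
          _ = |u 0 - v 0| ^ 3 := by
            rw [← Real.rpow_natCast]
            norm_num
          _ ≤ _ := by gcongr
      refine mul_le_mul' ?_ (ENNReal.ofReal_le_ofReal h3)
      refine le_mul_of_one_le_right' ?_
      refine one_le_pow₀ ?_
      rw [ENNReal.one_le_ofReal]
      exact one_le_pow₀ (by linarith [abs_nonneg (k : ℝ)])
  choose W hWm hWi hWb using hW
  -- The expected bounds grow like r(k)ᵖ; dividing by r(k)^{p+1} leaves the summable 1/r(k).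
  let r : ℤ → ℝ := fun k => (1 + |(k : ℝ)|) ^ 2
  have hr : ∀ k, 0 < r k := fun k => by positivity
  let S : Ω → ℝ≥0∞ := fun ω => ∑' k : ℤ, W k ω / ENNReal.ofReal (r k ^ (p + 1))
  have hS : ∫⁻ ω, S ω ∂P ≠ ∞ := by
    have h1 : ∀ k : ℤ, ∫⁻ ω, W k ω / ENNReal.ofReal (r k ^ (p + 1)) ∂P ≤
        chainConst 1 (2 * p) * momentConst p * ENNReal.ofReal ((r k)⁻¹) := by
      intro k
      simp only [div_eq_mul_inv]
      rw [lintegral_mul_const _ (hWm k)]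
      refine (mul_le_mul_left (hWi k) _).trans_eq ?_
      rw [← ENNReal.ofReal_inv_of_pos (pow_pos (hr k) _), mul_assoc, mul_assoc]
      change _ * (↑(momentConst p) * (ENNReal.ofReal (r k) ^ p * _)) = _
      rw [← ENNReal.ofReal_pow (hr k).le, ← ENNReal.ofReal_mul (pow_pos (hr k) _).le, mul_assoc]
      congr 3
      rw [pow_succ]
      field_simp [(hr k).ne']
    rw [lintegral_tsum fun k => ((hWm k).div_const _).aemeasurable]
    refine ne_top_of_le_ne_top ?_ (ENNReal.tsum_le_tsum h1)
    rw [ENNReal.tsum_mul_left]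
    refine ENNReal.mul_ne_top (ENNReal.mul_ne_top (chainConst_ne_top 1 (by omega))
      ENNReal.coe_ne_top) ?_
    have hsum : Summable fun k : ℤ => (r k)⁻¹ := by
      have h2 := Real.summable_abs_int_rpow (b := 2) (by norm_num)
      refine Summable.of_norm_bounded_eventually h2 ?_
      rw [Filter.eventually_cofinite]
      refine (Set.finite_singleton (0 : ℤ)).subset fun k hk => ?_
      by_contra hk0
      refine hk ?_
      have hk1 : 0 < |(k : ℝ)| := abs_pos.2 (by exact_mod_cast hk0)
      rw [Real.norm_of_nonneg (inv_nonneg.2 (hr k).le), Real.rpow_neg (abs_nonneg _), Real.rpow_two]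
      refine inv_anti₀ (by positivity) ?_
      simp only [r]
      gcongr
      linarith
    exact hsum.tsum_ofReal_ne_top
  have hSm : Measurable S := Measurable.tsum fun k => (hWm k).div_const _
  filter_upwards [ae_lt_top hSm hS, h.continuous_paths] with ω hω hc
  refine ⟨1 + (S ω).toReal, by positivity, fun u => ?_⟩
  have h1 := hWb ⌊u⌋ ω (by fun_prop) (fun _ => Int.fract u) ⟨fun _ => Int.fract_nonneg u,
    fun _ => (Int.fract_lt_one u).le⟩
  simp only [Int.floor_add_fract] at h1
  have h2 : W ⌊u⌋ ω ≤ S ω * ENNReal.ofReal (r ⌊u⌋ ^ (p + 1)) := by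
    have h3 := ENNReal.le_tsum (f := fun k : ℤ => W k ω / ENNReal.ofReal (r k ^ (p + 1))) ⌊u⌋
    rwa [ENNReal.div_le_iff (by simpa using pow_pos (hr _) _) ENNReal.ofReal_ne_top] at h3
  have h4 := h1.trans h2
  rw [← ofReal_norm, ← ENNReal.ofReal_pow (norm_nonneg _), ← ENNReal.ofReal_toReal hω.ne,
    ← ENNReal.ofReal_mul ENNReal.toReal_nonneg, ENNReal.ofReal_le_ofReal_iff (mul_nonneg
      ENNReal.toReal_nonneg (pow_nonneg (hr _).le _)), Real.norm_eq_abs] at h4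
  have hfl : r ⌊u⌋ ≤ (2 + |u|) ^ 2 := by
    refine pow_le_pow_left₀ (by positivity) ?_ 2
    have h5 := Int.floor_le u
    have h6 := Int.lt_floor_add_one u
    have : |(⌊u⌋ : ℝ)| ≤ 1 + |u| := by
      rw [abs_le]
      constructor
      · linarith [neg_abs_le u]
      · linarith [le_abs_self u]
    linarith
  have hA : (1 : ℝ) ≤ (2 + |u|) ^ 2 := one_le_pow₀ (by linarith [abs_nonneg u])
  have h7 : |X u ω| ^ (2 * p) ≤ ((1 + (S ω).toReal) * (2 + |u|) ^ 2) ^ (2 * p) := by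
    refine h4.trans ?_
    rw [mul_pow]
    have hs : (0 : ℝ) ≤ (S ω).toReal := ENNReal.toReal_nonneg
    refine mul_le_mul ?_ ?_ (pow_nonneg (hr _).le _) (by positivity)
    · calc (S ω).toReal ≤ 1 + (S ω).toReal := by linarith
        _ ≤ _ := le_self_pow₀ (by linarith) (by omega)
    · calc r ⌊u⌋ ^ (p + 1) ≤ ((2 + |u|) ^ 2) ^ (p + 1) := pow_le_pow_left₀ (hr _).le hfl _
        _ ≤ _ := pow_le_pow_right₀ hA (by omega)
  exact (pow_le_pow_iff_left₀ (abs_nonneg _) (by positivity) (by omega)).1 h7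

variable {β : Mode → ℝ → Ω → ℂ}

theorem IsModeFBM.measurable (h : IsModeFBM H β P) (k : Mode) (t : ℝ) : Measurable (β k t) := by
  have h2 : √(2 : ℝ) ≠ 0 := by positivity
  have h1 : ∀ ω, β k t ω = ⟨(√2)⁻¹ * (√2 * (β k t ω).re), (√2)⁻¹ * (√2 * (β k t ω).im)⟩ :=
    fun ω => by simp [h2]
  rw [funext h1]
  exact Complex.measurableEquivRealProd.symm.measurable.comp ((((h.re_fbm k).measurable t).const_mul _).prodMk
    (((h.im_fbm k).measurable t).const_mul _))

/-- Quadratic growth of the real and imaginary parts is absorbed by any exponential. With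
continuity, this is all that the pathwise integrals require. -/
theorem IsModeFBM.ae_subexpPath (h : IsModeFBM H β P) (hH : 0 < H) (hH1 : H < 1) :
    ∀ᵐ ω ∂P, ∀ k, SubexpPath fun t => β k t ω := by
  refine ae_all_iff.2 fun k => ?_
  have hs : √(2 : ℝ) ≠ 0 := by positivity
  have hs1 : 1 ≤ √(2 : ℝ) := Real.one_le_sqrt.2 (by norm_num)
  filter_upwards [(h.re_fbm k).ae_exists_growth_bound hH hH1,
    (h.im_fbm k).ae_exists_growth_bound hH hH1, (h.re_fbm k).continuous_paths,
    (h.im_fbm k).continuous_paths] with ω ⟨C, hC, h1⟩ ⟨D, hD, h2⟩ h3 h4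
  refine ⟨?_, fun ε hε => ⟨(C + D) * (2 / ε ^ 2 * Real.exp (2 * ε)), by positivity, fun u => ?_⟩⟩
  · have h5 : ∀ t, β k t ω = (((√2)⁻¹ * (√2 * (β k t ω).re) : ℝ) : ℂ) +
        (((√2)⁻¹ * (√2 * (β k t ω).im) : ℝ) : ℂ) * Complex.I := fun t => by
      rw [inv_mul_cancel_left₀ hs, inv_mul_cancel_left₀ hs, Complex.re_add_im]
    rw [funext h5]
    exact (Complex.continuous_ofReal.comp (h3.const_mul _)).add
      ((Complex.continuous_ofReal.comp (h4.const_mul _)).mul continuous_const)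
  · have h5 : ‖β k u ω‖ ≤ (C + D) * (2 + |u|) ^ 2 := by
      have h6 : ∀ x : ℝ, |x| ≤ |√2 * x| := fun x => by
        rw [abs_mul, abs_of_nonneg (Real.sqrt_nonneg _)]
        exact le_mul_of_one_le_left (abs_nonneg _) hs1
      refine (Complex.norm_le_abs_re_add_abs_im _).trans ?_
      rw [add_mul]
      exact add_le_add ((h6 _).trans (h1 u)) ((h6 _).trans (h2 u))
    refine h5.trans ?_
    rw [mul_assoc]
    refine mul_le_mul_of_nonneg_left ?_ (by positivity)
    have h6 := Real.quadratic_le_exp_of_nonneg (x := ε * (2 + |u|)) (by positivity)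
    have h7 : Real.exp (ε * (2 + |u|)) = Real.exp (2 * ε) * Real.exp (ε * |u|) := by
      rw [← Real.exp_add]
      ring_nf
    rw [h7] at h6
    have h8 : (ε * (2 + |u|)) ^ 2 ≤ 2 * (Real.exp (2 * ε) * Real.exp (ε * |u|)) := by
      have : 0 ≤ ε * (2 + |u|) := by positivity
      linarith
    rw [mul_assoc, div_mul_eq_mul_div, le_div_iff₀ (by positivity)]
    linarith

end FractionalBrownianMotion

end InertialParticle

namespace InertialParticle

open scoped ENNReal NNReal

/-! ### Complex sub-Gaussian random variables -/

section ComplexSubGaussian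

variable {Ω : Type*} [MeasurableSpace Ω] {P : Measure Ω}

theorem _root_.ProbabilityTheory.HasSubgaussianMGF.const_mul_of_le {X : Ω → ℝ} {c c' : ℝ≥0}
    (h : HasSubgaussianMGF X c P) (r : ℝ) (hc : r ^ 2 * c ≤ (c' : ℝ)) :
    HasSubgaussianMGF (fun ω => r * X ω) c' P :=
  (h.const_mul r).mono (by exact_mod_cast hc)

/-- Complex random variables with sub-Gaussian real and imaginary parts. -/
def SubG (Z : Ω → ℂ) (c : ℝ≥0) (P : Measure Ω) : Prop :=
  HasSubgaussianMGF (fun ω => (Z ω).re) c P ∧ HasSubgaussianMGF (fun ω => (Z ω).im) c P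

variable {Z : Ω → ℂ} {c c' : ℝ≥0}

theorem SubG.mono (h : SubG Z c P) (hc : c ≤ c') : SubG Z c' P := ⟨h.1.mono hc, h.2.mono hc⟩

theorem SubG.congr {Z' : Ω → ℂ} (h : SubG Z c P) (hZ : Z =ᵐ[P] Z') : SubG Z' c P :=
  ⟨h.1.congr (hZ.mono fun ω hω => by simp only [hω]),
    h.2.congr (hZ.mono fun ω hω => by simp only [hω])⟩

theorem subG_of_tendsto {Z' : ℕ → Ω → ℂ} (h : ∀ n, SubG (Z' n) c P)
    (hlim : ∀ᵐ ω ∂P, Tendsto (fun n => Z' n ω) atTop (𝓝 (Z ω))) : SubG Z c P :=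
  ⟨hasSubgaussianMGF_of_tendsto (fun n => (h n).1)
      (hlim.mono fun _ hω => (Complex.continuous_re.tendsto _).comp hω),
    hasSubgaussianMGF_of_tendsto (fun n => (h n).2)
      (hlim.mono fun _ hω => (Complex.continuous_im.tendsto _).comp hω)⟩

/-- Multiplication by r mixes the real and imaginary parts, which are not assumed independent;
without independence two parameters v combine to (√v + √v)² = 4v. -/
theorem SubG.const_mul (h : SubG Z c P) (r : ℂ) (hc : 4 * ‖r‖ ^ 2 * c ≤ (c' : ℝ)) :
    SubG (fun ω => r * Z ω) c' P := by
  have key : ∀ {X Y : Ω → ℝ} (a b : ℝ), |a| ≤ ‖r‖ → |b| ≤ ‖r‖ → HasSubgaussianMGF X c P →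
      HasSubgaussianMGF Y c P → HasSubgaussianMGF (fun ω => a * X ω + b * Y ω) c' P := by
    intro X Y a b ha hb hX hY
    have h1 : ∀ {X : Ω → ℝ} (a : ℝ), |a| ≤ ‖r‖ → HasSubgaussianMGF X c P →
        HasSubgaussianMGF (fun ω => a * X ω) (‖r‖₊ ^ 2 * c) P := fun a ha hX => by
      refine hX.const_mul_of_le a ?_
      push_cast
      rw [← sq_abs]
      gcongr
    refine ((h1 a ha hX).add (h1 b hb hY)).mono ?_
    rw [← two_mul, mul_pow, NNReal.sq_sqrt]
    have : 4 * ‖r‖₊ ^ 2 * c ≤ c' := by exact_mod_cast hc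
    refine le_trans (le_of_eq ?_) this
    ring
  refine ⟨?_, ?_⟩
  · have := key r.re (-r.im) (Complex.abs_re_le_norm r)
      (by rw [abs_neg]; exact Complex.abs_im_le_norm r) h.1 h.2
    refine this.congr (ae_of_all _ fun ω => ?_)
    simp [Complex.mul_re]
    ring
  · have := key r.re r.im (Complex.abs_re_le_norm r) (Complex.abs_im_le_norm r) h.2 h.1
    refine this.congr (ae_of_all _ fun ω => ?_)
    simp [Complex.mul_im]

/-- Independence makes parameters add without loss in the number of terms; this is how bounds for
single modes become series over modes. -/
theorem SubG.sum {ι : Type*} {Z : ι → Ω → ℂ} (hZ : iIndepFun Z P) {v : ι → ℝ≥0} {s : Finset ι}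
    (h : ∀ i ∈ s, SubG (Z i) (v i) P) : SubG (fun ω => ∑ i ∈ s, Z i ω) (∑ i ∈ s, v i) P := by
  refine ⟨?_, ?_⟩
  · refine (HasSubgaussianMGF.sum_of_iIndepFun (hZ.comp (fun _ => Complex.re)
      fun _ => Complex.measurable_re) fun i hi => (h i hi).1).congr (ae_of_all _ fun ω => ?_)
    simp
  · refine (HasSubgaussianMGF.sum_of_iIndepFun (hZ.comp (fun _ => Complex.im)
      fun _ => Complex.measurable_im) fun i hi => (h i hi).2).congr (ae_of_all _ fun ω => ?_)
    simp

theorem _root_.ProbabilityTheory.HasSubgaussianMGF.lintegral_pow_le' {X : Ω → ℝ}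
    (h : HasSubgaussianMGF X c P) {p : ℕ} (hp : p ≠ 0) :
    ∫⁻ ω, ‖X ω‖ₑ ^ (2 * p) ∂P ≤ momentConst p * (c : ℝ≥0∞) ^ p := by
  rcases eq_or_ne c 0 with rfl | hc
  · have h0 := h.ae_eq_zero_of_hasSubgaussianMGF_zero
    rw [lintegral_congr_ae (g := fun _ => 0) (h0.mono fun ω hω => by simp [hω, hp])]
    simp
  · exact h.lintegral_pow_le (pos_iff_ne_zero.2 hc) p

theorem SubG.lintegral_pow_le (h : SubG Z c P) {p : ℕ} (hp : p ≠ 0) :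
    ∫⁻ ω, ‖Z ω‖ₑ ^ (2 * p) ∂P ≤ 2 ^ (2 * p + 1) * momentConst p * (c : ℝ≥0∞) ^ p := by
  have h1 : ∀ ω, ‖Z ω‖ₑ ^ (2 * p) ≤
      2 ^ (2 * p) * (‖(Z ω).re‖ₑ ^ (2 * p) + ‖(Z ω).im‖ₑ ^ (2 * p)) := fun ω => by
    have h2 : ‖Z ω‖ₑ ≤ 2 * max ‖(Z ω).re‖ₑ ‖(Z ω).im‖ₑ := by
      have h3 : ‖Z ω‖ₑ ≤ ‖(Z ω).re‖ₑ + ‖(Z ω).im‖ₑ := by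
        rw [← ofReal_norm, ← ofReal_norm, ← ofReal_norm, ← ENNReal.ofReal_add (norm_nonneg _)
          (norm_nonneg _)]
        exact ENNReal.ofReal_le_ofReal (Complex.norm_le_abs_re_add_abs_im _)
      rw [two_mul]
      exact h3.trans (add_le_add (le_max_left _ _) (le_max_right _ _))
    refine (pow_le_pow_left' h2 _).trans ?_
    rw [mul_pow]
    gcongr
    rcases max_choice ‖(Z ω).re‖ₑ ‖(Z ω).im‖ₑ with h3 | h3 <;> rw [h3]
    · exact le_self_add
    · exact le_add_self
  have hm : AEMeasurable (fun ω => ‖(Z ω).re‖ₑ ^ (2 * p)) P := (h.1.aemeasurable.enorm).pow_const _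
  have hm2 : AEMeasurable (fun ω => ‖(Z ω).im‖ₑ ^ (2 * p)) P := (h.2.aemeasurable.enorm).pow_const _
  refine (lintegral_mono h1).trans ?_
  have hm3 : AEMeasurable (fun ω => ‖(Z ω).re‖ₑ ^ (2 * p) + ‖(Z ω).im‖ₑ ^ (2 * p)) P := hm.add hm2
  rw [lintegral_const_mul'' _ hm3, lintegral_add_left' hm]
  refine (mul_le_mul_right (add_le_add (h.1.lintegral_pow_le' hp) (h.2.lintegral_pow_le' hp))
    _).trans_eq ?_
  rw [← two_mul, pow_succ]
  ring

end ComplexSubGaussian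

/-! ### Variance bounds for the Ornstein–Uhlenbeck functional -/

section OUMoments

variable {Ω : Type*} [MeasurableSpace Ω] {P : Measure Ω} {H a : ℝ}

/-- The sum is a lower sum, since v^{2H} increases, of the Gamma integral of a e^{-av} v^{2H}. -/
theorem sum_ouWeight_mul_rpow_le (ha : 0 < a) (hH : 0 < H) (n N : ℕ) :
    ∑ j ∈ Finset.range N, ouWeight a n j * ((j : ℝ) / (n + 1)) ^ (2 * H) ≤
      Real.Gamma (2 * H + 1) * a ^ (-(2 * H)) := by
  have hn : (0 : ℝ) < n + 1 := by positivity
  have hle : ∀ j : ℕ, (j : ℝ) / (n + 1) ≤ (j + 1 : ℕ) / (n + 1) := fun j => by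
    gcongr
    exact Nat.le_succ j
  have hc : Continuous fun v : ℝ => a * Real.exp (-a * v) * v ^ (2 * H) := by
    have : Continuous fun v : ℝ => v ^ (2 * H) := Real.continuous_rpow_const (by positivity)
    fun_prop
  have h1 : ∀ j : ℕ, ouWeight a n j * ((j : ℝ) / (n + 1)) ^ (2 * H) ≤
      ∫ v in ((j : ℝ) / (n + 1))..((j + 1 : ℕ) / (n + 1)), a * Real.exp (-a * v) * v ^ (2 * H) := by
    intro j
    rw [ouWeight_eq_integral, ← intervalIntegral.integral_mul_const]
    refine intervalIntegral.integral_mono_on (hle j) (Continuous.intervalIntegrable (by fun_prop) _ _)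
      (hc.intervalIntegrable _ _) fun v hv => ?_
    have : (j : ℝ) / (n + 1) ≤ v := hv.1
    gcongr
  refine (Finset.sum_le_sum fun j _ => h1 j).trans ?_
  rw [intervalIntegral.sum_integral_adjacent_intervals
    (f := fun v => a * Real.exp (-a * v) * v ^ (2 * H)) (μ := volume)
    (a := fun j : ℕ => (j : ℝ) / (n + 1)) fun j _ => hc.intervalIntegrable _ _]
  have h2 : ∫ v in Set.Ioi (0 : ℝ), a * Real.exp (-a * v) * v ^ (2 * H) =
      Real.Gamma (2 * H + 1) * a ^ (-(2 * H)) := by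
    have h3 := Real.integral_rpow_mul_exp_neg_mul_Ioi (a := 2 * H + 1) (by positivity) ha
    have h4 : ∀ v : ℝ, a * Real.exp (-a * v) * v ^ (2 * H) =
        a * (v ^ (2 * H + 1 - 1) * Real.exp (-(a * v))) := fun v => by
      rw [add_sub_cancel_right, neg_mul]
      ring
    simp only [h4]
    rw [integral_const_mul, h3, one_div, Real.inv_rpow ha.le, ← Real.rpow_neg ha.le, neg_add,
      Real.rpow_add ha, Real.rpow_neg_one]
    field_simp
  have hint : IntegrableOn (fun v => a * Real.exp (-a * v) * v ^ (2 * H)) (Set.Ioi 0) := by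
    have h3 := integrableOn_rpow_mul_exp_neg_mul_rpow (s := 2 * H) (p := 1) (b := a)
      (by linarith) one_pos ha
    refine (h3.const_mul a).congr (ae_of_all _ fun v => ?_)
    simp only [Real.rpow_one]
    ring
  rw [← h2]
  rw [intervalIntegral.integral_of_le (div_le_div_of_nonneg_right (by simp) hn.le)]
  refine setIntegral_mono_set hint ?_ (by simpa using Set.Ioc_subset_Ioi_self.eventuallyLE)
  refine (ae_restrict_iff' measurableSet_Ioi).2 (ae_of_all _ fun v hv => ?_)
  have : (0 : ℝ) < v := hv
  simp only [Pi.zero_apply]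
  positivity

/-- The constant in the variance bounds of the stationary Ornstein–Uhlenbeck processes. -/
noncomputable def ouConst (H : ℝ) : ℝ := 4 * (1 + Real.Gamma (2 * H + 1))

theorem ouConst_pos (hH : 0 < H) : 0 < ouConst H := by
  have := Real.Gamma_pos_of_pos (show 0 < 2 * H + 1 by positivity)
  unfold ouConst
  positivity

variable {X : ℝ → Ω → ℝ}

theorem IsFBM.hasSubgaussianMGF_ouApprox (h : IsFBM H X P) (hH : 0 < H) (ha : 0 < a) {c : ℝ≥0}
    (hc : ouConst H * a ^ (-(2 * H)) ≤ c) (n : ℕ) (t : ℝ) :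
    HasSubgaussianMGF (fun ω => ouApprox a n (fun u => X u ω) t) c P := by
  -- Only single increments occur here, so the second one is taken to be the trivial X t - X t.
  have h1 := h.hasSubgaussianMGF_sum hH (Finset.range ((n + 1) ^ 2)) (ouWeight a n)
    (fun j _ => ouWeight_nonneg ha n j) (sum_ouWeight_le_one n _)
    (fun j => ![t, t - j / (n + 1), t, t]) (c := c) ?_
  · refine h1.congr (ae_of_all _ fun ω => ?_)
    simp [ouApprox]
  · refine le_trans ?_ hc
    have h2 := sum_ouWeight_mul_rpow_le ha hH n ((n + 1) ^ 2)
    have h3 : ∀ j : ℕ, |(j : ℝ) / (n + 1)| = j / (n + 1) := fun j => abs_of_nonneg (by positivity)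
    have h0 : (0 : ℝ) ^ (2 * H) = 0 := Real.zero_rpow (by positivity)
    have h4 : ∀ j ∈ Finset.range ((n + 1) ^ 2), ouWeight a n j *
        (2 * |(![t, t - j / (n + 1), t, t] : Fin 4 → ℝ) 0 - (![t, t - j / (n + 1), t, t] : Fin 4 → ℝ) 1| ^ (2 * H) +
        2 * |(![t, t - j / (n + 1), t, t] : Fin 4 → ℝ) 2 - (![t, t - j / (n + 1), t, t] : Fin 4 → ℝ) 3| ^ (2 * H)) =
        2 * (ouWeight a n j * ((j : ℝ) / (n + 1)) ^ (2 * H)) := fun j _ => by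
      simp [h3, h0]
      ring
    rw [Finset.sum_congr rfl h4, ← Finset.mul_sum]
    have h5 : 0 ≤ a ^ (-(2 * H)) := by positivity
    have h6 := Real.Gamma_pos_of_pos (show 0 < 2 * H + 1 by positivity)
    unfold ouConst
    nlinarith [mul_nonneg h6.le h5]

/-- Interpolation between the short-time bound x^{2H} and the stationary bound b^{-2H}, according to
whether b x ≤ 1. The weight α^{2γ-2H} of the hypotheses originates here. -/
theorem min_rpow_le {x b γ : ℝ} (hx : 0 ≤ x) (hb : 0 < b) (hγ : 0 < γ) (hγH : γ ≤ H) :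
    x ^ (2 * H) ≤ b ^ (2 * γ - 2 * H) * x ^ (2 * γ) ∨
      b ^ (-(2 * H)) ≤ b ^ (2 * γ - 2 * H) * x ^ (2 * γ) := by
  rcases le_total (b * x) 1 with h | h
  · left
    rcases hx.eq_or_lt with rfl | hx
    · rw [Real.zero_rpow (by linarith)]
      positivity
    have h1 : x ≤ b⁻¹ := by rwa [le_inv_comm₀ hx hb, ← one_div, le_div_iff₀ hx]
    calc x ^ (2 * H) = x ^ (2 * H - 2 * γ) * x ^ (2 * γ) := by rw [← Real.rpow_add hx]; ring_nf
      _ ≤ b⁻¹ ^ (2 * H - 2 * γ) * x ^ (2 * γ) := by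
        gcongr
        linarith
      _ = _ := by rw [Real.inv_rpow hb.le, ← Real.rpow_neg hb.le, neg_sub]
  · right
    have h1 : 1 ≤ (b * x) ^ (2 * γ) := Real.one_le_rpow h (by positivity)
    rw [Real.mul_rpow hb.le hx] at h1
    calc b ^ (-(2 * H)) ≤ b ^ (-(2 * H)) * (b ^ (2 * γ) * x ^ (2 * γ)) :=
          le_mul_of_one_le_right (by positivity) h1
      _ = _ := by rw [← mul_assoc, ← Real.rpow_add hb]; ring_nf

/-- The second difference of X at t, t - v, s, s - v can be paired into increments over |t - s| or
into increments over v; `min_rpow_le` decides which pairing to use. -/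
theorem IsFBM.hasSubgaussianMGF_ouApprox_sub (h : IsFBM H X P) (hH : 0 < H) (ha : 0 < a) {γ : ℝ}
    (hγ : 0 < γ) (hγH : γ ≤ H) {s t : ℝ} {c : ℝ≥0}
    (hc : ouConst H * (a ^ (2 * γ - 2 * H) * |t - s| ^ (2 * γ)) ≤ c) (n : ℕ) :
    HasSubgaussianMGF (fun ω => ouApprox a n (fun u => X u ω) t - ouApprox a n (fun u => X u ω) s)
      c P := by
  have hG := Real.Gamma_pos_of_pos (show 0 < 2 * H + 1 by positivity)
  have key : ∀ f : ℕ → Fin 4 → ℝ, (∀ j : ℕ, (∀ ω, (X t ω - X (t - j / (n + 1)) ω) -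
      (X s ω - X (s - j / (n + 1)) ω) = (X (f j 0) ω - X (f j 1) ω) - (X (f j 2) ω - X (f j 3) ω))) →
      ∑ j ∈ Finset.range ((n + 1) ^ 2), ouWeight a n j * (2 * |f j 0 - f j 1| ^ (2 * H) +
        2 * |f j 2 - f j 3| ^ (2 * H)) ≤ c →
      HasSubgaussianMGF (fun ω => ouApprox a n (fun u => X u ω) t - ouApprox a n (fun u => X u ω) s)
        c P := by
    intro f hf hfc
    refine (h.hasSubgaussianMGF_sum hH (Finset.range ((n + 1) ^ 2)) (ouWeight a n)
      (fun j _ => ouWeight_nonneg ha n j) (sum_ouWeight_le_one n _) f hfc).congr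
      (ae_of_all _ fun ω => ?_)
    simp only [ouApprox, smul_eq_mul]
    rw [← Finset.sum_sub_distrib]
    exact Finset.sum_congr rfl fun j _ => by rw [← hf]; ring
  rcases min_rpow_le (abs_nonneg (t - s)) ha hγ hγH with h1 | h1
  · refine key (fun j => ![t, s, t - j / (n + 1), s - j / (n + 1)]) (fun j ω => ?_) ?_
    · simp
      ring
    · have h4 : ∀ j ∈ Finset.range ((n + 1) ^ 2), ouWeight a n j *
          (2 * |(![t, s, t - j / (n + 1), s - j / (n + 1)] : Fin 4 → ℝ) 0 -
            (![t, s, t - j / (n + 1), s - j / (n + 1)] : Fin 4 → ℝ) 1| ^ (2 * H) +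
          2 * |(![t, s, t - j / (n + 1), s - j / (n + 1)] : Fin 4 → ℝ) 2 -
            (![t, s, t - j / (n + 1), s - j / (n + 1)] : Fin 4 → ℝ) 3| ^ (2 * H)) =
          ouWeight a n j * (4 * |t - s| ^ (2 * H)) := fun j _ => by
        change ouWeight a n j * (2 * |t - s| ^ (2 * H) +
          2 * |t - j / (n + 1) - (s - j / (n + 1))| ^ (2 * H)) = _
        rw [sub_sub_sub_cancel_right]
        ring
      rw [Finset.sum_congr rfl h4, ← Finset.sum_mul]
      refine (mul_le_of_le_one_left (by positivity) (sum_ouWeight_le_one n _)).trans (le_trans ?_ hc)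
      unfold ouConst
      have h5 : 0 ≤ |t - s| ^ (2 * H) := by positivity
      nlinarith
  · refine key (fun j => ![t, t - j / (n + 1), s, s - j / (n + 1)]) (fun j ω => ?_) ?_
    · simp
    · have h3 : ∀ j : ℕ, |(j : ℝ) / (n + 1)| = j / (n + 1) := fun j => abs_of_nonneg (by positivity)
      have h4 : ∀ j ∈ Finset.range ((n + 1) ^ 2), ouWeight a n j *
          (2 * |(![t, t - j / (n + 1), s, s - j / (n + 1)] : Fin 4 → ℝ) 0 -
            (![t, t - j / (n + 1), s, s - j / (n + 1)] : Fin 4 → ℝ) 1| ^ (2 * H) +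
          2 * |(![t, t - j / (n + 1), s, s - j / (n + 1)] : Fin 4 → ℝ) 2 -
            (![t, t - j / (n + 1), s, s - j / (n + 1)] : Fin 4 → ℝ) 3| ^ (2 * H)) =
          4 * (ouWeight a n j * ((j : ℝ) / (n + 1)) ^ (2 * H)) := fun j _ => by
        simp [h3]
        ring
      rw [Finset.sum_congr rfl h4, ← Finset.mul_sum]
      have h2 := sum_ouWeight_mul_rpow_le ha hH n ((n + 1) ^ 2)
      refine le_trans ?_ hc
      unfold ouConst
      have h5 : 0 ≤ a ^ (-(2 * H)) := by positivity
      nlinarith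

theorem map_ouApprox {E F : Type*} [AddCommGroup E] [Module ℝ E] [AddCommGroup F] [Module ℝ F]
    (L : E →ₗ[ℝ] F) (n : ℕ) (g : ℝ → E) (t : ℝ) :
    L (ouApprox a n g t) = ouApprox a n (fun u => L (g u)) t := by
  simp [ouApprox, map_sum]

variable {β : Mode → ℝ → Ω → ℂ}

theorem subG_of_sqrt_two_mul {Z : Ω → ℂ} {c : ℝ≥0}
    (h1 : HasSubgaussianMGF (fun ω => √2 * (Z ω).re) c P)
    (h2 : HasSubgaussianMGF (fun ω => √2 * (Z ω).im) c P) : SubG Z c P := by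
  have hs : √(2 : ℝ) ≠ 0 := by positivity
  have h3 : (√(2 : ℝ))⁻¹ ^ 2 * (c : ℝ) ≤ c := by
    rw [inv_pow, Real.sq_sqrt (by norm_num)]
    linarith [c.coe_nonneg]
  refine ⟨(h1.const_mul_of_le (√2)⁻¹ h3).congr (ae_of_all _ fun ω => ?_),
    (h2.const_mul_of_le (√2)⁻¹ h3).congr (ae_of_all _ fun ω => ?_)⟩ <;>
  simp only [inv_mul_cancel_left₀ hs]

theorem IsModeFBM.subG_ouInt (h : IsModeFBM H β P) (hH : 0 < H) (hH1 : H < 1) (ha : 0 < a)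
    {c : ℝ≥0} (hc : ouConst H * a ^ (-(2 * H)) ≤ c) (k : Mode) (t : ℝ) :
    SubG (fun ω => ouInt a (fun u => β k u ω) t) c P := by
  refine subG_of_tendsto (Z' := fun n ω => ouApprox a n (fun u => β k u ω) t) (fun n => ?_) ?_
  · have hr := map_ouApprox (a := a) (√2 • Complex.reLm) n
    have hi := map_ouApprox (a := a) (√2 • Complex.imLm) n
    simp only [LinearMap.smul_apply, smul_eq_mul, Complex.reLm_coe, Complex.imLm_coe] at hr hi
    refine subG_of_sqrt_two_mul ?_ ?_
    · simp only [hr]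
      exact (h.re_fbm k).hasSubgaussianMGF_ouApprox hH ha hc n t
    · simp only [hi]
      exact (h.im_fbm k).hasSubgaussianMGF_ouApprox hH ha hc n t
  · filter_upwards [h.ae_subexpPath hH hH1] with ω hω
    exact (hω k).tendsto_ouApprox ha t

theorem IsModeFBM.subG_ouInt_sub (h : IsModeFBM H β P) (hH : 0 < H) (hH1 : H < 1) (ha : 0 < a)
    {γ : ℝ} (hγ : 0 < γ) (hγH : γ ≤ H) {s t : ℝ} {c : ℝ≥0}
    (hc : ouConst H * (a ^ (2 * γ - 2 * H) * |t - s| ^ (2 * γ)) ≤ c) (k : Mode) :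
    SubG (fun ω => ouInt a (fun u => β k u ω) t - ouInt a (fun u => β k u ω) s) c P := by
  refine subG_of_tendsto (Z' := fun n ω => ouApprox a n (fun u => β k u ω) t -
    ouApprox a n (fun u => β k u ω) s) (fun n => ?_) ?_
  · have hr := map_ouApprox (a := a) (√2 • Complex.reLm) n
    have hi := map_ouApprox (a := a) (√2 • Complex.imLm) n
    simp only [LinearMap.smul_apply, smul_eq_mul, Complex.reLm_coe, Complex.imLm_coe] at hr hi
    refine subG_of_sqrt_two_mul ?_ ?_
    · simp only [Complex.sub_re, mul_sub, hr]
      exact (h.re_fbm k).hasSubgaussianMGF_ouApprox_sub hH ha hγ hγH hc n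
    · simp only [Complex.sub_im, mul_sub, hi]
      exact (h.im_fbm k).hasSubgaussianMGF_ouApprox_sub hH ha hγ hγH hc n
  · filter_upwards [h.ae_subexpPath hH hH1] with ω hω
    exact ((hω k).tendsto_ouApprox ha t).sub ((hω k).tendsto_ouApprox ha s)

/-- The Ornstein–Uhlenbeck functional as a measurable functional on path space. -/
noncomputable def ouLim (a : ℝ) (t : ℝ) (g : ℝ → ℂ) : ℂ :=
  limUnder atTop fun n => ouApprox a n g t

/-- On the space of all paths with the product σ-algebra, a limit of finite combinations of
coordinates is measurable without any regularity of the path. -/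
theorem measurable_ouLim (a t : ℝ) : Measurable (ouLim a t) := by
  refine (StronglyMeasurable.limUnder (l := atTop) fun n => ?_).measurable
  refine Measurable.stronglyMeasurable ?_
  unfold ouApprox
  fun_prop

theorem SubexpPath.ouLim_eq {g : ℝ → ℂ} (hg : SubexpPath g) (ha : 0 < a) (t : ℝ) :
    ouLim a t g = ouInt a g t :=
  (hg.tendsto_ouApprox ha t).limUnder_eq

end OUMoments

end InertialParticle

namespace InertialParticle

/-! ### Uniqueness of the law of the noise, and stationarity -/

section LawInvariance

variable {Ω : Type*} [MeasurableSpace Ω] {P : Measure Ω} {H : ℝ} {X X' : ℝ → Ω → ℝ}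

/-- Stationarity of increments: the terms |s + r|^{2H}, |t + r|^{2H} and |r|^{2H} cancel in the
covariance. -/
theorem IsFBM.shift (h : IsFBM H X P) (hH : 0 < H) (r : ℝ) :
    IsFBM H (fun t ω => X (t + r) ω - X r ω) P where
  measurable t := (h.measurable _).sub (h.measurable _)
  gaussian := by
    have := h.gaussian.shift r
    simpa only [add_comm r] using this
  zero := ae_of_all _ fun ω => by simp
  mean t := by rw [integral_sub (h.integrable _) (h.integrable _), h.mean, h.mean, sub_zero]
  cov s t := by
    have h1 : ∀ ω, (X (s + r) ω - X r ω) * (X (t + r) ω - X r ω) =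
        (X (s + r) ω * X (t + r) ω - X (s + r) ω * X r ω) - (X r ω * X (t + r) ω - X r ω * X r ω) :=
      fun ω => by ring
    simp only [h1]
    have i1 : Integrable (fun ω => X (s + r) ω * X (t + r) ω - X (s + r) ω * X r ω) P :=
      (h.integrable_mul _ _).sub (h.integrable_mul _ _)
    have i2 : Integrable (fun ω => X r ω * X (t + r) ω - X r ω * X r ω) P :=
      (h.integrable_mul _ _).sub (h.integrable_mul _ _)
    rw [integral_sub i1 i2, integral_sub (h.integrable_mul _ _) (h.integrable_mul _ _),
      integral_sub (h.integrable_mul _ _) (h.integrable_mul _ _), h.cov, h.cov, h.cov, h.cov]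
    have h2 : r - (t + r) = -t := by ring
    have h0 : (0 : ℝ) ^ (2 * H) = 0 := Real.zero_rpow (by positivity)
    simp only [add_sub_add_right_eq_sub, add_sub_cancel_right, h2, abs_neg, sub_self, abs_zero, h0]
    ring
  continuous_paths := by
    filter_upwards [h.continuous_paths] with ω hω
    exact (hω.comp (continuous_add_const r)).sub continuous_const

theorem IsFBM.measurable_path (h : IsFBM H X P) : Measurable fun ω t => X t ω :=
  measurable_pi_lambda _ h.measurable

/-- The law of a fractional Brownian motion is determined by the Hurst parameter. -/
theorem IsFBM.map_eq [IsProbabilityMeasure P] (h : IsFBM H X P) (h' : IsFBM H X' P) :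
    P.map (fun ω t => X t ω) = P.map (fun ω t => X' t ω) := by
  refine (map_eq_iff_forall_finset_map_restrict_eq h.measurable_path.aemeasurable
    h'.measurable_path.aemeasurable).2 fun I => ?_
  -- The characteristic function of a centred Gaussian vector is determined by its covariance
  -- matrix, here an explicit function of H.
  have key : ∀ {Y : ℝ → Ω → ℝ} (hY : IsFBM H Y P) (L : StrongDual ℝ (I → ℝ)),
      charFunDual (P.map fun ω => I.restrict (Y · ω)) L = Complex.exp (- ((∑ i : I, ∑ j : I,
        L (Pi.single i 1) * L (Pi.single j 1) * ((1 / 2) * (|(i : ℝ)| ^ (2 * H) +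
          |(j : ℝ)| ^ (2 * H) - |(i : ℝ) - j| ^ (2 * H))) : ℝ) : ℂ) / 2) := by
    intro Y hY L
    have hL : ∀ ω, L (I.restrict (Y · ω)) = ∑ i : I, L (Pi.single i 1) * Y i ω := fun ω => by
      conv_lhs => rw [pi_eq_sum_univ' (I.restrict (Y · ω))]
      rw [map_sum]
      refine Finset.sum_congr rfl fun i _ => ?_
      rw [map_smul, smul_eq_mul, mul_comm, Finset.restrict_def]
    have hi : ∀ i : I, Integrable (fun ω => L (Pi.single i 1) * Y i ω) P := fun i =>
      (hY.integrable _).const_mul _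
    have h0 : ∫ ω, L (I.restrict (Y · ω)) ∂P = 0 := by
      simp only [hL]
      rw [integral_finsetSum _ fun i _ => hi i]
      exact Finset.sum_eq_zero fun i _ => by rw [integral_const_mul, hY.mean, mul_zero]
    rw [(hY.gaussian.hasGaussianLaw I).charFunDual_map_eq L]
    have hm : AEMeasurable (fun ω => L (I.restrict (Y · ω))) P := by
      simp only [hL]
      exact Finset.aemeasurable_fun_sum _ fun i _ => (hi i).aemeasurable
    have hv : Var[fun ω => L (I.restrict (Y · ω)); P] = ∑ i : I, ∑ j : I,
        L (Pi.single i 1) * L (Pi.single j 1) * ((1 / 2) * (|(i : ℝ)| ^ (2 * H) +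
          |(j : ℝ)| ^ (2 * H) - |(i : ℝ) - j| ^ (2 * H))) := by
      rw [variance_of_integral_eq_zero hm h0]
      have h2 : ∀ ω, (L (I.restrict (Y · ω))) ^ 2 = ∑ i : I, ∑ j : I,
          L (Pi.single i 1) * L (Pi.single j 1) * (Y i ω * Y j ω) := fun ω => by
        rw [hL, sq, Finset.sum_mul_sum]
        exact Finset.sum_congr rfl fun i _ => Finset.sum_congr rfl fun j _ => by ring
      have hij : ∀ i j : I, Integrable (fun ω => L (Pi.single i 1) * L (Pi.single j 1) *
          (Y i ω * Y j ω)) P := fun i j => (hY.integrable_mul _ _).const_mul _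
      simp only [h2]
      rw [integral_finsetSum _ fun i _ => integrable_finsetSum _ fun j _ => hij i j]
      refine Finset.sum_congr rfl fun i _ => ?_
      rw [integral_finsetSum _ fun j _ => hij i j]
      refine Finset.sum_congr rfl fun j _ => ?_
      rw [integral_const_mul, hY.cov]
    change Complex.exp (_ * Complex.I - ((Var[fun ω => L (I.restrict (Y · ω)); P] : ℝ) : ℂ) / 2) = _
    rw [hv]
    congr 1
    simp only [Function.comp_def]
    rw [h0]
    simp [neg_div]
  have e1 : IsFiniteMeasure (P.map fun ω => I.restrict (X · ω)) := inferInstance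
  have e2 : IsFiniteMeasure (P.map fun ω => I.restrict (X' · ω)) := inferInstance
  refine Measure.ext_of_charFunDual ?_
  ext L
  rw [key h, key h']

variable {β β' : Mode → ℝ → Ω → ℂ}

theorem IsModeFBM.measurable_path (h : IsModeFBM H β P) (k : Mode) :
    Measurable fun ω t => β k t ω :=
  measurable_pi_lambda _ (h.measurable k)

theorem IsModeFBM.shift (h : IsModeFBM H β P) (hH : 0 < H) (r : ℝ) :
    IsModeFBM H (fun k t ω => β k (t + r) ω - β k r ω) P where
  re_fbm k := by
    have := (h.re_fbm k).shift hH r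
    simpa only [← mul_sub, ← Complex.sub_re] using this
  im_fbm k := by
    have := (h.im_fbm k).shift hH r
    simpa only [← mul_sub, ← Complex.sub_im] using this
  re_im_indep k := by
    have hm : Measurable fun (g : ℝ → ℝ) t => g (t + r) - g r :=
      measurable_pi_lambda _ fun t => (measurable_pi_apply _).sub (measurable_pi_apply _)
    exact (h.re_im_indep k).comp hm hm
  conj k := by
    filter_upwards [h.conj k] with ω hω t
    rw [hω, hω, map_sub]
  indep S hS := by
    have hm : Measurable fun (g : ℝ → ℂ) t => g (t + r) - g r :=
      measurable_pi_lambda _ fun t => (measurable_pi_apply _).sub (measurable_pi_apply _)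
    exact (h.indep S hS).comp (fun _ g t => g (t + r) - g r) fun _ => hm

theorem IsModeFBM.map_eq_single [IsProbabilityMeasure P] (h : IsModeFBM H β P)
    (h' : IsModeFBM H β' P) (k : Mode) :
    P.map (fun ω t => β k t ω) = P.map (fun ω t => β' k t ω) := by
  have hs : √(2 : ℝ) ≠ 0 := by positivity
  have hscale : Measurable fun (g : ℝ → ℝ) t => (√2)⁻¹ * g t :=
    measurable_pi_lambda _ fun t => (measurable_pi_apply t).const_mul _
  have hre : P.map (fun ω t => (β k t ω).re) = P.map (fun ω t => (β' k t ω).re) := by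
    have h1 := congrArg (Measure.map fun (g : ℝ → ℝ) t => (√2)⁻¹ * g t)
      ((h.re_fbm k).map_eq (h'.re_fbm k))
    rw [Measure.map_map hscale (h.re_fbm k).measurable_path,
      Measure.map_map hscale (h'.re_fbm k).measurable_path] at h1
    simpa only [Function.comp_def, inv_mul_cancel_left₀ hs] using h1
  have him : P.map (fun ω t => (β k t ω).im) = P.map (fun ω t => (β' k t ω).im) := by
    have h1 := congrArg (Measure.map fun (g : ℝ → ℝ) t => (√2)⁻¹ * g t)
      ((h.im_fbm k).map_eq (h'.im_fbm k))
    rw [Measure.map_map hscale (h.im_fbm k).measurable_path,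
      Measure.map_map hscale (h'.im_fbm k).measurable_path] at h1
    simpa only [Function.comp_def, inv_mul_cancel_left₀ hs] using h1
  have mre : ∀ {β : Mode → ℝ → Ω → ℂ}, IsModeFBM H β P → Measurable fun ω t => (β k t ω).re :=
    fun h => measurable_pi_lambda _ fun t => Complex.measurable_re.comp (h.measurable k t)
  have mim : ∀ {β : Mode → ℝ → Ω → ℂ}, IsModeFBM H β P → Measurable fun ω t => (β k t ω).im :=
    fun h => measurable_pi_lambda _ fun t => Complex.measurable_im.comp (h.measurable k t)
  have hp : P.map (fun ω => ((fun t => (β k t ω).re), fun t => (β k t ω).im)) =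
      P.map (fun ω => ((fun t => (β' k t ω).re), fun t => (β' k t ω).im)) := by
    rw [(indepFun_iff_map_prod_eq_prod_map_map (mre h).aemeasurable (mim h).aemeasurable).1
      (h.re_im_indep k), (indepFun_iff_map_prod_eq_prod_map_map (mre h').aemeasurable
      (mim h').aemeasurable).1 (h'.re_im_indep k), hre, him]
  let F : (ℝ → ℝ) × (ℝ → ℝ) → ℝ → ℂ := fun g t => (g.1 t : ℂ) + (g.2 t : ℂ) * Complex.I
  have hmk : Measurable F := measurable_pi_lambda _ fun t => by
    have m1 : Measurable fun g : (ℝ → ℝ) × (ℝ → ℝ) => g.1 t :=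
      (measurable_pi_apply t).comp measurable_fst
    have m2 : Measurable fun g : (ℝ → ℝ) × (ℝ → ℝ) => g.2 t :=
      (measurable_pi_apply t).comp measurable_snd
    exact (Complex.measurable_ofReal.comp m1).add
      ((Complex.measurable_ofReal.comp m2).mul_const _)
  have h1 := congrArg (Measure.map F) hp
  rw [Measure.map_map hmk ((mre h).prodMk (mim h)),
    Measure.map_map hmk ((mre h').prodMk (mim h'))] at h1
  simpa only [F, Function.comp_def, Complex.re_add_im] using h1

/-- One mode out of each pair `{k, -k}`. -/
def halfModes : Set Mode := {k | 0 < k.1 0 ∨ k.1 0 = 0 ∧ 0 < k.1 1}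

theorem negMode_negMode (k : Mode) : negMode (negMode k) = k := by
  ext1
  simp [negMode]

theorem negMode_notMem_halfModes {k : Mode} (hk : k ∈ halfModes) : negMode k ∉ halfModes := by
  simp only [halfModes, negMode, Set.mem_ofPred_eq, Pi.neg_apply] at hk ⊢
  omega

theorem negMode_mem_halfModes {k : Mode} (hk : k ∉ halfModes) : negMode k ∈ halfModes := by
  have h0 : k.1 0 ≠ 0 ∨ k.1 1 ≠ 0 := by
    by_contra! h
    exact k.2 (funext fun i => by fin_cases i <;> simp [h.1, h.2])
  simp only [halfModes, negMode, Set.mem_ofPred_eq, Pi.neg_apply] at hk ⊢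
  omega

theorem negMode_ne (k : Mode) : negMode k ≠ k := by
  intro h
  by_cases hk : k ∈ halfModes
  · exact negMode_notMem_halfModes hk (h.symm ▸ hk)
  · exact hk (h ▸ negMode_mem_halfModes hk)

open Classical in
/-- The extension of a family of paths from `halfModes` to all modes by conjugation. -/
noncomputable def extendConj (g : halfModes → ℝ → ℂ) (k : Mode) (t : ℝ) : ℂ :=
  if hk : k ∈ halfModes then g ⟨k, hk⟩ t
  else (starRingEnd ℂ) (g ⟨negMode k, negMode_mem_halfModes hk⟩ t)

theorem measurable_extendConj : Measurable extendConj := by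
  refine measurable_pi_lambda _ fun k => measurable_pi_lambda _ fun t => ?_
  by_cases hk : k ∈ halfModes
  · simp only [extendConj, hk, dif_pos]
    exact (measurable_pi_apply t).comp (measurable_pi_apply _)
  · simp only [extendConj, hk, dif_neg, not_false_eq_true]
    exact Complex.continuous_conj.measurable.comp
      ((measurable_pi_apply t).comp (measurable_pi_apply _))

theorem IsModeFBM.ae_eq_extendConj (h : IsModeFBM H β P) :
    (fun ω k t => β k t ω) =ᵐ[P] fun ω => extendConj fun k t => β k.1 t ω := by
  have h1 : ∀ᵐ ω ∂P, ∀ k t, β (negMode k) t ω = (starRingEnd ℂ) (β k t ω) :=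
    ae_all_iff.2 h.conj
  filter_upwards [h1] with ω hω
  funext k t
  by_cases hk : k ∈ halfModes
  · simp [extendConj, hk]
  · simp [extendConj, hk, hω]

/-- The law of the family of driving noises is determined by the Hurst parameter. -/
theorem IsModeFBM.map_eq [IsProbabilityMeasure P] (h : IsModeFBM H β P)
    (h' : IsModeFBM H β' P) :
    P.map (fun ω k t => β k t ω) = P.map (fun ω k t => β' k t ω) := by
  -- Independence is available only for one mode of each conjugate pair; the remaining modes are a
  -- measurable function of these.
  rw [Measure.map_congr h.ae_eq_extendConj, Measure.map_congr h'.ae_eq_extendConj]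
  have hS : ∀ k ∈ halfModes, negMode k ∉ halfModes := fun k hk => negMode_notMem_halfModes hk
  have h1 : P.map (fun ω (k : halfModes) t => β k.1 t ω) =
      P.map (fun ω (k : halfModes) t => β' k.1 t ω) := by
    have e1 := (h.indep _ hS).map_fun_eq_infinitePi_map
      fun k : halfModes => h.measurable_path k.1
    have e2 := (h'.indep _ hS).map_fun_eq_infinitePi_map
      fun k : halfModes => h'.measurable_path k.1
    refine e1.trans (Eq.trans ?_ e2.symm)
    congr 1
    funext k
    exact h.map_eq_single h' k.1
  have h2 := congrArg (Measure.map extendConj) h1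
  rwa [Measure.map_map measurable_extendConj (measurable_pi_lambda _ fun k => h.measurable_path k.1),
    Measure.map_map measurable_extendConj (measurable_pi_lambda _ fun k => h'.measurable_path k.1)]
    at h2

/-- The functional sees only increments of the path, so subtracting the constant g r has no effect.
-/
theorem ouLim_shift (a r t : ℝ) (g : ℝ → ℂ) :
    ouLim a t (fun u => g (u + r) - g r) = ouLim a (t + r) g := by
  unfold ouLim ouApprox
  congr 1
  funext n
  refine Finset.sum_congr rfl fun j _ => ?_
  rw [sub_sub_sub_cancel_right, sub_add_eq_add_sub]

/-- The Ornstein–Uhlenbeck processes driven by the modes are jointly stationary. -/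
theorem IsModeFBM.map_ouLim_add [IsProbabilityMeasure P] (h : IsModeFBM H β P) (hH : 0 < H)
    (a : Mode → ℝ) (r : ℝ) :
    P.map (fun ω k t => ouLim (a k) (t + r) fun u => β k u ω) =
      P.map (fun ω k t => ouLim (a k) t fun u => β k u ω) := by
  have hm : Measurable fun (g : Mode → ℝ → ℂ) k t => ouLim (a k) t (g k) :=
    measurable_pi_lambda _ fun k => measurable_pi_lambda _ fun t =>
      (measurable_ouLim _ _).comp (measurable_pi_apply k)
  have h1 := congrArg (Measure.map fun (g : Mode → ℝ → ℂ) k t => ouLim (a k) t (g k))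
    ((h.shift hH r).map_eq h)
  rw [Measure.map_map hm (measurable_pi_lambda _ (h.shift hH r).measurable_path),
    Measure.map_map hm (measurable_pi_lambda _ h.measurable_path)] at h1
  simp only [Function.comp_def] at h1
  rw [← h1]
  congr 1
  funext ω k t
  exact (ouLim_shift _ _ _ _).symm

end LawInvariance

end InertialParticle

namespace InertialParticle

open scoped NNReal

/-! ### Fourier coefficients of the stationary solution -/

section OUFamily

variable {Ω : Type*} [MeasurableSpace Ω] {P : Measure Ω} {τ ν H : ℝ} {α lam : Mode → ℝ}
  {β : Mode → ℝ → Ω → ℂ}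

/-- A regularised version of the Fourier coefficients of the stationary solution. -/
structure IsOUFamily (P : Measure Ω) (ν H : ℝ) (α lam : Mode → ℝ) (β : Mode → ℝ → Ω → ℂ)
    (a : Mode → ℝ → Ω → ℂ) : Prop where
  measurable : ∀ k t, Measurable (a k t)
  continuous : ∀ k ω, Continuous fun t => a k t ω
  conj : ∀ k t ω, a (negMode k) t ω = (starRingEnd ℂ) (a k t ω)
  stat : ∀ᵐ ω ∂P, ∀ k t, statCoeff ν H α lam β t k ω = a k t ω
  mild : ∀ᵐ ω ∂P, ∀ k s t, s ≤ t →
    a k t ω = Real.exp (-(t - s) * ν * α k) * a k s ω + convCoeff ν H α lam β s t k ω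
  subG : ∀ F : Finset Mode, (∀ k ∈ F, negMode k ∉ F) → ∀ (c : Mode → ℂ) (t : ℝ) (v : ℝ≥0),
    ∑ k ∈ F, 4 * ‖c k‖ ^ 2 * (lam k * (ouConst H * α k ^ (-(2 * H)))) ≤ (v : ℝ) →
      SubG (fun ω => ∑ k ∈ F, c k * a k t ω) v P
  subG_sub : ∀ F : Finset Mode, (∀ k ∈ F, negMode k ∉ F) → ∀ (c : Mode → ℂ) (s t : ℝ) (γ : ℝ)
    (v : ℝ≥0), 0 < γ → γ ≤ H →
    ∑ k ∈ F, 4 * ‖c k‖ ^ 2 * (lam k * (ouConst H * ν ^ (2 * γ) *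
      (α k ^ (2 * γ - 2 * H) * |t - s| ^ (2 * γ)))) ≤ (v : ℝ) →
      SubG (fun ω => ∑ k ∈ F, c k * (a k t ω - a k s ω)) v P
  map_add : ∀ r, P.map (fun ω k t => a k (t + r) ω) = P.map (fun ω k t => a k t ω)

theorem Assumptions.alpha_pos (hA : Assumptions τ ν H α lam) (k : Mode) : 0 < α k := by
  obtain ⟨c, hc, h⟩ := hA.alpha_lower
  exact hc.trans_le (h k)

theorem subG_sum_const_mul {U : Mode → Ω → ℂ} {F : Finset Mode}
    (hU : iIndepFun (fun (k : (F : Set Mode)) => U k.1) P) (c : Mode → ℂ) {u : Mode → ℝ≥0}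
    (h : ∀ k ∈ F, SubG (U k) (u k) P) {v : ℝ≥0}
    (hv : ∑ k ∈ F, 4 * ‖c k‖ ^ 2 * (u k : ℝ) ≤ (v : ℝ)) :
    SubG (fun ω => ∑ k ∈ F, c k * U k ω) v P := by
  have h1 : iIndepFun (fun (k : (F : Set Mode)) ω => c k.1 * U k.1 ω) P :=
    hU.comp (fun k z => c k.1 * z) fun k => measurable_const_mul _
  have h2 := SubG.sum h1 (v := fun k => 4 * ‖c k.1‖₊ ^ 2 * u k.1) (s := Finset.univ)
    fun k _ => (h k.1 k.2).const_mul _ (by push_cast; rfl)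
  have h3 : ∀ ω, ∑ k : (F : Set Mode), c k.1 * U k.1 ω = ∑ k ∈ F, c k * U k ω := fun ω =>
    Finset.sum_coe_sort F fun k => c k * U k ω
  have h4 : ∑ k : (F : Set Mode), 4 * ‖c k.1‖₊ ^ 2 * u k.1 = ∑ k ∈ F, 4 * ‖c k‖₊ ^ 2 * u k :=
    Finset.sum_coe_sort F fun k => 4 * ‖c k‖₊ ^ 2 * u k
  simp only [h3] at h2
  rw [h4] at h2
  refine h2.mono ?_
  rw [← NNReal.coe_le_coe]
  push_cast
  exact hv

/-- The coefficients are set to zero off a measurable set of full measure on which all paths are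
subexponential and conjugate in pairs; continuity and symmetry then hold for every ω, and
measurability comes from the path-space functional. -/
theorem exists_isOUFamily [IsProbabilityMeasure P] (hA : Assumptions τ ν H α lam)
    (hβ : IsModeFBM H β P) : ∃ a, IsOUFamily P ν H α lam β a := by
  classical
  have hH := hA.hurst_pos
  have hH1 := hA.hurst_lt_one
  have hν := hA.nu_pos
  have hpos : ∀ k, 0 < ν * α k := fun k => mul_pos hν (hA.alpha_pos k)
  have hgood : ∀ᵐ ω ∂P, (∀ k, SubexpPath fun t => β k t ω) ∧
      ∀ k t, β (negMode k) t ω = (starRingEnd ℂ) (β k t ω) :=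
    (hβ.ae_subexpPath hH hH1).and (ae_all_iff.2 hβ.conj)
  obtain ⟨G, hG, hGm, hGp⟩ := hgood.exists_measurable_mem
  let b : Mode → ℂ := fun k => ((√(lam k) * ν ^ H : ℝ) : ℂ)
  let a : Mode → ℝ → Ω → ℂ := fun k t =>
    G.indicator fun ω => b k * ouInt (ν * α k) (fun u => β k u ω) t
  have haG : ∀ {ω}, ω ∈ G → ∀ k t, a k t ω = b k * ouInt (ν * α k) (fun u => β k u ω) t :=
    fun hω k t => Set.indicator_of_mem hω _
  have haL : ∀ k t, a k t = G.indicator fun ω => b k * ouLim (ν * α k) t fun u => β k u ω := by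
    intro k t
    refine Set.indicator_congr fun ω hω => ?_
    rw [((hGp ω hω).1 k).ouLim_eq (hpos k)]
  have hmL : ∀ k t, Measurable fun ω => ouLim (ν * α k) t fun u => β k u ω := fun k t =>
    (measurable_ouLim _ _).comp (hβ.measurable_path k)
  have hb : ∀ k, ‖b k‖ ^ 2 = lam k * ν ^ (2 * H) := fun k => by
    simp only [b]
    rw [Complex.norm_real, Real.norm_of_nonneg (by positivity), mul_pow,
      Real.sq_sqrt (hA.lam_nonneg k), ← Real.rpow_natCast (ν ^ H), ← Real.rpow_mul hν.le]
    ring_nf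
  have hbneg : ∀ k, b (negMode k) = b k := fun k => by simp only [b, hA.lam_symm]
  have hbconj : ∀ k, (starRingEnd ℂ) (b k) = b k := fun k => Complex.conj_ofReal _
  have hmem : ∀ᵐ ω ∂P, ω ∈ G := hG
  have hind : ∀ (F : Finset Mode), (∀ k ∈ F, negMode k ∉ F) →
      ∀ Φ : Mode → (ℝ → ℂ) → ℂ, (∀ k, Measurable (Φ k)) →
      iIndepFun (fun (k : (F : Set Mode)) ω => Φ k.1 fun t => β k.1 t ω) P := fun F hF Φ hΦ =>
    (hβ.indep F (by simpa using hF)).comp (fun k => Φ k.1) fun k => hΦ k.1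
  refine ⟨a, ⟨fun k t => ?_, fun k ω => ?_, fun k t ω => ?_, ?_, ?_, ?_, ?_, ?_⟩⟩
  · rw [haL]
    exact ((hmL k t).const_mul _).indicator hGm
  · by_cases hω : ω ∈ G
    · simp only [haG hω]
      exact (continuous_ouInt (hpos k) ((hGp ω hω).1 k)).const_mul _
    · simp only [a, Set.indicator_of_notMem hω]
      exact continuous_const
  · by_cases hω : ω ∈ G
    · rw [haG hω, haG hω, hbneg, map_mul, hbconj, hA.alpha_symm]
      congr 1
      simp only [ouInt, (hGp ω hω).2]
      rw [← integral_conj]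
      congr 1
      funext v
      rw [Complex.real_smul, Complex.real_smul, map_mul, map_sub, Complex.conj_ofReal]
    · simp only [a, Set.indicator_of_notMem hω, map_zero]
  · filter_upwards [hmem] with ω hω k t
    rw [haG hω, statCoeff, rsIntegralIic_exp_eq (hpos k) ((hGp ω hω).1 k)]
  · filter_upwards [hmem] with ω hω k s t hst
    rw [haG hω, haG hω, convCoeff, rsIntegral_exp_eq ((hGp ω hω).1 k).1 hst,
      ouInt_eq (hpos k) ((hGp ω hω).1 k) s t, mul_assoc _ ν (α k)]
    ring
  · intro F hF c t v hv
    have hu : ∀ k, (0 : ℝ) ≤ ouConst H * (ν * α k) ^ (-(2 * H)) := fun k => by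
      have := ouConst_pos hH
      have := hpos k
      positivity
    have h1 := subG_sum_const_mul (P := P) (F := F)
      (U := fun k ω => ouLim (ν * α k) t fun u => β k u ω)
      (hind F hF (fun k => ouLim (ν * α k) t) fun k => measurable_ouLim _ _) (fun k => c k * b k)
      (u := fun k => ⟨ouConst H * (ν * α k) ^ (-(2 * H)), hu k⟩) (v := v) (fun k _ => ?_) ?_
    · refine h1.congr ?_
      filter_upwards [hmem] with ω hω
      refine Finset.sum_congr rfl fun k _ => ?_
      rw [haG hω, ((hGp ω hω).1 k).ouLim_eq (hpos k), mul_assoc]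
    · refine (hβ.subG_ouInt hH hH1 (hpos k) (c := ⟨_, hu k⟩) le_rfl k t).congr ?_
      filter_upwards [hmem] with ω hω
      rw [((hGp ω hω).1 k).ouLim_eq (hpos k)]
    · refine le_trans (le_of_eq (Finset.sum_congr rfl fun k _ => ?_)) hv
      rw [norm_mul, mul_pow, hb]
      change _ * (ouConst H * (ν * α k) ^ (-(2 * H))) = _
      -- The factor ν^{2H} of the noise cancels the ν^{-2H} of the variance bound.
      rw [Real.mul_rpow hν.le (hA.alpha_pos k).le, Real.rpow_neg hν.le]
      have := (Real.rpow_pos_of_pos hν (2 * H)).ne'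
      field_simp
  · intro F hF c s t γ v hγ hγH hv
    have hu : ∀ k, (0 : ℝ) ≤ ouConst H * ((ν * α k) ^ (2 * γ - 2 * H) * |t - s| ^ (2 * γ)) :=
      fun k => by
        have := ouConst_pos hH
        have := hpos k
        positivity
    have h1 := subG_sum_const_mul (P := P) (F := F)
      (U := fun k ω => ouLim (ν * α k) t (fun u => β k u ω) - ouLim (ν * α k) s fun u => β k u ω)
      (hind F hF (fun k g => ouLim (ν * α k) t g - ouLim (ν * α k) s g)
        fun k => (measurable_ouLim _ _).sub (measurable_ouLim _ _)) (fun k => c k * b k)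
      (u := fun k => ⟨ouConst H * ((ν * α k) ^ (2 * γ - 2 * H) * |t - s| ^ (2 * γ)), hu k⟩)
      (v := v) (fun k _ => ?_) ?_
    · refine h1.congr ?_
      filter_upwards [hmem] with ω hω
      refine Finset.sum_congr rfl fun k _ => ?_
      rw [haG hω, haG hω, ((hGp ω hω).1 k).ouLim_eq (hpos k), ((hGp ω hω).1 k).ouLim_eq (hpos k),
        mul_assoc, mul_sub]
    · refine (hβ.subG_ouInt_sub hH hH1 (hpos k) hγ hγH (c := ⟨_, hu k⟩) le_rfl k).congr ?_
      filter_upwards [hmem] with ω hω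
      rw [((hGp ω hω).1 k).ouLim_eq (hpos k), ((hGp ω hω).1 k).ouLim_eq (hpos k)]
    · refine le_trans (le_of_eq (Finset.sum_congr rfl fun k _ => ?_)) hv
      rw [norm_mul, mul_pow, hb]
      change _ * (ouConst H * ((ν * α k) ^ (2 * γ - 2 * H) * |t - s| ^ (2 * γ))) = _
      rw [Real.mul_rpow hν.le (hA.alpha_pos k).le, Real.rpow_sub hν]
      have := (Real.rpow_pos_of_pos hν (2 * H)).ne'
      field_simp
  · intro r
    have h1 : ∀ r, (fun ω k t => a k (t + r) ω) =ᵐ[P]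
        fun ω k t => b k * ouLim (ν * α k) (t + r) fun u => β k u ω := by
      intro r
      filter_upwards [hmem] with ω hω
      funext k t
      rw [haG hω, ((hGp ω hω).1 k).ouLim_eq (hpos k)]
    have h2 := h1 0
    simp only [add_zero] at h2
    rw [Measure.map_congr (h1 r), Measure.map_congr h2]
    have hm : Measurable fun (g : Mode → ℝ → ℂ) k t => b k * g k t :=
      measurable_pi_lambda _ fun k => measurable_pi_lambda _ fun t =>
        Measurable.const_mul (f := fun g : Mode → ℝ → ℂ => g k t)
          ((measurable_pi_apply t).comp (measurable_pi_apply k)) _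
    have h3 := congrArg (Measure.map fun (g : Mode → ℝ → ℂ) k t => b k * g k t)
      (hβ.map_ouLim_add hH (fun k => ν * α k) r)
    rwa [Measure.map_map hm (measurable_pi_lambda _ fun k => measurable_pi_lambda _ fun t =>
      hmL k _), Measure.map_map hm (measurable_pi_lambda _ fun k => measurable_pi_lambda _ fun t =>
      hmL k _)] at h3

end OUFamily

end InertialParticle

namespace InertialParticle

open scoped NNReal ENNReal

/-! ### Orthonormal series -/

section Orthonormal

variable {ι W : Type*} [NormedAddCommGroup W] [InnerProductSpace ℂ W] {v : ι → W}

theorem _root_.Orthonormal.norm_sum_smul_sq (hv : Orthonormal ℂ v) (c : ι → ℂ) (F : Finset ι) :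
    ‖∑ i ∈ F, c i • v i‖ ^ 2 = ∑ i ∈ F, ‖c i‖ ^ 2 := by
  simpa using hv.orthogonalFamily.norm_sum c F

theorem _root_.Orthonormal.summable_smul [CompleteSpace W] (hv : Orthonormal ℂ v) {c : ι → ℂ}
    (hc : Summable fun i => ‖c i‖ ^ 2) : Summable fun i => c i • v i := by
  simpa using hv.orthogonalFamily.summable_iff_norm_sq_summable c |>.2 hc

theorem _root_.Orthonormal.hasSum_norm_sq (hv : Orthonormal ℂ v) {c : ι → ℂ}
    {w : W} (hw : HasSum (fun i => c i • v i) w) : HasSum (fun i => ‖c i‖ ^ 2) (‖w‖ ^ 2) := by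
  have h1 : Tendsto (fun F : Finset ι => ‖∑ i ∈ F, c i • v i‖ ^ 2) atTop (𝓝 (‖w‖ ^ 2)) :=
    (hw.norm).pow 2
  simp only [hv.norm_sum_smul_sq] at h1
  exact h1

theorem _root_.Orthonormal.inner_hasSum (hv : Orthonormal ℂ v) {c : ι → ℂ}
    {w : W} (hw : HasSum (fun i => c i • v i) w) (k : ι) : inner ℂ (v k) w = c k := by
  classical
  have h1 := (innerSL ℂ (v k)).hasSum hw
  have h2 : (fun i => innerSL ℂ (v k) (c i • v i)) = fun i => if i = k then c k else 0 := by
    funext i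
    rw [innerSL_apply_apply, inner_smul_right, orthonormal_iff_ite.1 hv]
    split_ifs with h3 h4 h4
    · rw [h3]; simp
    · exact absurd h3.symm h4
    · exact absurd h4.symm h3
    · simp
  rw [h2] at h1
  exact h1.unique (hasSum_ite_eq k (c k))

/-- Parseval for the tail; it turns convergence in L²(Ω, V) into convergence of a numerical series.
-/
theorem _root_.Orthonormal.enorm_sub_sum_sq (hv : Orthonormal ℂ v) {c : ι → ℂ} {w : W}
    (hw : HasSum (fun i => c i • v i) w) (F : Finset ι) :
    ‖w - ∑ i ∈ F, c i • v i‖ₑ ^ 2 = ∑' i : {i // i ∉ F}, ‖c i‖ₑ ^ 2 := by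
  have h1 : HasSum (fun i : {i // i ∉ F} => c i • v i) (w - ∑ i ∈ F, c i • v i) :=
    (F.hasSum_compl_iff (f := fun i => c i • v i)).2 (by rwa [sub_add_cancel])
  have h3 := (hv.comp (fun i : {i // i ∉ F} => i.1) Subtype.val_injective).hasSum_norm_sq
    (c := fun i => c i) h1
  rw [← ofReal_norm, ← ENNReal.ofReal_pow (norm_nonneg _), ← h3.tsum_eq,
    ENNReal.ofReal_tsum_of_nonneg (fun k => by positivity) h3.summable]
  congr 1
  funext k
  rw [← ofReal_norm, ← ENNReal.ofReal_pow (norm_nonneg _)]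

end Orthonormal

/-! ### The space `V` and the semigroup -/

section TheSpaceV

theorem integral_eq_inner_mFourierLp (f : Lp ℂ 2 torusMeasure) :
    ∫ x, f x ∂torusMeasure = inner ℂ (UnitAddTorus.mFourierLp 2 (0 : Fin 2 → ℤ)) f := by
  rw [MeasureTheory.L2.inner_def]
  refine integral_congr_ae ?_
  have h0 : (UnitAddTorus.mFourierLp 2 (0 : Fin 2 → ℤ) : Lp ℂ 2 torusMeasure) =ᵐ[torusMeasure]
    UnitAddTorus.mFourier 0 := UnitAddTorus.coeFn_mFourierLp 2 (0 : Fin 2 → ℤ)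
  filter_upwards [h0] with x hx
  rw [hx, UnitAddTorus.mFourier_zero]
  simp

theorem isClosed_V : IsClosed (V : Set (Lp ℂ 2 torusMeasure)) := by
  have h : (V : Set (Lp ℂ 2 torusMeasure)) =
      (fun f => inner ℂ (UnitAddTorus.mFourierLp 2 (0 : Fin 2 → ℤ) : Lp ℂ 2 torusMeasure) f) ⁻¹'
        {0} := by
    ext f
    rw [Set.mem_preimage, ← integral_eq_inner_mFourierLp]
    rfl
  rw [h]
  exact isClosed_singleton.preimage (by fun_prop)

instance : CompleteSpace V := isClosed_V.completeSpace_coe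

theorem orthonormal_e : Orthonormal ℂ e := by
  have h := (UnitAddTorus.orthonormal_mFourier (d := Fin 2)).comp (fun k : Mode => k.1)
    Subtype.val_injective
  exact ⟨fun k => h.1 k, fun i j hij => h.2 hij⟩

instance : Countable Mode := inferInstance

/-- An exhaustion of the set of modes by finite sets. -/
noncomputable def modeSeq : ℕ → Finset Mode :=
  Classical.choose (exists_seq_tendsto (atTop : Filter (Finset Mode)))

theorem tendsto_modeSeq : Tendsto modeSeq atTop atTop :=
  Classical.choose_spec (exists_seq_tendsto (atTop : Filter (Finset Mode)))

/-- The sum `∑ c_k e_k`. -/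
noncomputable def vsum (c : Mode → ℂ) : V :=
  limUnder atTop fun N => ∑ k ∈ modeSeq N, c k • e k

theorem hasSum_vsum {c : Mode → ℂ} (hc : Summable fun k => ‖c k‖ ^ 2) :
    HasSum (fun k => c k • e k) (vsum c) := by
  have h := (orthonormal_e.summable_smul hc).hasSum
  have h1 : vsum c = ∑' k, c k • e k := (Tendsto.comp h tendsto_modeSeq).limUnder_eq
  rw [h1]
  exact h

/-- This is the purpose of summing along a fixed sequence of finite sets: `limUnder` of a sequence
is measurable even where the series diverges. -/
theorem stronglyMeasurable_vsum {A : Type*} [MeasurableSpace A] {c : Mode → A → ℂ}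
    (hc : ∀ k, Measurable (c k)) : StronglyMeasurable fun x => vsum fun k => c k x := by
  refine StronglyMeasurable.limUnder (l := atTop) fun N => ?_
  exact Finset.stronglyMeasurable_fun_sum _ fun k _ => ((hc k).stronglyMeasurable).smul_const _

variable {ν : ℝ} {α : Mode → ℝ}

theorem hasSum_semigroup {t : ℝ} (hν : 0 < ν) (hα : ∀ k, 0 < α k) (ht : 0 ≤ t) (f : V) :
    HasSum (fun k => ((Real.exp (-t * ν * α k) : ℂ) * inner ℂ (e k) f) • e k)
      (semigroup ν α t f) := by
  refine (orthonormal_e.summable_smul ?_).hasSum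
  refine Summable.of_nonneg_of_le (fun k => by positivity) (fun k => ?_)
    (orthonormal_e.inner_products_summable (x := f))
  rw [norm_mul, mul_pow]
  refine mul_le_of_le_one_left (by positivity) ?_
  rw [Complex.norm_real, Real.norm_of_nonneg (Real.exp_nonneg _)]
  refine pow_le_one₀ (Real.exp_nonneg _) (Real.exp_le_one_iff.2 ?_)
  have := mul_nonneg (mul_nonneg ht hν.le) (hα k).le
  linarith

theorem semigroup_sub {t : ℝ} (hν : 0 < ν) (hα : ∀ k, 0 < α k) (ht : 0 ≤ t) (f g : V) :
    semigroup ν α t (f - g) = semigroup ν α t f - semigroup ν α t g := by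
  refine (hasSum_semigroup hν hα ht (f - g)).unique ?_
  have h := (hasSum_semigroup hν hα ht f).sub (hasSum_semigroup hν hα ht g)
  have h1 : ∀ k, ((Real.exp (-t * ν * α k) : ℂ) * inner ℂ (e k) (f - g)) • e k =
      ((Real.exp (-t * ν * α k) : ℂ) * inner ℂ (e k) f) • e k -
        ((Real.exp (-t * ν * α k) : ℂ) * inner ℂ (e k) g) • e k := fun k => by
    rw [inner_sub_right, mul_sub, sub_smul]
  simpa only [h1] using h

/-- The spectral gap c of -A gives exponential contraction, on which uniqueness of the stationary
solution rests. -/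
theorem norm_semigroup_le {t c : ℝ} (hν : 0 < ν) (hc : 0 < c) (hα : ∀ k, c ≤ α k) (ht : 0 ≤ t)
    (f : V) : ‖semigroup ν α t f‖ ≤ Real.exp (-t * ν * c) * ‖f‖ := by
  have h1 := orthonormal_e.hasSum_norm_sq (hasSum_semigroup hν (fun k => hc.trans_le (hα k)) ht f)
  have h2 : ‖semigroup ν α t f‖ ^ 2 ≤ (Real.exp (-t * ν * c) * ‖f‖) ^ 2 := by
    rw [mul_pow]
    refine le_trans ?_ (mul_le_mul_of_nonneg_left (orthonormal_e.tsum_inner_products_le (x := f))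
      (by positivity))
    rw [← tsum_mul_left]
    refine hasSum_le (fun k => ?_) h1 (((orthonormal_e.inner_products_summable (x := f)).mul_left
      _).hasSum)
    rw [norm_mul, mul_pow, Complex.norm_real,
      Real.norm_of_nonneg (Real.exp_nonneg _)]
    have h3 : -t * ν * α k ≤ -t * ν * c := by
      have := mul_le_mul_of_nonneg_left (hα k) (mul_nonneg ht hν.le)
      linarith
    gcongr
  exact (pow_le_pow_iff_left₀ (norm_nonneg _) (by positivity) two_ne_zero).1 h2

theorem semigroup_eq {t : ℝ} (hν : 0 < ν) (hα : ∀ k, 0 < α k) (ht : 0 ≤ t) {f : V}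
    {c : Mode → ℂ} (hf : HasSum (fun k => c k • e k) f) :
    HasSum (fun k => ((Real.exp (-t * ν * α k) : ℝ) * c k : ℂ) • e k) (semigroup ν α t f) := by
  have h := hasSum_semigroup hν hα ht f
  simp only [orthonormal_e.inner_hasSum hf] at h
  simpa only [Complex.ofReal_exp] using h

end TheSpaceV

/-! ### Series in L²(Ω, V) -/

section L2Sums

variable {Ω : Type*} [MeasurableSpace Ω] {P : Measure Ω}

theorem HasL2Sum.congr {X X' : Mode → Ω → V} {Z : Ω → V} (h : HasL2Sum P X Z)
    (hX : ∀ k, X k =ᵐ[P] X' k) : HasL2Sum P X' Z := by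
  refine ⟨fun k => (memLp_congr_ae (hX k)).1 (h.1 k), h.2.1, h.2.2.congr fun F => ?_⟩
  refine eLpNorm_congr_ae ?_
  filter_upwards [ae_all_iff.2 hX] with ω hω
  simp only [hω]

theorem HasL2Sum.ae_unique {X : Mode → Ω → V} {Z Z' : Ω → V} (h : HasL2Sum P X Z)
    (h' : HasL2Sum P X Z') : Z =ᵐ[P] Z' := by
  have hm : ∀ F : Finset Mode, AEStronglyMeasurable (fun ω => ∑ k ∈ F, X k ω) P := fun F =>
    Finset.aestronglyMeasurable_fun_sum F fun k _ => (h.1 k).1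
  have h1 : ∀ F : Finset Mode, eLpNorm (fun ω => Z ω - Z' ω) 2 P ≤
      eLpNorm (fun ω => Z ω - ∑ k ∈ F, X k ω) 2 P + eLpNorm (fun ω => Z' ω - ∑ k ∈ F, X k ω) 2 P := by
    intro F
    refine (le_of_eq ?_).trans (eLpNorm_sub_le (h.2.1.1.sub (hm F)) (h'.2.1.1.sub (hm F))
      (by norm_num))
    congr 1
    funext ω
    simp
  have h2 := h.2.2.add h'.2.2
  rw [add_zero] at h2
  have h3 : eLpNorm (fun ω => Z ω - Z' ω) 2 P = 0 :=
    le_antisymm (ge_of_tendsto' h2 h1) zero_le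
  have h4 := (eLpNorm_eq_zero_iff (h.2.1.1.sub h'.2.1.1) (by norm_num)).1 h3
  filter_upwards [h4] with ω hω
  exact sub_eq_zero.1 hω

theorem ae_summable_of_tsum_lintegral {c : Mode → Ω → ℂ} (hc : ∀ k, AEMeasurable (c k) P)
    (hs : ∑' k, ∫⁻ ω, ‖c k ω‖ₑ ^ 2 ∂P ≠ ∞) : ∀ᵐ ω ∂P, Summable fun k => ‖c k ω‖ ^ 2 := by
  rw [← lintegral_tsum fun k => (hc k).enorm.pow_const 2] at hs
  filter_upwards [ae_lt_top' (AEMeasurable.tsum fun k => (hc k).enorm.pow_const 2) hs]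
    with ω hω
  have h1 := ENNReal.summable_toReal hω.ne
  simpa using h1

theorem eLpNorm_two_eq {W : Type*} [NormedAddCommGroup W] (f : Ω → W) :
    eLpNorm f 2 P = (∫⁻ ω, ‖f ω‖ₑ ^ 2 ∂P) ^ (1 / 2 : ℝ) := by
  rw [eLpNorm_eq_lintegral_rpow_enorm_toReal (by norm_num) (by norm_num)]
  simp

/-- By Parseval, the squared error of a partial sum is the tail of the series of second moments. -/
theorem hasL2Sum_vsum {c : Mode → Ω → ℂ} (hc : ∀ k, Measurable (c k))
    (hs : ∑' k, ∫⁻ ω, ‖c k ω‖ₑ ^ 2 ∂P ≠ ∞) :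
    HasL2Sum P (fun k ω => c k ω • e k) (fun ω => vsum fun k => c k ω) := by
  have hsm := stronglyMeasurable_vsum hc
  have hkm : ∀ k, StronglyMeasurable fun ω => c k ω • e k := fun k =>
    (hc k).stronglyMeasurable.smul_const _
  have hae := ae_summable_of_tsum_lintegral (fun k => (hc k).aemeasurable) hs
  have hnorm : ∀ F : Finset Mode, ∫⁻ ω, ‖(vsum fun k => c k ω) - ∑ k ∈ F, c k ω • e k‖ₑ ^ 2 ∂P =
      ∑' k : {k // k ∉ F}, ∫⁻ ω, ‖c k ω‖ₑ ^ 2 ∂P := by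
    intro F
    have h1 := lintegral_tsum (μ := P) (f := fun (k : {k // k ∉ F}) ω => ‖c k ω‖ₑ ^ 2)
      fun k => ((hc k.1).enorm.pow_const 2).aemeasurable
    rw [← h1]
    refine lintegral_congr_ae ?_
    filter_upwards [hae] with ω hω
    exact orthonormal_e.enorm_sub_sum_sq (hasSum_vsum hω) F
  have hfin : ∀ k, ∫⁻ ω, ‖c k ω‖ₑ ^ 2 ∂P ≠ ∞ := fun k => ENNReal.ne_top_of_tsum_ne_top hs k
  refine ⟨fun k => ⟨(hkm k).aestronglyMeasurable, ?_⟩, ⟨hsm.aestronglyMeasurable, ?_⟩, ?_⟩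
  · rw [eLpNorm_two_eq]
    refine ENNReal.rpow_lt_top_of_nonneg (by norm_num) ?_
    have h1 : ∀ ω, ‖c k ω • e k‖ₑ = ‖c k ω‖ₑ := fun ω => by
      rw [← ofReal_norm, norm_smul, orthonormal_e.1 k, mul_one, ofReal_norm]
    simp only [h1]
    exact hfin k
  · rw [eLpNorm_two_eq]
    refine ENNReal.rpow_lt_top_of_nonneg (by norm_num) ?_
    have h1 := hnorm ∅
    simp only [Finset.sum_empty, sub_zero] at h1
    rw [h1]
    exact ne_top_of_le_ne_top hs (ENNReal.tsum_comp_le_tsum_of_injective Subtype.val_injective _)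
  · simp only [eLpNorm_two_eq, hnorm]
    have h1 := (ENNReal.tendsto_tsum_compl_atTop_zero hs).ennrpow_const (1 / 2 : ℝ)
    rwa [ENNReal.zero_rpow_of_pos (by norm_num)] at h1

end L2Sums

end InertialParticle

namespace InertialParticle

open scoped NNReal ENNReal

/-! ### Existence and uniqueness of the stationary mild solution -/

section MildSolutions

variable {Ω : Type*} [MeasurableSpace Ω] {P : Measure Ω} {τ ν H : ℝ} {α lam : Mode → ℝ}
  {β : Mode → ℝ → Ω → ℂ} {a : Mode → ℝ → Ω → ℂ}

theorem IsOUFamily.tsum_lintegral_ne_top (ha : IsOUFamily P ν H α lam β a)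
    (hA : Assumptions τ ν H α lam) (hs : Summable fun k => lam k * α k ^ (-(2 * H))) (t : ℝ) :
    ∑' k, ∫⁻ ω, ‖a k t ω‖ₑ ^ 2 ∂P ≠ ∞ := by
  have h0 : ∀ k, 0 ≤ lam k * α k ^ (-(2 * H)) := fun k =>
    mul_nonneg (hA.lam_nonneg k) (Real.rpow_nonneg (hA.alpha_pos k).le _)
  have hC := ouConst_pos hA.hurst_pos
  have h1 : ∀ k, ∫⁻ ω, ‖a k t ω‖ₑ ^ 2 ∂P ≤ 2 ^ (2 * 1 + 1) * momentConst 1 *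
      ENNReal.ofReal (4 * ouConst H * (lam k * α k ^ (-(2 * H)))) := by
    intro k
    have h2 := (ha.subG {k} (by simpa using negMode_ne k) (fun _ => 1) t
      (4 * ouConst H * (lam k * α k ^ (-(2 * H)))).toNNReal ?_).lintegral_pow_le one_ne_zero
    · rw [ENNReal.ofReal]
      simpa using h2
    · rw [Finset.sum_singleton, Real.coe_toNNReal _ (mul_nonneg (by positivity) (h0 k))]
      simp only [norm_one]
      exact le_of_eq (by ring)
  refine ne_top_of_le_ne_top ?_ (ENNReal.tsum_le_tsum h1)
  rw [ENNReal.tsum_mul_left]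
  exact ENNReal.mul_ne_top (ENNReal.mul_ne_top (by simp) ENNReal.coe_ne_top)
    (hs.mul_left _).tsum_ofReal_ne_top

/-- The stationary solution. -/
noncomputable def statSol (a : Mode → ℝ → Ω → ℂ) (t : ℝ) (ω : Ω) : V := vsum fun k => a k t ω

theorem IsOUFamily.ae_hasSum_statSol (ha : IsOUFamily P ν H α lam β a)
    (hA : Assumptions τ ν H α lam) (hs : Summable fun k => lam k * α k ^ (-(2 * H))) (t : ℝ) :
    ∀ᵐ ω ∂P, HasSum (fun k => a k t ω • e k) (statSol a t ω) := by
  filter_upwards [ae_summable_of_tsum_lintegral (fun k => (ha.measurable k t).aemeasurable)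
    (ha.tsum_lintegral_ne_top hA hs t)] with ω hω
  exact hasSum_vsum hω

theorem IsOUFamily.hasL2Sum_statSol (ha : IsOUFamily P ν H α lam β a)
    (hA : Assumptions τ ν H α lam) (hs : Summable fun k => lam k * α k ^ (-(2 * H))) (t : ℝ) :
    HasL2Sum P (fun k ω => statCoeff ν H α lam β t k ω • e k) (statSol a t) := by
  refine (hasL2Sum_vsum (fun k => ha.measurable k t)
    (ha.tsum_lintegral_ne_top hA hs t)).congr fun k => ?_
  filter_upwards [ha.stat] with ω hω
  rw [hω]

/-- The stochastic convolution is recovered as the series with coefficients a_k(t) - e^{-(t-s)να_k}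
a_k(s), whose second moments are summable because those of both terms are. -/
theorem IsOUFamily.isMildSolution (ha : IsOUFamily P ν H α lam β a)
    (hA : Assumptions τ ν H α lam) (hs : Summable fun k => lam k * α k ^ (-(2 * H))) :
    IsMildSolution P ν H α lam β (statSol a) := by
  refine ⟨?_, fun s t hst => ?_⟩
  · refine (stronglyMeasurable_vsum (c := fun k (p : ℝ × Ω) => a k p.1 p.2) fun k => ?_).measurable
    exact measurable_uncurry_of_continuous_of_measurable (u := a k) (ha.continuous k)
      (ha.measurable k)
  · let d : Mode → Ω → ℂ := fun k ω => a k t ω - Real.exp (-(t - s) * ν * α k) * a k s ω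
    have hd : ∀ k, Measurable (d k) := fun k =>
      (ha.measurable k t).sub ((ha.measurable k s).const_mul _)
    have hd2 : ∑' k, ∫⁻ ω, ‖d k ω‖ₑ ^ 2 ∂P ≠ ∞ := by
      have h1 : ∀ k, ∫⁻ ω, ‖d k ω‖ₑ ^ 2 ∂P ≤
          2 * (∫⁻ ω, ‖a k t ω‖ₑ ^ 2 ∂P + ∫⁻ ω, ‖a k s ω‖ₑ ^ 2 ∂P) := by
        intro k
        have hm : Measurable fun ω => ‖a k t ω‖ₑ ^ 2 + ‖a k s ω‖ₑ ^ 2 :=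
          ((ha.measurable k t).enorm.pow_const 2).add ((ha.measurable k s).enorm.pow_const 2)
        rw [← lintegral_add_left ((ha.measurable k t).enorm.pow_const 2),
          ← lintegral_const_mul _ hm]
        refine lintegral_mono fun ω => ?_
        simp only [← ofReal_norm]
        rw [← ENNReal.ofReal_pow (norm_nonneg _), ← ENNReal.ofReal_pow (norm_nonneg _),
          ← ENNReal.ofReal_pow (norm_nonneg _), ← ENNReal.ofReal_add (by positivity) (by positivity),
          ← ENNReal.ofReal_ofNat 2, ← ENNReal.ofReal_mul (by norm_num)]
        refine ENNReal.ofReal_le_ofReal ?_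
        have h2 : ‖d k ω‖ ≤ ‖a k t ω‖ + ‖a k s ω‖ := by
          refine (norm_sub_le _ _).trans ?_
          gcongr
          rw [norm_mul, Complex.norm_real, Real.norm_of_nonneg (Real.exp_nonneg _)]
          refine mul_le_of_le_one_left (norm_nonneg _) (Real.exp_le_one_iff.2 ?_)
          have := mul_nonneg (mul_nonneg (sub_nonneg.2 hst) hA.nu_pos.le) (hA.alpha_pos k).le
          linarith
        calc ‖d k ω‖ ^ 2 ≤ (‖a k t ω‖ + ‖a k s ω‖) ^ 2 := by gcongr
          _ ≤ _ := by nlinarith [sq_nonneg (‖a k t ω‖ - ‖a k s ω‖)]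
      refine ne_top_of_le_ne_top ?_ (ENNReal.tsum_le_tsum h1)
      rw [ENNReal.tsum_mul_left, ENNReal.tsum_add]
      exact ENNReal.mul_ne_top (by simp) (ENNReal.add_ne_top.2
        ⟨ha.tsum_lintegral_ne_top hA hs t, ha.tsum_lintegral_ne_top hA hs s⟩)
    refine ⟨fun ω => vsum fun k => d k ω, (hasL2Sum_vsum hd hd2).congr fun k => ?_, ?_⟩
    · filter_upwards [ha.mild] with ω hω
      simp only [d]
      rw [hω k s t hst, add_sub_cancel_left]
    · filter_upwards [ha.ae_hasSum_statSol hA hs s, ha.ae_hasSum_statSol hA hs t,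
        ae_summable_of_tsum_lintegral (fun k => (hd k).aemeasurable) hd2] with ω h1 h2 h3
      have h4 := (semigroup_eq hA.nu_pos hA.alpha_pos (sub_nonneg.2 hst) h1).add (hasSum_vsum h3)
      refine h2.unique ?_
      have h5 : ∀ k, ((Real.exp (-(t - s) * ν * α k) : ℝ) * a k s ω : ℂ) • e k + d k ω • e k =
          a k t ω • e k := fun k => by
        rw [← add_smul]
        simp only [d]
        rw [add_sub_cancel]
      simpa only [h5] using h4

/-- The values at finitely many times are one measurable function of the coefficient paths, whose
joint law is shift invariant. -/
theorem IsOUFamily.isStrictlyStationary (ha : IsOUFamily P ν H α lam β a) :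
    IsStrictlyStationary P (statSol a) := by
  intro n t r
  have hm : Measurable fun (g : Mode → ℝ → ℂ) (i : Fin n) => vsum fun k => g k (t i) :=
    measurable_pi_lambda _ fun i => (stronglyMeasurable_vsum
      (c := fun k (g : Mode → ℝ → ℂ) => g k (t i)) fun k =>
        (measurable_pi_apply (t i)).comp (measurable_pi_apply k)).measurable
  have h1 := congrArg (Measure.map fun (g : Mode → ℝ → ℂ) (i : Fin n) =>
    vsum fun k => g k (t i)) (ha.map_add r)
  rwa [Measure.map_map hm (measurable_pi_lambda _ fun k => measurable_pi_lambda _ fun t =>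
    ha.measurable k _), Measure.map_map hm (measurable_pi_lambda _ fun k =>
    measurable_pi_lambda _ fun t => ha.measurable k _)] at h1

theorem IsStrictlyStationary.measure_norm_gt {ψ : ℝ → Ω → V} (h : IsStrictlyStationary P ψ)
    (hm : ∀ t, Measurable (ψ t)) (t R : ℝ) : P {ω | R < ‖ψ t ω‖} = P {ω | R < ‖ψ 0 ω‖} := by
  have h1 := h 1 (fun _ => 0) t
  have hms : MeasurableSet {f : Fin 1 → V | R < ‖f 0‖} :=
    measurableSet_lt measurable_const (continuous_norm.measurable.comp (measurable_pi_apply 0))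
  have h2 := congrArg (fun μ => μ {f : Fin 1 → V | R < ‖f 0‖}) h1
  rw [Measure.map_apply (measurable_pi_lambda _ fun i => hm _) hms,
    Measure.map_apply (measurable_pi_lambda _ fun i => hm _) hms] at h2
  simpa using h2

theorem tendsto_measure_norm_gt [IsFiniteMeasure P] {f : Ω → V} (hf : Measurable f) :
    Tendsto (fun n : ℕ => P {ω | (n : ℝ) < ‖f ω‖}) atTop (𝓝 0) := by
  have hms : ∀ n : ℕ, MeasurableSet {ω | (n : ℝ) < ‖f ω‖} := fun n =>
    measurableSet_lt measurable_const (continuous_norm.measurable.comp hf)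
  have h1 := tendsto_measure_iInter_atTop (μ := P) (s := fun n : ℕ => {ω | (n : ℝ) < ‖f ω‖})
    (fun n => (hms n).nullMeasurableSet)
    (fun m n hmn ω (hω : (n : ℝ) < ‖f ω‖) =>
      lt_of_le_of_lt (Nat.cast_le.2 hmn : (m : ℝ) ≤ n) hω) ⟨0, measure_ne_top _ _⟩
  have h2 : ⋂ n : ℕ, {ω | (n : ℝ) < ‖f ω‖} = ∅ := by
    refine Set.eq_empty_of_forall_notMem fun ω hω => ?_
    obtain ⟨n, hn⟩ := exists_nat_ge ‖f ω‖
    exact absurd (Set.mem_iInter.1 hω n) (not_lt.2 hn)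
  rwa [h2, measure_empty] at h1

/-- Stationary mild solutions are unique up to modification. -/
theorem IsMildSolution.ae_eq [IsFiniteMeasure P] (hA : Assumptions τ ν H α lam)
    {ψ φ : ℝ → Ω → V} (hψ : IsMildSolution P ν H α lam β ψ) (hψs : IsStrictlyStationary P ψ)
    (hφ : IsMildSolution P ν H α lam β φ) (hφs : IsStrictlyStationary P φ) (t : ℝ) :
    ψ t =ᵐ[P] φ t := by
  obtain ⟨c, hc, hαc⟩ := hA.alpha_lower
  have hν := hA.nu_pos
  have mψ : ∀ t, Measurable (ψ t) := fun t => hψ.1.comp measurable_prodMk_left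
  have mφ : ∀ t, Measurable (φ t) := fun t => hφ.1.comp measurable_prodMk_left
  -- The noise terms cancel, so the difference of two solutions evolves by the semigroup alone.
  have hcontr : ∀ s ≤ t, ∀ᵐ ω ∂P,
      ‖ψ t ω - φ t ω‖ ≤ Real.exp (-(t - s) * ν * c) * ‖ψ s ω - φ s ω‖ := by
    intro s hst
    obtain ⟨Z, hZ, h1⟩ := hψ.2 s t hst
    obtain ⟨Z', hZ', h2⟩ := hφ.2 s t hst
    filter_upwards [h1, h2, hZ.ae_unique hZ'] with ω h1 h2 h3
    rw [h1, h2, h3, add_sub_add_right_eq_sub,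
      ← semigroup_sub hν hA.alpha_pos (sub_nonneg.2 hst)]
    exact norm_semigroup_le hν hc hαc (sub_nonneg.2 hst) _
  have key : ∀ ε > 0, P {ω | ε < ‖ψ t ω - φ t ω‖} = 0 := by
    intro ε hε
    have hb : ∀ n : ℕ, P {ω | ε < ‖ψ t ω - φ t ω‖} ≤
        P {ω | (n : ℝ) < ‖ψ 0 ω‖} + P {ω | (n : ℝ) < ‖φ 0 ω‖} := by
      intro n
      have h0 : Tendsto (fun r : ℝ => Real.exp (-r) * (2 * n)) atTop (𝓝 0) := by
        simpa using Real.tendsto_exp_neg_atTop_nhds_zero.mul_const (2 * (n : ℝ))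
      -- The starting time s lies so far back that 2n contracts below ε. A difference above ε at
      -- time t then forces one solution to exceed n at time s, an event whose probability does not
      -- depend on s.
      obtain ⟨r, hr, hr0⟩ := ((h0.eventually (gt_mem_nhds hε)).and (eventually_ge_atTop 0)).exists
      let s := t - r / (ν * c)
      have hνc : 0 < ν * c := mul_pos hν hc
      have hst : s ≤ t := sub_le_self _ (by positivity)
      rw [← hψs.measure_norm_gt mψ s n, ← hφs.measure_norm_gt mφ s n]
      refine (measure_mono_ae ?_).trans (measure_union_le _ _)
      filter_upwards [hcontr s hst] with ω hω hω2
      have h3 : -(t - s) * ν * c = -r := by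
        simp only [s]
        field_simp
        ring
      rw [h3] at hω
      by_contra hcon
      have h4 : ‖ψ s ω‖ ≤ n ∧ ‖φ s ω‖ ≤ n := by
        constructor
        · by_contra h; exact hcon (Or.inl (not_le.1 h))
        · by_contra h; exact hcon (Or.inr (not_le.1 h))
      have h5 : ‖ψ s ω - φ s ω‖ ≤ 2 * n := (norm_sub_le _ _).trans (by linarith [h4.1, h4.2])
      have h6 : ε < ‖ψ t ω - φ t ω‖ := hω2
      have h7 := mul_le_mul_of_nonneg_left h5 (Real.exp_nonneg (-r))
      linarith
    have h1 := (tendsto_measure_norm_gt (P := P) (mψ 0)).add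
      (tendsto_measure_norm_gt (P := P) (mφ 0))
    rw [add_zero] at h1
    exact le_antisymm (ge_of_tendsto' h1 hb) zero_le
  have h1 : ∀ᵐ ω ∂P, ∀ n : ℕ, ‖ψ t ω - φ t ω‖ ≤ 1 / ((n : ℝ) + 1) := by
    refine ae_all_iff.2 fun n => ?_
    rw [ae_iff]
    simpa only [not_le] using key (1 / ((n : ℝ) + 1)) (by positivity)
  filter_upwards [h1] with ω hω
  have h2 : ‖ψ t ω - φ t ω‖ ≤ 0 := ge_of_tendsto' tendsto_one_div_add_atTop_nhds_zero_nat hω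
  exact sub_eq_zero.1 (norm_le_zero_iff.1 h2)

end MildSolutions

end InertialParticle

namespace InertialParticle

/-! ### Series of Cⁿ families -/

section Series

variable {E F : Type*} [NormedAddCommGroup E] [NormedSpace ℝ E] [NormedAddCommGroup F]
  [NormedSpace ℝ F] [CompleteSpace F]

/-- The Weierstrass test for all derivatives, with bounds that may depend on the unit time interval.
-/
theorem JointCn.tsum {m : ℕ} {f : ℕ → ℝ → E → F} (hf : ∀ N, JointCn m (f N))
    (hb : ∀ i ≤ m, ∀ j : ℤ, ∃ u : ℕ → ℝ, Summable u ∧ ∀ N, ∀ t ∈ Set.Icc (j : ℝ) (j + 1), ∀ v,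
      ‖iteratedFDeriv ℝ i (f N t) v‖ ≤ u N) : JointCn m fun t v => ∑' N, f N t v := by
  choose! u hu hub using hb
  have hj : ∀ t : ℝ, t ∈ Set.Icc ((⌊t⌋ : ℤ) : ℝ) (⌊t⌋ + 1) := fun t =>
    ⟨Int.floor_le t, (Int.lt_floor_add_one t).le⟩
  have hcd : ∀ t N, ContDiff ℝ ((m : ℕ∞) : WithTop ℕ∞) (f N t) := fun t N => (hf N).1 t
  have hv : ∀ t : ℝ, ∀ i : ℕ, (i : ℕ∞) ≤ (m : ℕ∞) → Summable (u i ⌊t⌋) := fun t i hi =>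
    hu i (by exact_mod_cast hi) _
  have hfd : ∀ t : ℝ, ∀ (i N : ℕ) (v : E), (i : ℕ∞) ≤ (m : ℕ∞) →
      ‖iteratedFDeriv ℝ i (f N t) v‖ ≤ u i ⌊t⌋ N := fun t i N v hi =>
    hub i (by exact_mod_cast hi) _ N t (hj t) v
  refine ⟨fun t => contDiff_tsum (hcd t) (hv t) (hfd t), fun i hi => ?_⟩
  have h1 : (fun p : ℝ × E => iteratedFDeriv ℝ i (fun v => ∑' N, f N p.1 v) p.2) =
      fun p => ∑' N, iteratedFDeriv ℝ i (f N p.1) p.2 := by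
    funext p
    exact iteratedFDeriv_tsum_apply (hcd p.1) (hv p.1) (hfd p.1) (by exact_mod_cast hi) p.2
  rw [h1]
  refine continuous_iff_continuousAt.2 fun p => ?_
  have hc : ContinuousOn (fun p : ℝ × E => ∑' N, iteratedFDeriv ℝ i (f N p.1) p.2)
      (Set.Ioo ((⌊p.1⌋ : ℝ) - 1) (⌊p.1⌋ + 1) ×ˢ Set.univ) := by
    -- Times near p.1 may fall into the preceding unit interval, so the bounds for both intervals
    -- are added.
    refine continuousOn_tsum (u := fun N => |u i (⌊p.1⌋ - 1) N| + |u i ⌊p.1⌋ N|)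
      (fun N => ((hf N).2 i hi).continuousOn) ((hu i hi _).abs.add (hu i hi _).abs) ?_
    rintro N ⟨t, v⟩ ⟨ht, -⟩
    rcases le_total t ⌊p.1⌋ with h | h
    · have := hub i hi (⌊p.1⌋ - 1) N t ⟨by push_cast; exact ht.1.le, by push_cast; linarith⟩ v
      exact this.trans ((le_abs_self _).trans (le_add_of_nonneg_right (abs_nonneg _)))
    · have := hub i hi ⌊p.1⌋ N t ⟨h, ht.2.le⟩ v
      exact this.trans ((le_abs_self _).trans (le_add_of_nonneg_left (abs_nonneg _)))
  refine hc.continuousAt (prod_mem_nhds (Ioo_mem_nhds ?_ ?_) univ_mem)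
  · linarith [Int.floor_le p.1]
  · exact Int.lt_floor_add_one p.1

end Series

/-! ### Plane waves and trigonometric polynomials -/

section PlaneWaves

/-- The linear form `v ↦ i ⟨k, v⟩`. -/
noncomputable def waveLin (k : Mode) : Plane →L[ℝ] ℂ :=
  ∑ l, (ContinuousLinearMap.proj l : Plane →L[ℝ] ℝ).smulRight
    (2 * (Real.pi : ℂ) * Complex.I * (k.1 l : ℂ))

theorem waveLin_apply (k : Mode) (v : Plane) :
    waveLin k v = ((2 * Real.pi * (k.1 0 * v 0 + k.1 1 * v 1) : ℝ) : ℂ) * Complex.I := by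
  simp only [waveLin, Fin.sum_univ_two]
  change v 0 • (2 * (Real.pi : ℂ) * Complex.I * (k.1 0 : ℂ)) +
    v 1 • (2 * (Real.pi : ℂ) * Complex.I * (k.1 1 : ℂ)) = _
  simp only [Complex.real_smul]
  push_cast
  ring

/-- The function `v ↦ exp (i ⟨k, v⟩)`. -/
noncomputable def planeWave (k : Mode) (v : Plane) : ℂ := Complex.exp (waveLin k v)

theorem norm_planeWave (k : Mode) (v : Plane) : ‖planeWave k v‖ = 1 := by
  rw [planeWave, waveLin_apply, Complex.norm_exp_ofReal_mul_I]

theorem mFourier_proj (k : Mode) (v : Plane) :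
    UnitAddTorus.mFourier k.1 (proj v) = planeWave k v := by
  have h : UnitAddTorus.mFourier k.1 (proj v) = ∏ i, fourier (k.1 i) ((v i : ℝ) : UnitAddCircle) :=
    rfl
  rw [h, Fin.prod_univ_two, fourier_coe_apply, fourier_coe_apply, ← Complex.exp_add, planeWave,
    waveLin_apply]
  congr 1
  push_cast
  ring

theorem planeWave_add_latticeVec (k : Mode) (v : Plane) (n : Fin 2 → ℤ) :
    planeWave k (v + latticeVec n) = planeWave k v := by
  rw [← mFourier_proj, ← mFourier_proj, proj_add_latticeVec]

theorem waveNorm_nonneg (k : Mode) : 0 ≤ waveNorm k := by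
  unfold waveNorm
  positivity

theorem abs_le_waveNorm (k : Mode) (l : Fin 2) : 2 * Real.pi * |(k.1 l : ℝ)| ≤ waveNorm k := by
  unfold waveNorm
  refine mul_le_mul_of_nonneg_left (Real.abs_le_sqrt ?_) (by positivity)
  fin_cases l
  · exact le_add_of_nonneg_right (sq_nonneg _)
  · exact le_add_of_nonneg_left (sq_nonneg _)

theorem one_le_waveNorm (k : Mode) : 1 ≤ waveNorm k := by
  have h0 : ∃ l, k.1 l ≠ 0 := by
    by_contra! h
    exact k.2 (funext h)
  obtain ⟨l, hl⟩ := h0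
  have h1 : (1 : ℝ) ≤ |(k.1 l : ℝ)| := by exact_mod_cast Int.one_le_abs hl
  have h2 := Real.pi_gt_three
  nlinarith [abs_le_waveNorm k l]

theorem norm_waveLin_single_le (k : Mode) (l : Fin 2) :
    ‖waveLin k (Pi.single l 1)‖ ≤ waveNorm k := by
  refine le_trans (le_of_eq ?_) (abs_le_waveNorm k l)
  rw [waveLin_apply, norm_mul, Complex.norm_I, mul_one, Complex.norm_real, Real.norm_eq_abs,
    abs_mul, abs_of_pos Real.two_pi_pos]
  congr 2
  fin_cases l <;> simp

theorem norm_planeWave_sub_le (k : Mode) (v w : Plane) :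
    ‖planeWave k v - planeWave k w‖ ≤ 2 * waveNorm k * ‖v - w‖ := by
  have h1 : planeWave k v - planeWave k w =
      planeWave k w * (Complex.exp (waveLin k (v - w)) - 1) := by
    rw [planeWave, planeWave, map_sub, Complex.exp_sub]
    field_simp [Complex.exp_ne_zero]
  rw [h1, norm_mul, norm_planeWave, one_mul, waveLin_apply, mul_comm _ Complex.I]
  refine (Real.norm_exp_I_mul_ofReal_sub_one_le).trans ?_
  rw [Real.norm_eq_abs, abs_mul, abs_of_pos Real.two_pi_pos]
  have h2 : ∀ l, |(v - w) l| ≤ ‖v - w‖ := fun l => norm_le_pi_norm (v - w) l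
  have h3 : |(k.1 0 : ℝ) * (v - w) 0 + k.1 1 * (v - w) 1| ≤
      |(k.1 0 : ℝ)| * ‖v - w‖ + |(k.1 1 : ℝ)| * ‖v - w‖ := by
    refine (abs_add_le _ _).trans ?_
    rw [abs_mul, abs_mul]
    gcongr <;> exact h2 _
  have h4 := mul_le_mul_of_nonneg_right (abs_le_waveNorm k 0) (norm_nonneg (v - w))
  have h5 := mul_le_mul_of_nonneg_right (abs_le_waveNorm k 1) (norm_nonneg (v - w))
  have h6 := mul_le_mul_of_nonneg_left h3 Real.two_pi_pos.le
  linarith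

/-- Interpolation between the Lipschitz bound and the trivial bound 2; the extra power of |k| in the
second series of the hypotheses comes from here. -/
theorem norm_planeWave_sub_le_rpow {γ : ℝ} (hγ : 0 < γ) (hγ1 : γ < 1) (k : Mode) (v w : Plane) :
    ‖planeWave k v - planeWave k w‖ ≤ 4 * (waveNorm k ^ γ * ‖v - w‖ ^ γ) := by
  set z := 2 * waveNorm k * ‖v - w‖ with hz
  have hk := waveNorm_nonneg k
  have hz0 : 0 ≤ z := by positivity
  have h1 : ‖planeWave k v - planeWave k w‖ ≤ 2 * z ^ γ := by
    rcases le_total z 1 with h | h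
    · have h2 : z ≤ z ^ γ := Real.self_le_rpow_of_le_one hz0 h hγ1.le
      linarith [norm_planeWave_sub_le k v w]
    · have h2 : 1 ≤ z ^ γ := Real.one_le_rpow h hγ.le
      have h3 := norm_sub_le (planeWave k v) (planeWave k w)
      rw [norm_planeWave, norm_planeWave] at h3
      linarith
  refine h1.trans ?_
  rw [hz, mul_assoc, Real.mul_rpow (by norm_num) (by positivity), Real.mul_rpow hk (norm_nonneg _)]
  have h4 : (2 : ℝ) ^ γ ≤ 2 := by
    simpa using Real.rpow_le_rpow_of_exponent_le (by norm_num : (1 : ℝ) ≤ 2) hγ1.le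
  have h5 : 0 ≤ waveNorm k ^ γ * ‖v - w‖ ^ γ := by positivity
  nlinarith

/-- The multilinear form `m ↦ ∏ i ⟨k, m_j⟩`. -/
noncomputable def waveForm (k : Mode) (i : ℕ) : Plane [×i]→L[ℝ] ℂ :=
  (ContinuousMultilinearMap.mkPiAlgebraFin ℝ i ℂ).compContinuousLinearMap fun _ => waveLin k

theorem waveForm_apply (k : Mode) (i : ℕ) (m : Fin i → Plane) :
    waveForm k i m = ∏ j, waveLin k (m j) := by
  simp [waveForm, List.prod_ofFn]

theorem contDiff_planeWave (k : Mode) {n : WithTop ℕ∞} : ContDiff ℝ n (planeWave k) :=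
  (waveLin k).contDiff.cexp

theorem continuous_planeWave (k : Mode) : Continuous (planeWave k) :=
  (contDiff_planeWave k (n := 0)).continuous

theorem iteratedFDeriv_planeWave (k : Mode) (i : ℕ) :
    iteratedFDeriv ℝ i (planeWave k) = fun v => planeWave k v • waveForm k i := by
  induction i with
  | zero =>
    funext v
    ext m
    simp [waveForm_apply]
  | succ i ih =>
    funext v
    ext m
    rw [iteratedFDeriv_succ_apply_left, ih]
    have h1 : HasFDerivAt (planeWave k) (planeWave k v • waveLin k) v :=
      (waveLin k).hasFDerivAt.cexp
    rw [(h1.smul_const (waveForm k i)).fderiv]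
    simp only [ContinuousLinearMap.smulRight_apply, smul_apply,
      smul_apply, waveForm_apply, smul_eq_mul, Fin.prod_univ_succ, Fin.tail]
    ring

/-- The real trigonometric polynomial `2 Re ∑ b_k exp (i ⟨k, v⟩)`. -/
noncomputable def waveSum (F : Finset Mode) (b : Mode → ℂ) (v : Plane) : ℝ :=
  2 * (∑ k ∈ F, b k * planeWave k v).re

theorem waveSum_eq_comp (F : Finset Mode) (b : Mode → ℂ) :
    waveSum F b = ((2 : ℝ) • Complex.reCLM) ∘ fun v => ∑ k ∈ F, b k • planeWave k v := by
  funext v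
  simp [waveSum]

theorem contDiff_waveSum (F : Finset Mode) (b : Mode → ℂ) {n : WithTop ℕ∞} :
    ContDiff ℝ n (waveSum F b) := by
  rw [waveSum_eq_comp]
  exact ((2 : ℝ) • Complex.reCLM).contDiff.comp
    (ContDiff.sum fun k _ => (contDiff_planeWave k).const_smul (b k))

theorem iteratedFDeriv_waveSum (F : Finset Mode) (b : Mode → ℂ) (i : ℕ) (v : Plane) :
    iteratedFDeriv ℝ i (waveSum F b) v = ((2 : ℝ) • Complex.reCLM).compContinuousMultilinearMap
      (∑ k ∈ F, (b k * planeWave k v) • waveForm k i) := by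
  have hk : ∀ k ∈ F, ContDiff ℝ i fun v => b k • planeWave k v := fun k _ =>
    (contDiff_planeWave k).const_smul (b k)
  rw [waveSum_eq_comp, ContinuousLinearMap.iteratedFDeriv_comp_left _
    (ContDiff.sum hk).contDiffAt le_rfl, iteratedFDeriv_fun_sum_apply fun k h => (hk k h).contDiffAt]
  congr 1
  refine Finset.sum_congr rfl fun k _ => ?_
  rw [iteratedFDeriv_const_smul_apply' (contDiff_planeWave k).contDiffAt,
    iteratedFDeriv_planeWave, smul_smul]

theorem jointCn_waveSum (F : Finset Mode) {b : ℝ → Mode → ℂ} (hb : ∀ k, Continuous fun t => b t k)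
    (m : ℕ) : JointCn m fun t v => waveSum F (b t) v := by
  refine ⟨fun t => contDiff_waveSum F _, fun i _ => ?_⟩
  have h : (fun p : ℝ × Plane => iteratedFDeriv ℝ i (waveSum F (b p.1)) p.2) = fun p =>
      ContinuousLinearMap.compContinuousMultilinearMapL ℝ (fun _ : Fin i => Plane) ℂ ℝ
        ((2 : ℝ) • Complex.reCLM) (∑ k ∈ F, (b p.1 k * planeWave k p.2) • waveForm k i) := by
    funext p
    exact iteratedFDeriv_waveSum F _ i p.2
  change Continuous fun p : ℝ × Plane => iteratedFDeriv ℝ i (waveSum F (b p.1)) p.2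
  rw [h]
  refine ContinuousLinearMap.continuous _ |>.comp ?_
  refine continuous_finsetSum _ fun k _ => ?_
  exact (((hb k).comp continuous_fst).mul ((continuous_planeWave k).comp continuous_snd)).smul
    continuous_const

/-- Reduces the operator norm of a derivative to scalar partial derivatives, for which moment bounds
are available. -/
theorem norm_le_sum_norm_single {G : Type*} [NormedAddCommGroup G] [NormedSpace ℝ G] {i : ℕ}
    (T : Plane [×i]→L[ℝ] G) :
    ‖T‖ ≤ ∑ c : Fin i → Fin 2, ‖T fun j => Pi.single (c j) 1‖ := by
  refine T.opNorm_le_bound (Finset.sum_nonneg fun _ _ => norm_nonneg _) fun m => ?_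
  have h1 : m = fun j => ∑ l, m j l • (Pi.single l 1 : Plane) := by
    funext j
    exact pi_eq_sum_univ' (m j)
  conv_lhs => rw [h1]
  rw [ContinuousMultilinearMap.map_sum, Finset.sum_mul]
  refine (norm_sum_le _ _).trans (Finset.sum_le_sum fun c _ => ?_)
  rw [ContinuousMultilinearMap.map_smul_univ, norm_smul, mul_comm, norm_prod]
  refine mul_le_mul_of_nonneg_left ?_ (norm_nonneg _)
  exact Finset.prod_le_prod (fun _ _ => norm_nonneg _) fun j _ => norm_le_pi_norm (m j) _

/-- The symbol of the partial derivative with indices `c`. -/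
noncomputable def waveCoeff {i : ℕ} (c : Fin i → Fin 2) (k : Mode) : ℂ :=
  ∏ j, waveLin k (Pi.single (c j) 1)

theorem norm_waveCoeff_le {i m : ℕ} (hi : i ≤ m) (c : Fin i → Fin 2) (k : Mode) :
    ‖waveCoeff c k‖ ≤ waveNorm k ^ m := by
  rw [waveCoeff, norm_prod]
  refine (Finset.prod_le_prod (fun _ _ => norm_nonneg _)
    fun j _ => norm_waveLin_single_le k (c j)).trans ?_
  rw [Finset.prod_const, Finset.card_univ, Fintype.card_fin]
  exact pow_le_pow_right₀ (one_le_waveNorm k) hi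

theorem norm_iteratedFDeriv_waveSum_le (F : Finset Mode) (b : Mode → ℂ) (i : ℕ) (v : Plane) :
    ‖iteratedFDeriv ℝ i (waveSum F b) v‖ ≤
      ∑ c : Fin i → Fin 2, 2 * ‖∑ k ∈ F, waveCoeff c k * planeWave k v * b k‖ := by
  refine (norm_le_sum_norm_single _).trans (Finset.sum_le_sum fun c _ => ?_)
  rw [iteratedFDeriv_waveSum]
  have h : (∑ k ∈ F, (b k * planeWave k v) • waveForm k i) (fun j => Pi.single (c j) 1) =
      ∑ k ∈ F, waveCoeff c k * planeWave k v * b k := by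
    rw [sum_apply]
    refine Finset.sum_congr rfl fun k _ => ?_
    rw [smul_apply, waveForm_apply, smul_eq_mul, waveCoeff]
    ring
  rw [ContinuousLinearMap.compContinuousMultilinearMap_coe, Function.comp_apply, h]
  simp only [smul_apply, Complex.reCLM_apply, smul_eq_mul, norm_mul,
    Real.norm_ofNat]
  gcongr
  exact Complex.abs_re_le_norm _

end PlaneWaves

end InertialParticle

namespace InertialParticle

open scoped NNReal ENNReal

/-! ### Moment bounds for blocks of modes -/

section FieldBounds

variable {Ω : Type*} [MeasurableSpace Ω] {P : Measure Ω} {τ ν H γ : ℝ} {α lam : Mode → ℝ}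
  {β : Mode → ℝ → Ω → ℂ} {a : Mode → ℝ → Ω → ℂ} {m : ℕ}

/-- Without independence, the square roots of the parameters add. -/
theorem SubG.add {Z Z' : Ω → ℂ} {c : ℝ≥0} (h : SubG Z c P) (h' : SubG Z' c P) :
    SubG (fun ω => Z ω + Z' ω) (4 * c) P := by
  have h4 : (NNReal.sqrt c + NNReal.sqrt c) ^ 2 = 4 * c := by
    rw [← two_mul, mul_pow, NNReal.sq_sqrt]
    norm_num
  refine ⟨?_, ?_⟩
  · have := h.1.add h'.1
    rw [h4] at this
    exact this
  · have := h.2.add h'.2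
    rw [h4] at this
    exact this

/-- The weight of a mode that controls the `Cᵐ` norm of the random field. -/
noncomputable def modeWeight (α lam : Mode → ℝ) (H γ : ℝ) (m : ℕ) (k : Mode) : ℝ :=
  lam k * α k ^ (2 * γ - 2 * H) * waveNorm k ^ (2 * (m : ℝ)) +
    lam k * α k ^ (-(2 * H)) * waveNorm k ^ (2 * (m : ℝ) + 2 * γ)

/-- The variance constant of the random field. -/
noncomputable def fieldConst (ν H γ : ℝ) : ℝ≥0 := (64 * ouConst H * (1 + ν ^ (2 * γ))).toNNReal

theorem coe_fieldConst (hν : 0 < ν) (hH : 0 < H) :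
    (fieldConst ν H γ : ℝ) = 64 * ouConst H * (1 + ν ^ (2 * γ)) := by
  have := ouConst_pos hH
  exact Real.coe_toNNReal _ (by positivity)

theorem waveNorm_rpow_two_mul (k : Mode) :
    waveNorm k ^ (2 * (m : ℝ)) = (waveNorm k ^ m) ^ 2 := by
  rw [← pow_mul, ← Real.rpow_natCast]
  congr 1
  push_cast
  ring

theorem modeWeight_left_le (hA : Assumptions τ ν H α lam) (k : Mode) :
    lam k * α k ^ (2 * γ - 2 * H) * (waveNorm k ^ m) ^ 2 ≤ modeWeight α lam H γ m k := by
  rw [modeWeight, waveNorm_rpow_two_mul]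
  refine le_add_of_nonneg_right ?_
  have := hA.lam_nonneg k
  have := hA.alpha_pos k
  have := waveNorm_nonneg k
  positivity

theorem modeWeight_right_le (hA : Assumptions τ ν H α lam) (k : Mode) :
    lam k * α k ^ (-(2 * H)) * ((waveNorm k ^ m) ^ 2 * (waveNorm k ^ γ) ^ 2) ≤
      modeWeight α lam H γ m k := by
  have h1 := hA.lam_nonneg k
  have h2 := hA.alpha_pos k
  have h3 := waveNorm_nonneg k
  have h4 : 0 < waveNorm k := zero_lt_one.trans_le (one_le_waveNorm k)
  rw [modeWeight, Real.rpow_add h4, waveNorm_rpow_two_mul, two_mul γ, Real.rpow_add h4,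
    ← sq (waveNorm k ^ γ)]
  refine le_add_of_nonneg_left ?_
  positivity

/-- Since wave numbers are at least one, the second part of `modeWeight` dominates the weight
without the extra power. -/
theorem IsOUFamily.subG_field (ha : IsOUFamily P ν H α lam β a) (hA : Assumptions τ ν H α lam)
    (hγ : 0 < γ) {F : Finset Mode} (hF : ∀ k ∈ F, negMode k ∉ F) {q : Mode → ℂ}
    (hq : ∀ k, ‖q k‖ ≤ waveNorm k ^ m) {σ : ℝ≥0} (hσ : ∑ k ∈ F, modeWeight α lam H γ m k ≤ σ)
    (t : ℝ) (v : Plane) :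
    SubG (fun ω => ∑ k ∈ F, q k * planeWave k v * a k t ω) (fieldConst ν H γ * σ) P := by
  have hC := ouConst_pos hA.hurst_pos
  have hν := hA.nu_pos
  refine ha.subG F hF (fun k => q k * planeWave k v) t _ ?_
  rw [NNReal.coe_mul, coe_fieldConst hν hA.hurst_pos]
  calc _ ≤ ∑ k ∈ F, 4 * ouConst H * modeWeight α lam H γ m k := by
        refine Finset.sum_le_sum fun k _ => ?_
        have h1 := hA.lam_nonneg k
        have h2 := hA.alpha_pos k
        have h3 : 1 ≤ (waveNorm k ^ γ) ^ 2 :=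
          one_le_pow₀ (Real.one_le_rpow (one_le_waveNorm k) hγ.le)
        have h4 : ‖q k‖ ^ 2 ≤ (waveNorm k ^ m) ^ 2 * (waveNorm k ^ γ) ^ 2 :=
          (pow_le_pow_left₀ (norm_nonneg _) (hq k) 2).trans
            (le_mul_of_one_le_right (by positivity) h3)
        rw [norm_mul, norm_planeWave, mul_one]
        calc _ = 4 * ouConst H * (lam k * α k ^ (-(2 * H)) * ‖q k‖ ^ 2) := by ring
          _ ≤ 4 * ouConst H * (lam k * α k ^ (-(2 * H)) *
              ((waveNorm k ^ m) ^ 2 * (waveNorm k ^ γ) ^ 2)) := by gcongr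
          _ ≤ _ := by gcongr; exact modeWeight_right_le hA k
    _ ≤ 4 * ouConst H * σ := by rw [← Finset.mul_sum]; gcongr
    _ ≤ _ := by
        have h5 : 0 ≤ ν ^ (2 * γ) := by positivity
        have h6 : 0 ≤ ouConst H * (σ : ℝ) := by positivity
        nlinarith [mul_nonneg h6 h5]

/-- The increment splits into a time increment at the point v, controlled by the first part of
`modeWeight`, and a space increment at time s, controlled by the second. The two are dependent,
hence the factor 4. -/
theorem IsOUFamily.subG_field_sub (ha : IsOUFamily P ν H α lam β a)
    (hA : Assumptions τ ν H α lam) (hγ : 0 < γ) (hγ1 : γ < 1) (hγH : γ ≤ H) {F : Finset Mode}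
    (hF : ∀ k ∈ F, negMode k ∉ F) {q : Mode → ℂ} (hq : ∀ k, ‖q k‖ ≤ waveNorm k ^ m) {σ : ℝ≥0}
    (hσ : ∑ k ∈ F, modeWeight α lam H γ m k ≤ σ) {t s : ℝ} {v w : Plane} {δ : ℝ≥0}
    (ht : |t - s| ≤ δ) (hv : ‖v - w‖ ≤ δ) :
    SubG (fun ω => ∑ k ∈ F, q k * planeWave k v * a k t ω -
      ∑ k ∈ F, q k * planeWave k w * a k s ω) (4 * (fieldConst ν H γ * σ * δ ^ (2 * γ))) P := by
  have hC := ouConst_pos hA.hurst_pos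
  have hν := hA.nu_pos
  have hν2 : 0 ≤ ν ^ (2 * γ) := by positivity
  have hσδ : 0 ≤ ouConst H * (σ : ℝ) * (δ : ℝ) ^ (2 * γ) := by positivity
  have e1 : SubG (fun ω => ∑ k ∈ F, q k * planeWave k v * (a k t ω - a k s ω))
      (fieldConst ν H γ * σ * δ ^ (2 * γ)) P := by
    refine ha.subG_sub F hF (fun k => q k * planeWave k v) s t γ _ hγ hγH ?_
    rw [NNReal.coe_mul, NNReal.coe_mul, coe_fieldConst hν hA.hurst_pos, NNReal.coe_rpow]
    calc _ ≤ ∑ k ∈ F, 4 * ouConst H * ν ^ (2 * γ) * (δ : ℝ) ^ (2 * γ) *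
          modeWeight α lam H γ m k := by
          refine Finset.sum_le_sum fun k _ => ?_
          have h1 := hA.lam_nonneg k
          have h2 := hA.alpha_pos k
          have h4 : ‖q k‖ ^ 2 ≤ (waveNorm k ^ m) ^ 2 :=
            pow_le_pow_left₀ (norm_nonneg _) (hq k) 2
          have h5 : |t - s| ^ (2 * γ) ≤ (δ : ℝ) ^ (2 * γ) := by gcongr
          rw [norm_mul, norm_planeWave, mul_one]
          calc _ = 4 * ouConst H * ν ^ (2 * γ) * |t - s| ^ (2 * γ) *
                (lam k * α k ^ (2 * γ - 2 * H) * ‖q k‖ ^ 2) := by ring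
            _ ≤ 4 * ouConst H * ν ^ (2 * γ) * (δ : ℝ) ^ (2 * γ) *
                (lam k * α k ^ (2 * γ - 2 * H) * (waveNorm k ^ m) ^ 2) := by gcongr
            _ ≤ _ := by gcongr; exact modeWeight_left_le hA k
      _ ≤ 4 * ouConst H * ν ^ (2 * γ) * (δ : ℝ) ^ (2 * γ) * σ := by
          rw [← Finset.mul_sum]; gcongr
      _ ≤ _ := by nlinarith [mul_nonneg hσδ hν2]
  have e2 : SubG (fun ω => ∑ k ∈ F, q k * (planeWave k v - planeWave k w) * a k s ω)
      (fieldConst ν H γ * σ * δ ^ (2 * γ)) P := by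
    refine ha.subG F hF (fun k => q k * (planeWave k v - planeWave k w)) s _ ?_
    rw [NNReal.coe_mul, NNReal.coe_mul, coe_fieldConst hν hA.hurst_pos, NNReal.coe_rpow]
    have hδ2 : (δ : ℝ) ^ (2 * γ) = ((δ : ℝ) ^ γ) ^ 2 := by
      rw [← Real.rpow_natCast, ← Real.rpow_mul δ.coe_nonneg]
      congr 1
      push_cast
      ring
    calc _ ≤ ∑ k ∈ F, 64 * ouConst H * (δ : ℝ) ^ (2 * γ) * modeWeight α lam H γ m k := by
          refine Finset.sum_le_sum fun k _ => ?_
          have h1 := hA.lam_nonneg k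
          have h2 := hA.alpha_pos k
          have h3 := waveNorm_nonneg k
          have h5 : ‖v - w‖ ^ γ ≤ (δ : ℝ) ^ γ := by gcongr
          have h4 : ‖q k * (planeWave k v - planeWave k w)‖ ≤
              waveNorm k ^ m * (4 * (waveNorm k ^ γ * (δ : ℝ) ^ γ)) := by
            rw [norm_mul]
            refine mul_le_mul (hq k) ?_ (norm_nonneg _) (by positivity)
            refine (norm_planeWave_sub_le_rpow hγ hγ1 k v w).trans ?_
            gcongr
          have h6 := pow_le_pow_left₀ (norm_nonneg _) h4 2
          calc _ = 4 * ouConst H * (lam k * α k ^ (-(2 * H))) *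
                ‖q k * (planeWave k v - planeWave k w)‖ ^ 2 := by ring
            _ ≤ 4 * ouConst H * (lam k * α k ^ (-(2 * H))) *
                (waveNorm k ^ m * (4 * (waveNorm k ^ γ * (δ : ℝ) ^ γ))) ^ 2 := by gcongr
            _ = 64 * ouConst H * (δ : ℝ) ^ (2 * γ) * (lam k * α k ^ (-(2 * H)) *
                ((waveNorm k ^ m) ^ 2 * (waveNorm k ^ γ) ^ 2)) := by rw [hδ2]; ring
            _ ≤ _ := by gcongr; exact modeWeight_right_le hA k
      _ ≤ 64 * ouConst H * (δ : ℝ) ^ (2 * γ) * σ := by rw [← Finset.mul_sum]; gcongr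
      _ ≤ _ := by nlinarith [mul_nonneg hσδ hν2]
  refine (e1.add e2).congr (ae_of_all _ fun ω => ?_)
  simp only
  rw [← Finset.sum_add_distrib, ← Finset.sum_sub_distrib]
  exact Finset.sum_congr rfl fun k _ => by ring

/-- The exponent 5 is the d + 2 of chaining for d = 3, one time and two space variables. -/
theorem rpow_pow_le_pow_five {γ : ℝ} {p : ℕ} (hp : 5 ≤ 2 * γ * p) {x : ℝ≥0} (hx : x ≤ 1) :
    (x ^ (2 * γ)) ^ p ≤ x ^ 5 := by
  rw [← NNReal.rpow_natCast, ← NNReal.rpow_mul, ← NNReal.rpow_natCast x 5]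
  rcases eq_or_ne x 0 with rfl | h0
  · rw [NNReal.zero_rpow (by linarith)]
    exact zero_le
  · exact NNReal.rpow_le_rpow_of_exponent_ge (pos_iff_ne_zero.2 h0) hx (by exact_mod_cast hp)

/-- The moment constant for the supremum of the random field over a time interval of unit
length. -/
noncomputable def fieldSupConst (ν H γ : ℝ) (p : ℕ) : ℝ≥0∞ :=
  chainConst 3 (2 * p) * (2 ^ (2 * p + 1) * momentConst p * (4 * fieldConst ν H γ : ℝ≥0) ^ p)

theorem fieldSupConst_ne_top {p : ℕ} (hp : p ≠ 0) : fieldSupConst ν H γ p ≠ ∞ :=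
  ENNReal.mul_ne_top (chainConst_ne_top 3 (by omega)) (ENNReal.mul_ne_top
    (ENNReal.mul_ne_top (by simp) ENNReal.coe_ne_top) (ENNReal.pow_ne_top ENNReal.coe_ne_top))

/-- Chaining over unit time and the unit square, extended to the plane by periodicity. A high moment
p makes up for the small Hölder exponent γ. -/
theorem IsOUFamily.exists_sup_bound (ha : IsOUFamily P ν H α lam β a)
    (hA : Assumptions τ ν H α lam) (hγ : 0 < γ) (hγ1 : γ < 1) (hγH : γ ≤ H) {F : Finset Mode}
    (hF : ∀ k ∈ F, negMode k ∉ F) {q : Mode → ℂ} (hq : ∀ k, ‖q k‖ ≤ waveNorm k ^ m) {σ : ℝ≥0}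
    (hσ : ∑ k ∈ F, modeWeight α lam H γ m k ≤ σ) {p : ℕ} (hp : 5 ≤ 2 * γ * p) (j : ℤ) :
    ∃ W : Ω → ℝ≥0∞, Measurable W ∧
      ∫⁻ ω, W ω ∂P ≤ fieldSupConst ν H γ p * (σ : ℝ≥0∞) ^ p ∧
      ∀ ω, ∀ t ∈ Set.Icc (j : ℝ) (j + 1), ∀ v,
        ‖∑ k ∈ F, q k * planeWave k v * a k t ω‖ₑ ^ (2 * p) ≤ W ω := by
  have hp0 : p ≠ 0 := by
    rintro rfl
    norm_num at hp
  let pt : (Fin 3 → ℝ) → Plane := fun u => ![u 1, u 2]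
  have hpt : Continuous pt := by
    refine continuous_pi fun l => ?_
    fin_cases l
    · exact continuous_apply 1
    · exact continuous_apply 2
  let X : (Fin 3 → ℝ) → Ω → ℂ := fun u ω =>
    ∑ k ∈ F, q k * planeWave k (pt u) * a k (j + u 0) ω
  have hX : ∀ u, Measurable (X u) := fun u =>
    Finset.measurable_fun_sum _ fun k _ => (ha.measurable k _).const_mul _
  have hXc : ∀ ω, Continuous fun u => X u ω := fun ω => by
    refine continuous_finsetSum _ fun k _ => ?_
    refine (continuous_const.mul ((continuous_planeWave k).comp hpt)).mul ?_
    exact (ha.continuous k ω).comp (continuous_const.add (continuous_apply 0))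
  obtain ⟨W, hW, hWi, hWb⟩ := InertialParticle.exists_sup_bound (P := P) (p := 2 * p) (by omega) hX
    (K := 2 ^ (2 * p + 1) * momentConst p * ((4 * fieldConst ν H γ * σ : ℝ≥0) : ℝ≥0∞) ^ p)
    (fun u _ => ((ha.subG_field hA hγ hF hq hσ _ _).mono
      (by rw [mul_assoc]; exact le_mul_of_one_le_left zero_le (by norm_num))).lintegral_pow_le hp0)
    (fun u hu v hv => by
      have h1 : ‖u - v‖₊ ≤ 1 := by
        refine pi_nnnorm_le_iff.2 fun l => ?_
        rw [← NNReal.coe_le_coe, coe_nnnorm, Real.norm_eq_abs, Pi.sub_apply, abs_le]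
        have := hu.1 l; have := hu.2 l; have := hv.1 l; have := hv.2 l
        simp only [Pi.zero_apply, Pi.one_apply, NNReal.coe_one] at *
        constructor <;> linarith
      have h2 := (ha.subG_field_sub hA hγ hγ1 hγH hF hq hσ (t := j + u 0) (s := j + v 0)
        (v := pt u) (w := pt v) (δ := ‖u - v‖₊) (by
          rw [add_sub_add_left_eq_sub, coe_nnnorm]
          exact norm_le_pi_norm (u - v) 0) (by
          rw [coe_nnnorm]
          refine (pi_norm_le_iff_of_nonneg (norm_nonneg _)).2 fun l => ?_
          fin_cases l
          · exact norm_le_pi_norm (u - v) 1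
          · exact norm_le_pi_norm (u - v) 2)).lintegral_pow_le hp0
      refine h2.trans ?_
      rw [mul_assoc (2 ^ (2 * p + 1) * (momentConst p : ℝ≥0∞))]
      refine mul_le_mul_right ?_ _
      have h3 : (4 * (fieldConst ν H γ * σ * ‖u - v‖₊ ^ (2 * γ))) ^ p ≤
          (4 * fieldConst ν H γ * σ) ^ p * ‖u - v‖₊ ^ 5 := by
        calc _ = (4 * fieldConst ν H γ * σ) ^ p * (‖u - v‖₊ ^ (2 * γ)) ^ p := by ring
          _ ≤ _ := mul_le_mul_right (rpow_pow_le_pow_five hp h1) _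
      have h4 : ‖u - v‖ₑ = (‖u - v‖₊ : ℝ≥0∞) := rfl
      rw [h4]
      exact_mod_cast h3)
  refine ⟨W, hW, hWi.trans_eq ?_, fun ω t ht v => ?_⟩
  · rw [fieldSupConst, ENNReal.coe_mul _ σ, mul_pow]
    ring
  · obtain ⟨w, hw, n, rfl⟩ := exists_unitCube_eq_add_latticeVec v
    have := hWb ω (hXc ω) ![t - j, w 0, w 1] ⟨fun l => ?_, fun l => ?_⟩
    · have h5 : pt ![t - j, w 0, w 1] = w := by
        funext l
        fin_cases l <;> rfl
      simp only [X, h5, Matrix.cons_val_zero, add_sub_cancel] at this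
      simpa only [planeWave_add_latticeVec] using this
    · fin_cases l
      · exact sub_nonneg.2 ht.1
      · exact hw.1 0
      · exact hw.1 1
    · fin_cases l
      · exact sub_le_iff_le_add'.2 ht.2
      · exact hw.2 0
      · exact hw.2 1

/-- With parameters of order 8^{-N}, the expectations stay summable after multiplication by 4^{Np}.
The weighted sum is then finite almost surely and bounds each of its terms, and taking 2p-th roots
gives the rate 2^{-N}. -/
theorem ae_exists_geometric_bound {p : ℕ} (hp : p ≠ 0) {W : ℕ → Ω → ℝ≥0∞}
    (hW : ∀ N, Measurable (W N)) {C : ℝ≥0∞} (hC : C ≠ ∞) {κ : ℝ≥0}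
    (h : ∀ N, ∫⁻ ω, W N ω ∂P ≤ C * ((κ * (1 / 8) ^ N : ℝ≥0) : ℝ≥0∞) ^ p) :
    ∀ᵐ ω ∂P, ∃ B : ℝ, ∀ N, ∀ x : ℂ, ‖x‖ₑ ^ (2 * p) ≤ W N ω → ‖x‖ ≤ B * (1 / 2) ^ N := by
  have h1 : ∫⁻ ω, ∑' N, ((4 ^ N : ℝ≥0) : ℝ≥0∞) ^ p * W N ω ∂P ≠ ∞ := by
    rw [lintegral_tsum fun N => ((hW N).const_mul _).aemeasurable]
    have h2 : ∀ N, ∫⁻ ω, ((4 ^ N : ℝ≥0) : ℝ≥0∞) ^ p * W N ω ∂P ≤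
        C * (κ : ℝ≥0∞) ^ p * ((1 / 2 : ℝ≥0) ^ N : ℝ≥0) := by
      intro N
      rw [lintegral_const_mul _ (hW N)]
      refine (mul_le_mul_right (h N) _).trans ?_
      have h3 : (4 ^ N : ℝ≥0) ^ p * (κ * (1 / 8) ^ N) ^ p ≤ κ ^ p * (1 / 2) ^ N := by
        have h4 : (4 ^ N : ℝ≥0) ^ p * (κ * (1 / 8) ^ N) ^ p = κ ^ p * ((1 / 2) ^ N) ^ p := by
          rw [← mul_pow, ← mul_pow, mul_left_comm, ← mul_pow]
          norm_num
        rw [h4]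
        refine mul_le_mul_right (pow_le_of_le_one zero_le ?_ hp) _
        exact pow_le_one₀ zero_le (half_le_self zero_le)
      calc _ = C * (((4 ^ N : ℝ≥0) ^ p * (κ * (1 / 8) ^ N) ^ p : ℝ≥0) : ℝ≥0∞) := by
            push_cast
            ring
        _ ≤ C * ((κ ^ p * (1 / 2) ^ N : ℝ≥0) : ℝ≥0∞) := by gcongr
        _ = _ := by push_cast; ring
    refine ne_top_of_le_ne_top ?_ (ENNReal.tsum_le_tsum h2)
    rw [ENNReal.tsum_mul_left]
    refine ENNReal.mul_ne_top (ENNReal.mul_ne_top hC (ENNReal.pow_ne_top ENNReal.coe_ne_top)) ?_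
    exact ENNReal.tsum_coe_ne_top_iff_summable.2 (NNReal.summable_geometric (by norm_num))
  filter_upwards [ae_lt_top (Measurable.tsum fun N => (hW N).const_mul _) h1] with ω hω
  refine ⟨max 1 (∑' N, ((4 ^ N : ℝ≥0) : ℝ≥0∞) ^ p * W N ω).toReal, fun N x hx => ?_⟩
  set S := ∑' N, ((4 ^ N : ℝ≥0) : ℝ≥0∞) ^ p * W N ω with hS
  set B := max 1 S.toReal
  have h5 : ((4 ^ N : ℝ≥0) : ℝ≥0∞) ^ p * ‖x‖ₑ ^ (2 * p) ≤ S :=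
    (mul_le_mul_right hx _).trans
      (ENNReal.le_tsum (f := fun N => ((4 ^ N : ℝ≥0) : ℝ≥0∞) ^ p * W N ω) N)
  have h6 : ((4 : ℝ) ^ N) ^ p * ‖x‖ ^ (2 * p) ≤ S.toReal := by
    have := ENNReal.toReal_mono hω.ne h5
    simpa using this
  have h7 : (2 ^ N * ‖x‖) ^ (2 * p) ≤ B ^ (2 * p) := by
    calc (2 ^ N * ‖x‖) ^ (2 * p) = ((4 : ℝ) ^ N) ^ p * ‖x‖ ^ (2 * p) := by
          rw [mul_pow, ← pow_mul, ← pow_mul, show (4 : ℝ) = 2 ^ 2 by norm_num, ← pow_mul]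
          congr 2
          ring
      _ ≤ B := h6.trans (le_max_right _ _)
      _ ≤ B ^ (2 * p) := le_self_pow₀ (le_max_left _ _) (by omega)
  have h8 : 2 ^ N * ‖x‖ ≤ B := le_of_pow_le_pow_left₀ (by omega) (by positivity) h7
  rw [one_div, inv_pow, ← div_eq_mul_inv, le_div_iff₀ (by positivity), mul_comm]
  exact h8

end FieldBounds

end InertialParticle

namespace InertialParticle

open scoped NNReal ENNReal

/-! ### Choice of the blocks -/

section Exhaustion

/-- Blocks of a summable family can be made as small as desired by choosing the finite sets large
enough; in this way geometric convergence is obtained without any rate in the hypotheses. -/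
theorem exists_halfModes_exhaustion {w : Mode → ℝ} (hw : Summable w) :
    ∃ (h : ℕ → Finset Mode) (κ : ℝ≥0), Monotone h ∧ h 0 = ∅ ∧ (∀ N, ∀ k ∈ h N, k ∈ halfModes) ∧
      (∀ k ∈ halfModes, ∃ N, k ∈ h N) ∧
      ∀ N, ∑ k ∈ h (N + 1) \ h N, w k ≤ ((κ * (1 / 8) ^ N : ℝ≥0) : ℝ) := by
  classical
  have h1 : ∀ N : ℕ, ∃ G : Finset Mode, ∀ t : Finset Mode, Disjoint t G →
      ∑ k ∈ t, w k ∈ Set.Iio ((1 / 8 : ℝ) ^ (N + 1)) := fun N =>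
    summable_iff_vanishing.1 hw _ (Iio_mem_nhds (by positivity))
  choose G hG using h1
  let s : ℕ → Finset Mode := fun N => (Finset.range N).biUnion fun n => G n ∪ modeSeq n
  have hs : Monotone s := fun M N hMN =>
    Finset.biUnion_subset_biUnion_of_subset_left _ (Finset.range_mono hMN)
  let h : ℕ → Finset Mode := fun N => (s N).filter (· ∈ halfModes)
  -- The first block is not small and is absorbed into κ; the summand 1 serves all later blocks.
  refine ⟨h, 1 + ∑ k ∈ h 1, ‖w k‖₊, fun M N hMN => Finset.filter_subset_filter _ (hs hMN),
    by simp [h, s], fun N k hk => (Finset.mem_filter.1 hk).2, fun k hk => ?_, fun N => ?_⟩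
  · obtain ⟨n, hn⟩ := (tendsto_modeSeq.eventually (eventually_ge_atTop {k})).exists
    refine ⟨n + 1, Finset.mem_filter.2 ⟨Finset.mem_biUnion.2 ⟨n, by simp, ?_⟩, hk⟩⟩
    exact Finset.mem_union_right _ (hn (Finset.mem_singleton_self k))
  · rcases N with _ | N
    · have h0 : h 0 = ∅ := by simp [h, s]
      rw [h0, Finset.sdiff_empty, zero_add, pow_zero, mul_one]
      push_cast
      refine le_add_of_nonneg_of_le zero_le_one (Finset.sum_le_sum fun k _ => Real.le_norm_self _)
    · have h2 : Disjoint (h (N + 1 + 1) \ h (N + 1)) (G N) := by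
        rw [Finset.disjoint_left]
        intro k hk hkG
        rw [Finset.mem_sdiff] at hk
        refine hk.2 (Finset.mem_filter.2 ⟨Finset.mem_biUnion.2 ⟨N, by simp, ?_⟩,
          (Finset.mem_filter.1 hk.1).2⟩)
        exact Finset.mem_union_left _ hkG
      refine (Set.mem_Iio.1 (hG N _ h2)).le.trans ?_
      push_cast
      refine le_mul_of_one_le_left (by positivity) ?_
      exact le_add_of_nonneg_right (Finset.sum_nonneg fun _ _ => norm_nonneg _)

end Exhaustion

/-! ### Summability of the weights -/

section Summability

variable {τ ν H γ : ℝ} {α lam : Mode → ℝ} {m : ℕ}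

/-- The exponent may be lowered because α is bounded below and wave numbers are at least one. -/
theorem summable_modeWeight (hA : Assumptions τ ν H α lam) {γ' : ℝ} (h : γ' ≤ γ)
    (hsum₁ : Summable fun k : Mode =>
      lam k * α k ^ (2 * γ - 2 * H) * waveNorm k ^ (2 * (m : ℝ)))
    (hsum₂ : Summable fun k : Mode =>
      lam k * α k ^ (-(2 * H)) * waveNorm k ^ (2 * (m : ℝ) + 2 * γ)) :
    Summable (modeWeight α lam H γ' m) := by
  obtain ⟨c, hc, hαc⟩ := hA.alpha_lower
  refine Summable.add ?_ ?_
  · refine Summable.of_nonneg_of_le (fun k => ?_) (fun k => ?_)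
      (hsum₁.mul_left (c ^ (2 * γ' - 2 * γ)))
    · have := hA.lam_nonneg k
      have := hA.alpha_pos k
      have := waveNorm_nonneg k
      positivity
    · have h1 := hA.lam_nonneg k
      have h2 := hA.alpha_pos k
      have h3 := waveNorm_nonneg k
      have h4 : α k ^ (2 * γ' - 2 * H) = α k ^ (2 * γ' - 2 * γ) * α k ^ (2 * γ - 2 * H) := by
        rw [← Real.rpow_add h2]
        congr 1
        ring
      have h5 : α k ^ (2 * γ' - 2 * γ) ≤ c ^ (2 * γ' - 2 * γ) :=
        Real.rpow_le_rpow_of_nonpos hc (hαc k) (by linarith)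
      calc _ = α k ^ (2 * γ' - 2 * γ) *
            (lam k * α k ^ (2 * γ - 2 * H) * waveNorm k ^ (2 * (m : ℝ))) := by rw [h4]; ring
        _ ≤ _ := by gcongr
  · refine Summable.of_nonneg_of_le (fun k => ?_) (fun k => ?_) hsum₂
    · have := hA.lam_nonneg k
      have := hA.alpha_pos k
      have := waveNorm_nonneg k
      positivity
    · have h1 := hA.lam_nonneg k
      have h2 := hA.alpha_pos k
      have h3 := one_le_waveNorm k
      gcongr

theorem summable_lam_mul_alpha (hA : Assumptions τ ν H α lam) (hγ : 0 < γ)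
    (hsum₂ : Summable fun k : Mode =>
      lam k * α k ^ (-(2 * H)) * waveNorm k ^ (2 * (m : ℝ) + 2 * γ)) :
    Summable fun k => lam k * α k ^ (-(2 * H)) := by
  have h0 : ∀ k, 0 ≤ lam k * α k ^ (-(2 * H)) := fun k =>
    mul_nonneg (hA.lam_nonneg k) (Real.rpow_nonneg (hA.alpha_pos k).le _)
  exact Summable.of_nonneg_of_le h0 (fun k => le_mul_of_one_le_right (h0 k)
    (Real.one_le_rpow (one_le_waveNorm k) (by positivity))) hsum₂

end Summability

/-! ### Construction of the Cᵐ-version -/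

section Version

/-- The real trigonometric polynomial `2 Re ∑ b_k e_k` on the torus. -/
noncomputable def trigSum (F : Finset Mode) (b : Mode → ℂ) (x : Torus) : ℝ :=
  2 * (∑ k ∈ F, b k * UnitAddTorus.mFourier k.1 x).re

theorem trigSum_proj (F : Finset Mode) (b : Mode → ℂ) (v : Plane) :
    trigSum F b (proj v) = waveSum F b v := by
  simp only [trigSum, waveSum, mFourier_proj]

/-- The real random field `2 Re ∑ a_k e_k`, the sum being over the union of the sets `h N`. -/
noncomputable def trigField {Ω : Type*} (h : ℕ → Finset Mode) (a : Mode → ℝ → Ω → ℂ) (t : ℝ)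
    (x : Torus) (ω : Ω) : ℝ :=
  limUnder atTop fun N => trigSum (h N) (fun k => a k t ω) x

theorem measurable_trigField {Ω : Type*} [MeasurableSpace Ω] (h : ℕ → Finset Mode)
    {a : Mode → ℝ → Ω → ℂ} (ha : ∀ k t, Measurable (a k t)) (t : ℝ) (x : Torus) :
    Measurable (trigField h a t x) := by
  refine (StronglyMeasurable.limUnder (l := atTop) fun N => ?_).measurable
  refine Measurable.stronglyMeasurable ?_
  refine Measurable.const_mul (Complex.measurable_re.comp ?_) 2
  exact Finset.measurable_fun_sum _ fun k _ => (ha k t).mul_const _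

theorem sum_range_waveSum {h : ℕ → Finset Mode} (hm : Monotone h) (h0 : h 0 = ∅) (b : Mode → ℂ)
    (v : Plane) (N : ℕ) :
    ∑ n ∈ Finset.range N, waveSum (h (n + 1) \ h n) b v = waveSum (h N) b v := by
  induction N with
  | zero => simp [h0, waveSum]
  | succ N ih =>
    rw [Finset.sum_range_succ, ih, waveSum, waveSum, waveSum, ← mul_add, ← Complex.add_re,
      add_comm, Finset.sum_sdiff (hm N.le_succ)]

/-- Geometric decay of all scalar partial derivatives makes the block series converge in Cᵐ, locally
uniformly in time; its partial sums telescope to those that define the field. -/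
theorem tendsto_trigField {b : Mode → ℝ → ℂ} (hb : ∀ k, Continuous (b k)) {h : ℕ → Finset Mode}
    (hm : Monotone h) (h0 : h 0 = ∅) {m : ℕ}
    (hB : ∀ i ≤ m, ∀ (c : Fin i → Fin 2) (j : ℤ), ∃ B : ℝ, ∀ N, ∀ t ∈ Set.Icc (j : ℝ) (j + 1),
      ∀ v, ‖∑ k ∈ h (N + 1) \ h N, waveCoeff c k * planeWave k v * b k t‖ ≤ B * (1 / 2) ^ N) :
    JointCn m (fun t v => limUnder atTop fun N => trigSum (h N) (fun k => b k t) (proj v)) ∧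
      ∀ t x, Tendsto (fun N => trigSum (h N) (fun k => b k t) x) atTop
        (𝓝 (limUnder atTop fun N => trigSum (h N) (fun k => b k t) x)) := by
  have hbd : ∀ i ≤ m, ∀ j : ℤ, ∃ u : ℕ → ℝ, Summable u ∧ ∀ N, ∀ t ∈ Set.Icc (j : ℝ) (j + 1),
      ∀ v, ‖iteratedFDeriv ℝ i (waveSum (h (N + 1) \ h N) fun k => b k t) v‖ ≤ u N := by
    intro i hi j
    choose B hB using fun c => hB i hi c j
    refine ⟨fun N => ∑ c, 2 * (B c * (1 / 2) ^ N), summable_sum fun c _ =>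
      (summable_geometric_two.mul_left _).mul_left _, fun N t ht v => ?_⟩
    refine (norm_iteratedFDeriv_waveSum_le _ _ i v).trans (Finset.sum_le_sum fun c _ => ?_)
    exact mul_le_mul_of_nonneg_left (hB c N t ht v) zero_le_two
  have hlim : ∀ t v, Tendsto (fun N => trigSum (h N) (fun k => b k t) (proj v)) atTop
      (𝓝 (∑' N, waveSum (h (N + 1) \ h N) (fun k => b k t) v)) := by
    intro t v
    obtain ⟨u, hu, hub⟩ := hbd 0 m.zero_le ⌊t⌋
    have h1 : Summable fun N => waveSum (h (N + 1) \ h N) (fun k => b k t) v := by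
      refine Summable.of_norm_bounded hu fun N => ?_
      have := hub N t ⟨Int.floor_le t, (Int.lt_floor_add_one t).le⟩ v
      rwa [norm_iteratedFDeriv_zero] at this
    have h2 := h1.hasSum.tendsto_sum_nat
    simpa only [sum_range_waveSum hm h0, trigSum_proj] using h2
  refine ⟨?_, fun t x => ?_⟩
  · have h3 := JointCn.tsum (f := fun N t v => waveSum (h (N + 1) \ h N) (fun k => b k t) v)
      (fun N => jointCn_waveSum _ (b := fun t k => b k t) hb m) hbd
    have h4 : (fun t v => limUnder atTop fun N => trigSum (h N) (fun k => b k t) (proj v)) =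
        fun t v => ∑' N, waveSum (h (N + 1) \ h N) (fun k => b k t) v := by
      funext t v
      exact (hlim t v).limUnder_eq
    rwa [h4]
  · obtain ⟨v, rfl⟩ := proj_surjective x
    rw [(hlim t v).limUnder_eq]
    exact hlim t v

/-- Convergence in L² provides an almost everywhere convergent subsequence, whose limit must be the
pointwise one. -/
theorem Lp_ae_eq_of_tendsto {S : ℕ → C(Torus, ℂ)} {f : Lp ℂ 2 torusMeasure} {g : Torus → ℂ}
    (h1 : Tendsto (fun N => ContinuousMap.toLp 2 torusMeasure ℂ (S N)) atTop (𝓝 f))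
    (h2 : ∀ x, Tendsto (fun N => S N x) atTop (𝓝 (g x))) : f =ᵐ[torusMeasure] g := by
  obtain ⟨ns, hns, h3⟩ := (tendstoInMeasure_of_tendsto_Lp h1).exists_seq_tendsto_ae
  have h4 : ∀ᵐ x ∂torusMeasure, ∀ N, ContinuousMap.toLp 2 torusMeasure ℂ (S N) x = S N x :=
    ae_all_iff.2 fun N => ContinuousMap.coeFn_toLp torusMeasure (S N)
  filter_upwards [h3, h4] with x hx hx4
  simp only [hx4] at hx
  exact tendsto_nhds_unique hx ((h2 x).comp hns.tendsto_atTop)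

open Classical in
/-- The union of `F` and `-F`. -/
noncomputable def symmModes (F : Finset Mode) : Finset Mode := F ∪ F.image negMode

theorem tendsto_symmModes {h : ℕ → Finset Mode} (hm : Monotone h)
    (hex : ∀ k ∈ halfModes, ∃ N, k ∈ h N) : Tendsto (fun N => symmModes (h N)) atTop atTop := by
  classical
  have hmono : Monotone fun N => symmModes (h N) := fun M N hMN =>
    Finset.union_subset_union (hm hMN) (Finset.image_subset_image (hm hMN))
  refine tendsto_atTop_atTop.2 fun T => ?_
  have h1 : ∀ k : Mode, ∃ N, k ∈ symmModes (h N) := fun k => by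
    by_cases hk : k ∈ halfModes
    · obtain ⟨N, hN⟩ := hex k hk
      exact ⟨N, Finset.mem_union_left _ hN⟩
    · obtain ⟨N, hN⟩ := hex _ (negMode_mem_halfModes hk)
      exact ⟨N, Finset.mem_union_right _ (Finset.mem_image.2 ⟨_, hN, negMode_negMode k⟩)⟩
  choose n hn using h1
  refine ⟨T.sup n, fun N hN k hk => ?_⟩
  exact hmono ((Finset.le_sup hk).trans hN) (hn k)

/-- Conjugate modes pair up to twice a real part, so a real field is obtained while only independent
modes are summed. -/
theorem sum_symmModes {F : Finset Mode} (hF : ∀ k ∈ F, k ∈ halfModes) {b : Mode → ℂ}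
    (hb : ∀ k, b (negMode k) = (starRingEnd ℂ) (b k)) (x : Torus) :
    ∑ k ∈ symmModes F, b k * UnitAddTorus.mFourier k.1 x = (trigSum F b x : ℂ) := by
  classical
  have hd : Disjoint F (F.image negMode) := by
    rw [Finset.disjoint_left]
    intro k hk hk2
    obtain ⟨l, hl, rfl⟩ := Finset.mem_image.1 hk2
    exact negMode_notMem_halfModes (hF l hl) (hF _ hk)
  have hinj : Function.Injective negMode := fun k l hkl => by
    rw [← negMode_negMode k, hkl, negMode_negMode]
  rw [symmModes, Finset.sum_union hd, Finset.sum_image fun k _ l _ h => hinj h]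
  have h1 : ∀ k : Mode, b (negMode k) * UnitAddTorus.mFourier (negMode k).1 x =
      (starRingEnd ℂ) (b k * UnitAddTorus.mFourier k.1 x) := fun k => by
    rw [map_mul, hb]
    congr 1
    exact UnitAddTorus.mFourier_neg
  simp only [h1]
  rw [← map_sum, Complex.add_conj, trigSum]

theorem vsum_ae_eq {b : Mode → ℂ} (hb : ∀ k, b (negMode k) = (starRingEnd ℂ) (b k))
    {h : ℕ → Finset Mode} (hm : Monotone h) (hh : ∀ N, ∀ k ∈ h N, k ∈ halfModes)
    (hex : ∀ k ∈ halfModes, ∃ N, k ∈ h N) {f : V} (hf : HasSum (fun k => b k • e k) f)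
    {g : Torus → ℝ} (hg : ∀ x, Tendsto (fun N => trigSum (h N) b x) atTop (𝓝 (g x))) :
    (f : Lp ℂ 2 torusMeasure) =ᵐ[torusMeasure] fun x => (g x : ℂ) := by
  refine Lp_ae_eq_of_tendsto
    (S := fun N => ∑ k ∈ symmModes (h N), b k • UnitAddTorus.mFourier k.1) ?_ fun x => ?_
  · have h0 : Tendsto (fun F : Finset Mode => ∑ k ∈ F, b k • e k) atTop (𝓝 f) := hf
    have h1 : Tendsto (fun N => ((∑ k ∈ symmModes (h N), b k • e k : V) : Lp ℂ 2 torusMeasure))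
        atTop (𝓝 (f : Lp ℂ 2 torusMeasure)) :=
      (continuous_subtype_val.tendsto f).comp (h0.comp (tendsto_symmModes hm hex))
    refine h1.congr fun N => ?_
    rw [map_sum, Submodule.coe_sum]
    exact Finset.sum_congr rfl fun k _ => ((ContinuousMap.toLp 2 torusMeasure ℂ).map_smul _ _).symm
  · have h2 : ∀ N, (∑ k ∈ symmModes (h N), b k • UnitAddTorus.mFourier k.1) x =
        (trigSum (h N) b x : ℂ) := fun N => by
      rw [← sum_symmModes (hh N) hb x, ContinuousMap.sum_apply]
      rfl
    simp only [h2]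
    exact (Complex.continuous_ofReal.tendsto _).comp (hg x)

variable {Ω : Type*} [MeasurableSpace Ω] {P : Measure Ω} {τ ν H γ : ℝ} {α lam : Mode → ℝ}
  {β : Mode → ℝ → Ω → ℂ} {a : Mode → ℝ → Ω → ℂ} {m : ℕ}

/-- For each partial derivative and each unit time interval the block suprema decay geometrically
almost surely; these are countably many events, so a single null set suffices. -/
theorem IsOUFamily.exists_isCmVersion (ha : IsOUFamily P ν H α lam β a)
    (hA : Assumptions τ ν H α lam) (hs : Summable fun k => lam k * α k ^ (-(2 * H)))
    (hγ : 0 < γ) (hγ1 : γ < 1) (hγH : γ ≤ H) (hw : Summable (modeWeight α lam H γ m)) :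
    ∃ Ψ : ℝ → Torus → Ω → ℝ, IsCmVersion P m (statSol a) Ψ := by
  obtain ⟨h, κ, hm, h0, hh, hex, hκ⟩ := exists_halfModes_exhaustion hw
  have hhalf : ∀ N, ∀ k ∈ h (N + 1) \ h N, negMode k ∉ h (N + 1) \ h N := fun N k hk hk2 =>
    negMode_notMem_halfModes (hh _ k (Finset.mem_sdiff.1 hk).1) (hh _ _ (Finset.mem_sdiff.1 hk2).1)
  obtain ⟨p, hp⟩ := exists_nat_ge (5 / (2 * γ))
  rw [div_le_iff₀ (by positivity), mul_comm] at hp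
  have hp0 : p ≠ 0 := by
    rintro rfl
    norm_num at hp
  have hgood : ∀ᵐ ω ∂P, ∀ i : ℕ, ∀ _ : i ≤ m, ∀ (c : Fin i → Fin 2) (j : ℤ), ∃ B : ℝ,
      ∀ N, ∀ t ∈ Set.Icc (j : ℝ) (j + 1), ∀ v,
        ‖∑ k ∈ h (N + 1) \ h N, waveCoeff c k * planeWave k v * a k t ω‖ ≤ B * (1 / 2) ^ N := by
    refine ae_all_iff.2 fun i => ae_all_iff.2 fun hi => ae_all_iff.2 fun c =>
      ae_all_iff.2 fun j => ?_
    choose W hW hWi hWb using fun N => ha.exists_sup_bound hA hγ hγ1 hγH (hhalf N)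
      (norm_waveCoeff_le hi c) (hκ N) hp j
    filter_upwards [ae_exists_geometric_bound hp0 hW (fieldSupConst_ne_top hp0) hWi] with ω hω
    obtain ⟨B, hB⟩ := hω
    exact ⟨B, fun N t ht v => hB N _ (hWb N ω t ht v)⟩
  have hlim : ∀ᵐ ω ∂P, JointCn m (fun t v => trigField h a t (proj v) ω) ∧
      ∀ t x, Tendsto (fun N => trigSum (h N) (fun k => a k t ω) x) atTop
        (𝓝 (trigField h a t x ω)) := by
    filter_upwards [hgood] with ω hω
    exact tendsto_trigField (b := fun k t => a k t ω) (fun k => ha.continuous k ω) hm h0 hω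
  refine ⟨trigField h a, measurable_trigField h ha.measurable, fun t => ?_, ?_⟩
  · filter_upwards [hlim, ha.ae_hasSum_statSol hA hs t] with ω hω hsum
    exact vsum_ae_eq (fun k => ha.conj k t ω) hm hh hex hsum (hω.2 t)
  · filter_upwards [hlim] with ω hω
    exact continuousInCn_iff_jointCn.2 hω.1

end Version

end InertialParticle

/-! ### The main theorem -/

open InertialParticle in
theorem mainTheorem4 {Ω : Type*} [MeasurableSpace Ω] (P : Measure Ω) [IsProbabilityMeasure P]
    (τ ν H : ℝ) (α lam : Mode → ℝ) (β : Mode → ℝ → Ω → ℂ)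
    (hA : Assumptions τ ν H α lam) (hβ : IsModeFBM H β P)
    (m : ℕ) (hm : 2 ≤ m) (γ : ℝ) (hγ₀ : 0 < γ) (hγ₁ : γ < 1)
    (hsum₁ : Summable fun k : Mode =>
      lam k * α k ^ (2 * γ - 2 * H) * waveNorm k ^ (2 * (m : ℝ)))
    (hsum₂ : Summable fun k : Mode =>
      lam k * α k ^ (-(2 * H)) * waveNorm k ^ (2 * (m : ℝ) + 2 * γ)) :
    (∃ ψ : ℝ → Ω → V,
      IsMildSolution P ν H α lam β ψ ∧ IsStrictlyStationary P ψ ∧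
        ∀ t, HasL2Sum P (fun k ω => statCoeff ν H α lam β t k ω • e k) (ψ t)) ∧
    ∀ ψ : ℝ → Ω → V, IsMildSolution P ν H α lam β ψ → IsStrictlyStationary P ψ →
      (∃ Ψ : ℝ → Torus → Ω → ℝ, IsCmVersion P m ψ Ψ) ∧
      ∀ Ψ : ℝ → Torus → Ω → ℝ, IsCmVersion P m ψ Ψ →
        ∀ᵐ ω ∂P, HasUniqueGlobalSolution (m - 1) τ (fun t x => Ψ t x ω) := by
  obtain ⟨a, ha⟩ := exists_isOUFamily hA hβ
  have hs := summable_lam_mul_alpha hA hγ₀ hsum₂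
  refine ⟨⟨statSol a, ha.isMildSolution hA hs, ha.isStrictlyStationary,
    ha.hasL2Sum_statSol hA hs⟩, fun ψ hψ hψs => ⟨?_, fun Ψ hΨ => ?_⟩⟩
  -- The increment bounds require an exponent at most H, so γ is replaced by min γ H.
  · obtain ⟨Ψ, h1, h2, h3⟩ := ha.exists_isCmVersion hA hs (lt_min hγ₀ hA.hurst_pos)
      ((min_le_left γ H).trans_lt hγ₁) (min_le_right γ H)
      (summable_modeWeight hA (min_le_left γ H) hsum₁ hsum₂)
    refine ⟨Ψ, h1, fun t => ?_, h3⟩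
    -- Stationary mild solutions agree almost surely at each time, so a version of one is a version
    -- of all.
    filter_upwards [h2 t, hψ.ae_eq hA hψs (ha.isMildSolution hA hs) ha.isStrictlyStationary t]
      with ω hω hω2
    rwa [hω2]
  · filter_upwards [hΨ.2.2] with ω hω
    exact hasUniqueGlobalSolution_of_continuousInCn hm hω
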